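/- Let $m,n\ge 2$ be integers with $m+n\ge 8$. Let $$C_{m,n}=\{(x,y)\in\mathbb R^m\times\mathbb R^n:\ (n-1)|x|^2=(m-1)|y|^2\}$$ be the Lawson cone, and let $E^+_{m,n}$ and $E^-_{m,n}$ be the sets where $(n-1)|x|^2<(m-1)|y|^2$ and $(n-1)|x|^2>(m-1)|y|^2$, respectively. Let $\Sigma$ be one of the two hypersurfaces $\Sigma^\pm_{m,n}$, that is, a smooth, closed, connected, embedded minimal hypersurface of $\mathbb R^{m+n}$ that is contained in $E^+_{m,n}$ or in $E^-_{m,n}$, is $O(m)\times O(n)$-invariant, satisfies $\operatorname{dist}(\Sigma,\{0\})=1$, and is asymptotic to $C_{m,n}$ at infinity. The last condition means that, up to a bounded set, $\Sigma$ is the normal graph over $\{\xi\in C_{m,n}:|\xi|>R\}$, for some $R>0$, of a smooth function that tends to $0$ at infinity. Let $\Delta_\Sigma$ be the Laplace–Beltrami operator of $\Sigma$ and $|A_\Sigma|$ the norm of its second fundamental form. Let $\gamma>0$ and let $k\ge 1$ be an integer. Then there exists $\delta_*>0$ such that for every $\delta\in(0,\delta_*]$ the Jacobi–Toda system $$\delta\big(\Delta_\Sigma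 h_j+|A_\Sigma|^2h_j\big)=\gamma\big(e^{-\sqrt2(h_j-h_{j-1})}-e^{-\sqrt2(h_{j+1}-h_j)}\big)\quad\text{on }\Sigma,\qquad 1\le j\le k,$$ with the conventions $h_0\equiv-\infty$ and $h_{k+1}\equiv+\infty$ (so that $e^{-\sqrt2(h_1-h_0)}=e^{-\sqrt2(h_{k+1}-h_k)}=0$), has a smooth solution $(h_1,\dots,h_k)$, $h_j:\Sigma\to\mathbb R$, which is $O(m)\times O(n)$-invariant and satisfies $h_1<h_2<\dots<h_k$ everywhere on $\Sigma$. -/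

import Mathlib

open scoped ContDiff

noncomputable section

namespace JacobiToda

section SubmanifoldGeometry

/-! Extrinsic geometry of a subset `M` of a Euclidean space `V` which is a smooth submanifold.
Functions on `M` are represented by functions on `V` of which only the values on `M` are used. The
derivative `fderivWithin ℝ F M p` is determined by `F` restricted to `M` on tangent vectors at `p`,
and below it is only evaluated on tangent vectors. -/

variable {V : Type*} [NormedAddCommGroup V] [InnerProductSpace ℝ V] [FiniteDimensional ℝ V]

/-- `M` is a smooth embedded hypersurface (without boundary): locally it is the zero set of a smooth
function whose differential does not vanish. -/
def IsSmoothHypersurface (M : Set V) : Prop :=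
  ∀ p ∈ M, ∃ (U : Set V) (f : V → ℝ), IsOpen U ∧ p ∈ U ∧ ContDiffOn ℝ ∞ f U ∧
    (∀ q ∈ U, fderiv ℝ f q ≠ 0) ∧ M ∩ U = {q ∈ U | f q = 0}

/-- The tangent space `T_p M`. -/
def tangentSpace (M : Set V) (p : V) : Submodule ℝ V :=
  Submodule.span ℝ (tangentConeAt ℝ M p)

/-- The orthogonal projection of `V` onto `T_p M`. -/
def tangentProj (M : Set V) (p : V) : V →L[ℝ] V :=
  (tangentSpace M p).starProjection

/-- The second fundamental form, with values in the normal space: the normal part of the derivative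
in the direction `X` of a tangent field of `M` which takes the value `Y` at `p`; the field used is
`q ↦ (orthogonal projection of Y onto T_q M)`. -/
def secondFundamentalForm (M : Set V) (p X Y : V) : V :=
  (tangentSpace M p)ᗮ.starProjection (fderivWithin ℝ (fun q => tangentProj M q Y) M p X)

/-- The mean curvature vector `∑ i, A(e i, e i)`, with `e` an orthonormal basis of `T_p M`. -/
def meanCurvatureVector (M : Set V) (p : V) : V :=
  ∑ i, secondFundamentalForm M p (stdOrthonormalBasis ℝ (tangentSpace M p) i : V)
    (stdOrthonormalBasis ℝ (tangentSpace M p) i : V)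

/-- The squared norm `|A_M|² = ∑ i j, |A(e i, e j)|²` of the second fundamental form. -/
def normSqA (M : Set V) (p : V) : ℝ :=
  ∑ i, ∑ j, ‖secondFundamentalForm M p (stdOrthonormalBasis ℝ (tangentSpace M p) i : V)
    (stdOrthonormalBasis ℝ (tangentSpace M p) j : V)‖ ^ 2

/-- The Riemannian gradient of a function on `M`. -/
def surfaceGradient (M : Set V) (u : V → ℝ) (p : V) : V :=
  tangentProj M p (gradientWithin u M p)

/-- The divergence `∑ i, ⟨e i, D_{e i} X⟩` along `M` of a vector field `X`. -/
def surfaceDivergence (M : Set V) (X : V → V) (p : V) : ℝ :=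
  ∑ i, inner ℝ (stdOrthonormalBasis ℝ (tangentSpace M p) i : V)
    (fderivWithin ℝ X M p (stdOrthonormalBasis ℝ (tangentSpace M p) i : V))

/-- The Laplace–Beltrami operator `Δ_M u = div_M ∇_M u`. -/
def laplaceBeltrami (M : Set V) (u : V → ℝ) (p : V) : ℝ :=
  surfaceDivergence M (surfaceGradient M u) p

/-- A minimal hypersurface: smooth, with vanishing mean curvature. -/
def IsMinimalHypersurface (M : Set V) : Prop :=
  IsSmoothHypersurface M ∧ ∀ p ∈ M, meanCurvatureVector M p = 0

end SubmanifoldGeometry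

section LawsonCone

/-- The Euclidean space `ℝ^m × ℝ^n`, with its Euclidean norm. -/
abbrev Space (m n : ℕ) : Type :=
  WithLp 2 (EuclideanSpace ℝ (Fin m) × EuclideanSpace ℝ (Fin n))

/-- The action of `O(m) × O(n)` on `ℝ^m × ℝ^n`. -/
def act {m n : ℕ} (σ : EuclideanSpace ℝ (Fin m) ≃ₗᵢ[ℝ] EuclideanSpace ℝ (Fin m))
    (τ : EuclideanSpace ℝ (Fin n) ≃ₗᵢ[ℝ] EuclideanSpace ℝ (Fin n)) (p : Space m n) : Space m n :=
  WithLp.toLp 2 (σ p.fst, τ p.snd)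

/-- `O(m) × O(n)`-invariance of a set. -/
def IsInvariantSet {m n : ℕ} (M : Set (Space m n)) : Prop :=
  ∀ σ τ, ∀ p ∈ M, act σ τ p ∈ M

/-- `O(m) × O(n)`-invariance of a function on `M`. -/
def IsInvariantOn {m n : ℕ} (M : Set (Space m n)) (u : Space m n → ℝ) : Prop :=
  ∀ σ τ, ∀ p ∈ M, u (act σ τ p) = u p

/-- The Lawson cone `C_{m,n}`. -/
def lawsonCone (m n : ℕ) : Set (Space m n) :=
  {p | ((n : ℝ) - 1) * ‖p.fst‖ ^ 2 = ((m : ℝ) - 1) * ‖p.snd‖ ^ 2}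

/-- The component `E⁺` of the complement of the cone. -/
def coneSidePos (m n : ℕ) : Set (Space m n) :=
  {p | ((n : ℝ) - 1) * ‖p.fst‖ ^ 2 < ((m : ℝ) - 1) * ‖p.snd‖ ^ 2}

/-- The component `E⁻` of the complement of the cone. -/
def coneSideNeg (m n : ℕ) : Set (Space m n) :=
  {p | ((m : ℝ) - 1) * ‖p.snd‖ ^ 2 < ((n : ℝ) - 1) * ‖p.fst‖ ^ 2}

/-- At `ξ = (x, y)`, the vector `((1 - n) x, (m - 1) y)`: half the gradient of the quadratic form
`(m - 1) |y|² - (n - 1) |x|²` which defines the cone. -/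
def coneGradient {m n : ℕ} (ξ : Space m n) : Space m n :=
  WithLp.toLp 2 ((1 - (n : ℝ)) • ξ.fst, ((m : ℝ) - 1) • ξ.snd)

/-- The unit normal of the cone at a point `ξ ≠ 0` of it, pointing towards `E⁺`. -/
def coneNormal {m n : ℕ} (ξ : Space m n) : Space m n :=
  ‖coneGradient ξ‖⁻¹ • coneGradient ξ

/-- `M` is asymptotic to the Lawson cone at infinity: up to a bounded set, it is the normal graph,
over the part of the cone outside a ball, of a smooth function which tends to `0` at infinity. -/
def IsAsymptoticToCone {m n : ℕ} (M : Set (Space m n)) : Prop :=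
  ∃ (R : ℝ) (w : Space m n → ℝ) (K : Set (Space m n)), 0 < R ∧ Bornology.IsBounded K ∧
    ContDiffOn ℝ ∞ w (lawsonCone m n ∩ {ξ | R < ‖ξ‖}) ∧
    Filter.Tendsto w (Bornology.cobounded (Space m n) ⊓ Filter.principal (lawsonCone m n))
      (nhds 0) ∧
    M \ K = (fun ξ => ξ + w ξ • coneNormal ξ) '' (lawsonCone m n ∩ {ξ | R < ‖ξ‖})

/-- `M` is one of the two hypersurfaces `Σ⁺_{m,n} ⊂ E⁺`, `Σ⁻_{m,n} ⊂ E⁻`: a complete (closed as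
a set), connected, smooth minimal hypersurface on one side of the Lawson cone, asymptotic to the
cone at infinity, `O(m) × O(n)`-invariant and at distance `1` from the origin. -/
structure IsLawsonLeaf {m n : ℕ} (M : Set (Space m n)) : Prop where
  side : M ⊆ coneSidePos m n ∨ M ⊆ coneSideNeg m n
  closed : IsClosed M
  connected : IsConnected M
  minimal : IsMinimalHypersurface M
  asymptotic : IsAsymptoticToCone M
  invariant : IsInvariantSet M
  dist_origin : Metric.infDist 0 M = 1

end LawsonCone

section System

/-- The interaction `e^{-√2 (h_{j+1} - h_j)}` between the sheets `j` and `j + 1`, for the sheets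
`h_1, …, h_k` and with `h_0 = -∞`, `h_{k+1} = +∞`, so that it is `0` for `j = 0` and `j = k`. -/
def interaction {X : Type*} (k : ℕ) (h : ℕ → X → ℝ) (j : ℕ) (p : X) : ℝ :=
  if 1 ≤ j ∧ j < k then Real.exp (-(√2 * (h (j + 1) p - h j p))) else 0

/-- The functions `h_1, …, h_k` on the hypersurface `M` solve the Jacobi–Toda system. -/
def SolvesJacobiToda {m n : ℕ} (M : Set (Space m n)) (δ γ : ℝ) (k : ℕ)
    (h : ℕ → Space m n → ℝ) : Prop :=
  ∀ j, 1 ≤ j → j ≤ k → ∀ p ∈ M,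
    δ * (laplaceBeltrami M (h j) p + normSqA M p * h j p) =
      γ * (interaction k h (j - 1) p - interaction k h j p)

end System

end JacobiToda

end

open JacobiToda

open JacobiToda
open Filter Topology Set

noncomputable section

namespace JacobiToda

/-! By invariance the problem lives in the quadrant with coordinates a = |x|, b = |y|, where Σ
becomes a curve Γ asymptotic to the ray spanned by (α, β), the profile of the cone. The side E⁺ is
treated; E⁻ follows by exchanging the two factors.

Geometry. Let t be the coordinate along the ray. At a critical point of t on Γ the minimal surface
equation makes the second derivative positive, so t has only nondegenerate minima. Hence a level of
t that meets Γ twice forces all higher levels to do so (`isDoubleLevel_mono`), against the single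
sheet at infinity (`not_isDoubleLevel`). So Γ is a graph over the ray, and then a graph b = g(a)
over the axis, with g even and smooth and 0 ≤ g' ≤ β/α (`exists_graph_axis`). Thus g - (β/α) a is
positive and nonincreasing, and with μ = m - 1 the difference |A|² - μ/(1 + a²) is integrable even
after multiplication by √(1 + a²) (`exists_normSqA_bound`).

Analysis. For h = H(|x|) with H vector valued, the system becomes the singular ordinary differential
equation H''/(1 + g'²) + (μ/a) H' + |A|² H = -∇Ψ(H), where Ψ is κ/√2 times the sum of e^{-√2 gap}
over the gaps, κ = γ/δ. With the exponential cut off below gap 0 the force is Lipschitz, and a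
contraction argument gives a global solution with H'(0) = 0 and prescribed H(0) (`exists_solution`).
The energy |H'|²/(2(1 + g'²)) + μ|H|²/(2(1 + a²)) + Ψ(H) is damped up to the integrable error, so it
grows at most by a factor C which does not depend on δ (`potential_le`).

Where a gap is nonpositive, Ψ is at least κ/√2. Start with all gaps equal to L, with L so large that
C times the initial Ψ is at most half of this; then take δ so small that C times the remaining
initial energy, fixed by L, is less than the other half. No gap can vanish, so the cut off is never
active (`IsProfileGraph.exists_toda_solution`). Since H is even, H(|x|) is smooth, and continuity
carries the equation to the axis. -/

section

set_option linter.unusedSectionVars false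

/-! ### Extrinsic geometry in terms of a unit normal field. -/

section Hypersurface

variable {V : Type*} [NormedAddCommGroup V] [InnerProductSpace ℝ V] [FiniteDimensional ℝ V]

/-- For v in the kernel, the implicit function theorem corrects the line p + t v in a transverse
direction n to a curve p + t v + ψ(t) n in M. Since df(v) = 0, ψ'(0) = 0, so the curve has velocity
v and v lies in the tangent cone itself. -/
theorem tangentSpace_eq_ker {M : Set V} {p : V} {f : V → ℝ} (hp : p ∈ M)
    (hf : ContDiffAt ℝ 1 f p) (h0 : fderiv ℝ f p ≠ 0)
    (hM : ∀ᶠ q in 𝓝 p, q ∈ M ↔ f q = 0) :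
    tangentSpace M p = LinearMap.ker (fderiv ℝ f p).toLinearMap := by
  have hfp : f p = 0 := hM.self_of_nhds.1 hp
  apply le_antisymm
  · refine Submodule.span_le.2 fun y hy => ?_
    have h1 : HasFDerivWithinAt f (fderiv ℝ f p) M p :=
      (hf.differentiableAt one_ne_zero).hasFDerivAt.hasFDerivWithinAt
    have h2 : HasFDerivWithinAt f (0 : V →L[ℝ] ℝ) M p := by
      refine (hasFDerivWithinAt_const (0 : ℝ) p M).congr_of_eventuallyEq ?_ hfp
      filter_upwards [mem_nhdsWithin_of_mem_nhds hM, self_mem_nhdsWithin] with q h1 h2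
      exact h1.1 h2
    simpa using h1.unique_on h2 hy
  · intro v hv
    have hv : fderiv ℝ f p v = 0 := hv
    obtain ⟨n, hn⟩ : ∃ n, fderiv ℝ f p n ≠ 0 := by
      by_contra! h
      exact h0 (ContinuousLinearMap.ext h)
    let A : ℝ × ℝ →L[ℝ] V := ContinuousLinearMap.coprod
      (ContinuousLinearMap.toSpanSingleton ℝ v) (ContinuousLinearMap.toSpanSingleton ℝ n)
    have hA : ∀ z, A z = z.1 • v + z.2 • n := fun z => by simp [A]
    let g : ℝ × ℝ → ℝ := fun z => f (p + A z)
    have hpA : p + A (0, 0) = p := by simp [hA]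
    have hg : ContDiffAt ℝ 1 g (0, 0) := by
      refine ContDiffAt.comp _ (by rw [hpA]; exact hf) ?_
      exact contDiffAt_const.add A.contDiff.contDiffAt
    have hg' : HasFDerivAt g ((fderiv ℝ f p).comp A) (0, 0) := by
      have h1 : HasFDerivAt f (fderiv ℝ f p) (p + A (0, 0)) := by
        rw [hpA]; exact (hf.differentiableAt one_ne_zero).hasFDerivAt
      exact h1.comp (0, 0) (A.hasFDerivAt.const_add p)
    have hinv : (fderiv ℝ g (0, 0) ∘L .inr ℝ ℝ ℝ).IsInvertible := by
      rw [hg'.fderiv]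
      refine ⟨ContinuousLinearEquiv.unitsEquivAut ℝ (Units.mk0 _ hn), ?_⟩
      ext
      simp [hA]
    set ψ := hg.implicitFunction one_ne_zero hinv with hψ
    have hψ0 : ψ 0 = 0 := hg.implicitFunction_apply_self one_ne_zero hinv
    have hψ1 : HasFDerivAt ψ (0 : ℝ →L[ℝ] ℝ) 0 := by
      refine (hg.hasStrictFDerivAt_implicitFunction one_ne_zero hinv).hasFDerivAt.congr_fderiv ?_
      ext
      simp [hg'.fderiv, hA, hv]
    have hev : ∀ᶠ t in 𝓝 (0 : ℝ), g (t, ψ t) = g (0, 0) :=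
      hg.eventually_apply_implicitFunction one_ne_zero hinv
    have hc : HasFDerivAt (fun t => p + A (t, ψ t))
        (ContinuousLinearMap.toSpanSingleton ℝ v) 0 := by
      have := (A.hasFDerivAt (x := ((0 : ℝ), ψ 0))).comp (0 : ℝ)
        ((hasFDerivAt_id (0 : ℝ)).prodMk hψ1)
      refine (this.const_add p).congr_fderiv ?_
      ext
      simp [hA]
    have hcM : ∀ᶠ t in 𝓝 (0 : ℝ), p + A (t, ψ t) ∈ M := by
      have h1 : Tendsto (fun t => p + A (t, ψ t)) (𝓝 0) (𝓝 p) := by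
        have := hc.continuousAt.tendsto
        simpa [hψ0, hA] using this
      filter_upwards [h1.eventually hM, hev] with t h2 h3
      refine h2.2 ?_
      have : g (0, 0) = 0 := by simp only [g, hpA, hfp]
      rw [← this, ← h3]
    set s := {t : ℝ | p + A (t, ψ t) ∈ M} with hs
    have hsn : s ∈ 𝓝 (0 : ℝ) := hcM
    have h3 := hc.hasFDerivWithinAt (s := s) |>.mapsTo_tangent_cone
    have h4 : (1 : ℝ) ∈ tangentConeAt ℝ s 0 := by
      rw [tangentConeAt_of_mem_nhds hsn]; trivial
    have h5 := h3 h4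
    simp only [hψ0, hA, zero_smul, add_zero] at h5
    refine Submodule.subset_span (tangentConeAt_mono ?_ (by simpa using h5))
    rintro _ ⟨t, ht, rfl⟩
    have : p + A (t, ψ t) ∈ M := ht
    rwa [hA] at this

/-- `ν`, with derivative `L` at `p`, is a unit field near `p` which is normal to `M` at the points
of `M`. -/
structure IsNormalAt (M : Set V) (ν : V → V) (L : V →L[ℝ] V) (p : V) : Prop where
  mem : p ∈ M
  hasFDerivAt : HasFDerivAt ν L p
  norm_eq : ∀ᶠ q in 𝓝 p, ‖ν q‖ = 1
  tangent : ∀ᶠ q in 𝓝[M] p, tangentSpace M q = (ℝ ∙ ν q)ᗮ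

theorem inner_fderiv_unit {ν : V → V} {L : V →L[ℝ] V} {p : V} (hL : HasFDerivAt ν L p)
    (h1 : ∀ᶠ q in 𝓝 p, ‖ν q‖ = 1) (X : V) : inner ℝ (ν p) (L X) = 0 := by
  have h2 := hL.inner ℝ hL
  have h3 : HasFDerivAt (fun q => inner ℝ (ν q) (ν q)) (0 : V →L[ℝ] ℝ) p := by
    refine (hasFDerivAt_const (1 : ℝ) p).congr_of_eventuallyEq ?_
    filter_upwards [h1] with q hq
    simp [hq]
  have := congrArg (fun A : V →L[ℝ] ℝ => A X) (h2.unique h3)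
  simp only [ContinuousLinearMap.comp_apply, ContinuousLinearMap.prod_apply,
    fderivInnerCLM_apply, zero_apply] at this
  rw [real_inner_comm (ν p) (L X)] at this
  linarith

/-- The trace over a hyperplane is the full trace minus the normal entry. This replaces the
unspecified basis `stdOrthonormalBasis` of a tangent space by a convenient basis of the ambient
space. -/
theorem sum_inner_orthogonal {ι κ : Type*} [Fintype ι] [Fintype κ] {T : Submodule ℝ V} {ν : V}
    (hν : ‖ν‖ = 1) (hT : T = (ℝ ∙ ν)ᗮ) (b : OrthonormalBasis κ ℝ T) (E : OrthonormalBasis ι ℝ V)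
    (A : V →L[ℝ] V) :
    ∑ i, inner ℝ (b i : V) (A (b i)) = ∑ j, inner ℝ (E j) (A (E j)) - inner ℝ ν (A ν) := by
  subst hT
  have hP : ∀ x, ((ℝ ∙ ν)ᗮ).starProjection x = x - inner ℝ ν x • ν := fun x => by
    rw [Submodule.starProjection_orthogonal_val, Submodule.starProjection_unit_singleton ℝ hν]
  have hpars : ∀ x y : V, ∑ i, inner ℝ x (b i : V) * inner ℝ (b i : V) y =
      inner ℝ x y - inner ℝ ν y * inner ℝ x ν := by
    intro x y
    have h1 := b.sum_inner_mul_inner (((ℝ ∙ ν)ᗮ).orthogonalProjectionOnto x)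
      (((ℝ ∙ ν)ᗮ).orthogonalProjectionOnto y)
    have h2 : ∀ i (z : V), inner ℝ (b i : V) z =
        inner ℝ (b i) (((ℝ ∙ ν)ᗮ).orthogonalProjectionOnto z) := fun i z =>
      (Submodule.inner_orthogonalProjectionOnto_eq_of_mem_left _ _).symm
    have h3 : ∀ i (z : V), inner ℝ z (b i : V) =
        inner ℝ (((ℝ ∙ ν)ᗮ).orthogonalProjectionOnto z) (b i) := fun i z =>
      (Submodule.inner_orthogonalProjectionOnto_eq_of_mem_right _ _).symm
    simp_rw [h2, h3, h1]
    rw [Submodule.inner_orthogonalProjectionOnto_eq_of_mem_left, ← Submodule.starProjection_apply,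
      hP, inner_sub_left, real_inner_smul_left, real_inner_comm x ν]
    ring
  have h1 : ∀ i, inner ℝ (b i : V) (A (b i)) =
      ∑ j, inner ℝ (b i : V) (E j) * inner ℝ (E j) (A (b i)) := fun i =>
    (E.sum_inner_mul_inner _ _).symm
  simp_rw [h1]
  rw [Finset.sum_comm]
  have h2 : ∀ j, ∑ i, inner ℝ (b i : V) (E j) * inner ℝ (E j) (A (b i)) =
      inner ℝ (E j) (A (E j)) - inner ℝ ν (E j) * inner ℝ (E j) (A ν) := by
    intro j
    have := hpars (A.adjoint (E j)) (E j)
    simp only [ContinuousLinearMap.adjoint_inner_left] at this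
    rw [← this]
    exact Finset.sum_congr rfl fun i _ => mul_comm _ _
  simp_rw [h2]
  rw [Finset.sum_sub_distrib, E.sum_inner_mul_inner]

/-- Derivatives within M are unique only on the tangent cone, hence by linearity on its span; there
`fderivWithin` may be computed from any differentiable extension. -/
theorem fderivWithin_apply_tangent {W : Type*} [NormedAddCommGroup W] [NormedSpace ℝ W]
    {M : Set V} {p : V} (hp : p ∈ M) {F G : V → W} {G' : V →L[ℝ] W}
    (hFG : F =ᶠ[𝓝[M] p] G) (hG : HasFDerivAt G G' p) {X : V} (hX : X ∈ tangentSpace M p) :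
    fderivWithin ℝ F M p X = G' X := by
  have h1 : HasFDerivWithinAt F G' M p :=
    hG.hasFDerivWithinAt.congr_of_eventuallyEq hFG (hFG.self_of_nhdsWithin hp)
  have h2 := h1.differentiableWithinAt.hasFDerivWithinAt.unique_on h1
  have h3 : tangentSpace M p ≤
      LinearMap.ker (fderivWithin ℝ F M p - G').toLinearMap := by
    refine Submodule.span_le.2 fun y hy => ?_
    have := h2 hy
    simp [this]
  have h4 : (fderivWithin ℝ F M p - G') X = 0 := h3 hX
  simpa [sub_eq_zero] using h4

namespace IsNormalAt

variable {M : Set V} {ν : V → V} {L : V →L[ℝ] V} {p : V} (h : IsNormalAt M ν L p)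
include h

theorem norm_self : ‖ν p‖ = 1 := h.norm_eq.self_of_nhds

theorem tangent_self : tangentSpace M p = (ℝ ∙ ν p)ᗮ := h.tangent.self_of_nhdsWithin h.mem

theorem inner_of_mem {X : V} (hX : X ∈ tangentSpace M p) : inner ℝ (ν p) X = 0 := by
  rw [h.tangent_self, Submodule.mem_orthogonal_singleton_iff_inner_right] at hX
  exact hX

theorem tangentProj_eventuallyEq :
    ∀ᶠ q in 𝓝[M] p, ∀ Y, tangentProj M q Y = Y - inner ℝ (ν q) Y • ν q := by
  filter_upwards [h.tangent, mem_nhdsWithin_of_mem_nhds h.norm_eq] with q h1 h2 Y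
  simp only [tangentProj, h1]
  rw [Submodule.starProjection_orthogonal_val, Submodule.starProjection_unit_singleton ℝ h2]

theorem secondFundamentalForm_eq {X Y : V} (hX : X ∈ tangentSpace M p)
    (hY : Y ∈ tangentSpace M p) :
    secondFundamentalForm M p X Y = -(inner ℝ (L X) Y) • ν p := by
  have h1 : HasFDerivAt (fun q => Y - inner ℝ (ν q) Y • ν q) _ p :=
    ((h.hasFDerivAt.inner ℝ (hasFDerivAt_const Y p)).smul h.hasFDerivAt).const_sub Y
  rw [secondFundamentalForm, fderivWithin_apply_tangent h.mem
    (h.tangentProj_eventuallyEq.mono fun q hq => hq Y) h1 hX]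
  have h2 : (tangentSpace M p).starProjection (ν p) = 0 := by
    rw [Submodule.starProjection_apply_eq_zero_iff, h.tangent_self,
      Submodule.orthogonal_orthogonal]
    exact Submodule.mem_span_singleton_self _
  simp [h.inner_of_mem hY, h2]

/-- The mean curvature is minus the divergence of the normal. The full divergence can be used
because ν has unit length off M too, which kills the entry ⟨ν, Lν⟩. -/
theorem meanCurvatureVector_eq {ι : Type*} [Fintype ι] (E : OrthonormalBasis ι ℝ V) :
    meanCurvatureVector M p = -(∑ i, inner ℝ (E i) (L (E i))) • ν p := by
  have h1 : ∀ i, secondFundamentalForm M p (stdOrthonormalBasis ℝ (tangentSpace M p) i : V)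
      (stdOrthonormalBasis ℝ (tangentSpace M p) i : V) =
      -(inner ℝ (stdOrthonormalBasis ℝ (tangentSpace M p) i : V)
        (L (stdOrthonormalBasis ℝ (tangentSpace M p) i))) • ν p := fun i => by
    rw [h.secondFundamentalForm_eq (Subtype.coe_prop _) (Subtype.coe_prop _), real_inner_comm]
  rw [meanCurvatureVector, Finset.sum_congr rfl fun i _ => h1 i, ← Finset.sum_smul,
    Finset.sum_neg_distrib, sum_inner_orthogonal h.norm_self h.tangent_self _ E,
    inner_fderiv_unit h.hasFDerivAt h.norm_eq, sub_zero]

/-- This is the trace of the adjoint of L composed with L over the tangent space. The normal entry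
‖Lν‖² must be removed, since the extension of ν off M is arbitrary and need not be constant along ν.
-/
theorem normSqA_eq {ι : Type*} [Fintype ι] (E : OrthonormalBasis ι ℝ V) :
    normSqA M p = ∑ i, ‖L (E i)‖ ^ 2 - ‖L (ν p)‖ ^ 2 := by
  set b := stdOrthonormalBasis ℝ (tangentSpace M p) with hb
  have h1 : ∀ i j, ‖secondFundamentalForm M p (b i : V) (b j : V)‖ ^ 2 =
      inner ℝ (L (b i)) (b j : V) ^ 2 := fun i j => by
    rw [h.secondFundamentalForm_eq (Subtype.coe_prop _) (Subtype.coe_prop _), norm_smul,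
      h.norm_self]
    simp
  have h2 : ∀ X, L X ∈ tangentSpace M p := fun X => by
    rw [h.tangent_self, Submodule.mem_orthogonal_singleton_iff_inner_right]
    exact inner_fderiv_unit h.hasFDerivAt h.norm_eq X
  have h3 : ∀ i, ∑ j, ‖secondFundamentalForm M p (b i : V) (b j : V)‖ ^ 2 =
      inner ℝ (b i : V) ((L.adjoint ∘L L) (b i)) := fun i => by
    simp_rw [h1]
    have := b.sum_sq_norm_inner_left ⟨L (b i), h2 _⟩
    simp only [Submodule.coe_inner, Real.norm_eq_abs, sq_abs, Submodule.coe_norm] at this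
    simp_rw [this]
    rw [ContinuousLinearMap.comp_apply, ContinuousLinearMap.adjoint_inner_right,
      real_inner_self_eq_norm_sq]
  rw [normSqA, Finset.sum_congr rfl fun i _ => h3 i,
    sum_inner_orthogonal h.norm_self h.tangent_self b E]
  simp only [ContinuousLinearMap.comp_apply, ContinuousLinearMap.adjoint_inner_right,
    real_inner_self_eq_norm_sq]

/-- With Z = ∇U this is the classical formula Δ_M U = ΔU - D²U(ν, ν) - (div ν) ∂_ν U; the last term
comes from differentiating the normal part removed from Z. -/
theorem laplaceBeltrami_eq {ι : Type*} [Fintype ι] (E : OrthonormalBasis ι ℝ V)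
    {u : V → ℝ} {U : V → ℝ} {Z : V → V} {Z' : V →L[ℝ] V} (hu : EqOn u U M)
    (hU : ∀ᶠ q in 𝓝 p, HasFDerivAt U (innerSL ℝ (Z q)) q) (hZ : HasFDerivAt Z Z' p) :
    laplaceBeltrami M u p = ∑ i, inner ℝ (E i) (Z' (E i)) - inner ℝ (ν p) (Z' (ν p)) -
      inner ℝ (Z p) (ν p) * ∑ i, inner ℝ (E i) (L (E i)) := by
  have h1 : surfaceGradient M u =ᶠ[𝓝[M] p] fun q => Z q - inner ℝ (ν q) (Z q) • ν q := by
    filter_upwards [h.tangentProj_eventuallyEq, mem_nhdsWithin_of_mem_nhds hU,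
      h.tangent, mem_nhdsWithin_of_mem_nhds h.norm_eq, self_mem_nhdsWithin] with q h1 h2 h3 h4 h5
    rw [surfaceGradient, ← h1, ← sub_eq_zero, ← map_sub, tangentProj,
      Submodule.starProjection_apply_eq_zero_iff, Submodule.mem_orthogonal']
    intro X hX
    rw [inner_sub_left, inner_gradientWithin_left,
      fderivWithin_apply_tangent h5 (eventuallyEq_nhdsWithin_of_eqOn hu) h2 hX]
    simp
  have h2 : HasFDerivAt (fun q => Z q - inner ℝ (ν q) (Z q) • ν q) _ p :=
    hZ.sub ((h.hasFDerivAt.inner ℝ hZ).smul h.hasFDerivAt)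
  set b := stdOrthonormalBasis ℝ (tangentSpace M p) with hb
  have h3 : ∀ i, inner ℝ (b i : V) (fderivWithin ℝ (surfaceGradient M u) M p (b i)) =
      inner ℝ (b i : V) ((Z' - inner ℝ (ν p) (Z p) • L) (b i)) := fun i => by
    rw [fderivWithin_apply_tangent h.mem h1 h2 (Subtype.coe_prop _)]
    have : inner ℝ (b i : V) (ν p) = 0 := by
      rw [real_inner_comm]; exact h.inner_of_mem (Subtype.coe_prop _)
    simp [inner_sub_right, inner_add_right, inner_smul_right, this]
  rw [laplaceBeltrami, surfaceDivergence, Finset.sum_congr rfl fun i _ => h3 i,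
    sum_inner_orthogonal h.norm_self h.tangent_self b E]
  simp only [sub_apply, smul_apply, inner_sub_right, inner_smul_right, Finset.sum_sub_distrib,
    ← Finset.mul_sum, inner_fderiv_unit h.hasFDerivAt h.norm_eq, real_inner_comm (ν p) (Z p)]
  ring

end IsNormalAt

end Hypersurface


end

/-! ### Continuity of the curvature and of the Laplace operator. -/

section

set_option linter.unusedSectionVars false
section Continuity

variable {V : Type*} [NormedAddCommGroup V] [InnerProductSpace ℝ V] [FiniteDimensional ℝ V]

theorem tangentSpace_eq_orthogonal {M : Set V} {p : V} {f : V → ℝ} {ν : V} {r : ℝ} (hp : p ∈ M)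
    (hf : ContDiffAt ℝ 1 f p) (hM : ∀ᶠ q in 𝓝 p, q ∈ M ↔ f q = 0) (hr : r ≠ 0) (hν : ν ≠ 0)
    (hfν : fderiv ℝ f p = r • innerSL ℝ ν) :
    tangentSpace M p = (ℝ ∙ ν)ᗮ := by
  have h0 : fderiv ℝ f p ≠ 0 := by
    intro h
    have := congrArg (fun A : V →L[ℝ] ℝ => A ν) (hfν.symm.trans h)
    simp [hr, hν] at this
  rw [tangentSpace_eq_ker hp hf h0 hM, hfν]
  ext X
  rw [Submodule.mem_orthogonal_singleton_iff_inner_right]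
  simp [hr]

/-- The normalized gradient of a local equation serves all points of M near p at once, so that the
formulas in ν become continuous functions of the point. -/
theorem IsSmoothHypersurface.exists_isNormalAt {M : Set V} (hM : IsSmoothHypersurface M) {p : V}
    (hp : p ∈ M) : ∃ ν : V → V, ContDiffAt ℝ ∞ ν p ∧
      ∀ᶠ q in 𝓝 p, q ∈ M → IsNormalAt M ν (fderiv ℝ ν q) q := by
  obtain ⟨U, f, hU, hpU, hf, hf0, hMU⟩ := hM p hp
  set g : V → V := fun q => (InnerProductSpace.toDual ℝ V).symm (fderiv ℝ f q) with hg
  have hfg : ∀ q, fderiv ℝ f q = innerSL ℝ (g q) := fun q => by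
    ext X
    simp [hg]
  have hg0 : ∀ q ∈ U, g q ≠ 0 := fun q hq h => hf0 q hq (by rw [hfg, h]; simp)
  have hgs : ContDiffOn ℝ ∞ g U := by
    refine (InnerProductSpace.toDual ℝ V).symm.toContinuousLinearEquiv.contDiff.comp_contDiffOn ?_
    exact hf.fderiv_of_isOpen hU (by norm_num)
  set ν : V → V := fun q => ‖g q‖⁻¹ • g q with hν
  have hνs : ContDiffOn ℝ ∞ ν U := fun q hq => by
    have h1 := hgs.contDiffAt (hU.mem_nhds hq)
    exact (((h1.norm ℝ (hg0 q hq)).inv (norm_ne_zero_iff.2 (hg0 q hq))).smul h1).contDiffWithinAt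
  have hν1 : ∀ q ∈ U, ‖ν q‖ = 1 := fun q hq => by
    simp [hν, norm_smul, hg0 q hq]
  refine ⟨ν, hνs.contDiffAt (hU.mem_nhds hpU), ?_⟩
  filter_upwards [hU.mem_nhds hpU] with q hq hqM
  refine ⟨hqM, ((hνs.contDiffAt (hU.mem_nhds hq)).differentiableAt (by simp)).hasFDerivAt, ?_, ?_⟩
  · filter_upwards [hU.mem_nhds hq] with x hx using hν1 x hx
  · filter_upwards [self_mem_nhdsWithin, mem_nhdsWithin_of_mem_nhds (hU.mem_nhds hq)] with x hxM hx
    refine tangentSpace_eq_orthogonal (f := f) (r := ‖g x‖) hxM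
      ((hf.contDiffAt (hU.mem_nhds hx)).of_le (by simp)) ?_
      (norm_ne_zero_iff.2 (hg0 x hx)) ?_ ?_
    · filter_upwards [hU.mem_nhds hx] with y hy
      have := Set.ext_iff.1 hMU y
      simp only [mem_inter_iff, mem_ofPred_eq, hy, and_true, true_and] at this
      exact this
    · intro h
      have := hν1 x hx
      simp [h] at this
    · rw [hfg x, hν]
      simp [smul_smul, hg0 x hx]

/-- Together with the continuity of the Laplacian this carries an equation verified off the axis to
the points on it. -/
theorem IsSmoothHypersurface.continuousOn_normSqA {M : Set V} (hM : IsSmoothHypersurface M) :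
    ContinuousOn (normSqA M) M := by
  intro p hp
  obtain ⟨ν, hν, hN⟩ := hM.exists_isNormalAt hp
  have h1 : ContinuousAt (fderiv ℝ ν) p :=
    (hν.fderiv_right (m := 0) (by simp)).continuousAt
  have h2 : ContinuousAt (fun q => ∑ i, ‖fderiv ℝ ν q (stdOrthonormalBasis ℝ V i)‖ ^ 2 -
      ‖fderiv ℝ ν q (ν q)‖ ^ 2) p := by
    have := hν.continuousAt
    fun_prop
  refine h2.continuousWithinAt.congr_of_eventuallyEq ?_ ?_
  · filter_upwards [mem_nhdsWithin_of_mem_nhds hN, self_mem_nhdsWithin] with q h3 h4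
    exact (h3 h4).normSqA_eq _
  · exact (hN.self_of_nhds hp).normSqA_eq _

theorem IsSmoothHypersurface.continuousOn_laplaceBeltrami {M : Set V}
    (hM : IsSmoothHypersurface M) {u : V → ℝ} (hu : ContDiff ℝ ∞ u) :
    ContinuousOn (laplaceBeltrami M u) M := by
  intro p hp
  obtain ⟨ν, hν, hN⟩ := hM.exists_isNormalAt hp
  have h1 : ContinuousAt (fderiv ℝ ν) p :=
    (hν.fderiv_right (m := 0) (by simp)).continuousAt
  set Z : V → V := fun q => (InnerProductSpace.toDual ℝ V).symm (fderiv ℝ u q) with hZ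
  have hZs : ContDiff ℝ ∞ Z :=
    (InnerProductSpace.toDual ℝ V).symm.toContinuousLinearEquiv.contDiff.comp
      (hu.fderiv_right (m := ∞) (by simp))
  have hZu : ∀ q, HasFDerivAt u (innerSL ℝ (Z q)) q := fun q => by
    refine (hu.differentiable (by simp) q).hasFDerivAt.congr_fderiv ?_
    ext X
    simp [hZ]
  have hZ' : Continuous (fderiv ℝ Z) := hZs.continuous_fderiv (by simp)
  have hZc := hZs.continuous
  have h2 : ContinuousAt (fun q =>
      ∑ i, inner ℝ (stdOrthonormalBasis ℝ V i) (fderiv ℝ Z q (stdOrthonormalBasis ℝ V i)) -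
      inner ℝ (ν q) (fderiv ℝ Z q (ν q)) - inner ℝ (Z q) (ν q) *
      ∑ i, inner ℝ (stdOrthonormalBasis ℝ V i) (fderiv ℝ ν q (stdOrthonormalBasis ℝ V i))) p := by
    have := hν.continuousAt
    fun_prop
  have h3 : ∀ q, IsNormalAt M ν (fderiv ℝ ν q) q → laplaceBeltrami M u q = _ := fun q h =>
    h.laplaceBeltrami_eq (stdOrthonormalBasis ℝ V) (fun _ _ => rfl) (Eventually.of_forall hZu)
      (hZs.differentiable (by simp) q).hasFDerivAt
  refine h2.continuousWithinAt.congr_of_eventuallyEq ?_ ?_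
  · filter_upwards [mem_nhdsWithin_of_mem_nhds hN, self_mem_nhdsWithin] with q h4 h5
    exact h3 q (h4 h5)
  · exact h3 p (hN.self_of_nhds hp)

end Continuity


end

/-! ### Vector fields depending on a radial coordinate. -/

section

instance instContinuousSMulSpace (m n : ℕ) : ContinuousSMul ℝ (Space m n) :=
  IsBoundedSMul.continuousSMul

theorem hasFDerivAt_norm_of_ne {V : Type*} [NormedAddCommGroup V] [InnerProductSpace ℝ V] {x : V}
    (hx : x ≠ 0) : HasFDerivAt (fun x : V => ‖x‖) (innerSL ℝ (‖x‖⁻¹ • x)) x := by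
  have h1 := (hasStrictFDerivAt_norm_sq x).hasFDerivAt.sqrt (by simpa using hx)
  refine (h1.congr_of_eventuallyEq (Eventually.of_forall fun y => ?_)).congr_fderiv ?_
  · simp
  · ext y
    simp [real_inner_smul_left]
    ring

theorem norm_add_sub_inner_sq {V : Type*} [NormedAddCommGroup V] [InnerProductSpace ℝ V]
    {u : V} (hu : ‖u‖ = 1) (Y : V) (α β : ℝ) :
    ‖α • u + β • (Y - (inner ℝ u Y : ℝ) • u)‖ ^ 2 =
      α ^ 2 + β ^ 2 * (‖Y‖ ^ 2 - inner ℝ u Y ^ 2) := by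
  rw [← real_inner_self_eq_norm_sq, ← real_inner_self_eq_norm_sq Y]
  have : inner ℝ u u = (1 : ℝ) := by rw [real_inner_self_eq_norm_sq, hu]; norm_num
  simp only [inner_add_left, inner_add_right, inner_sub_left, inner_sub_right,
    real_inner_smul_left, real_inner_smul_right, this, real_inner_comm u Y]
  ring

theorem norm_inv_norm_smul {V : Type*} [NormedAddCommGroup V] [InnerProductSpace ℝ V]
    {x : V} (hx : x ≠ 0) : ‖‖x‖⁻¹ • x‖ = 1 := by
  simp [norm_smul, hx]

section Radial

variable {m n : ℕ}

/-- The coordinate `e₁ |x| + e₂ |y|`. -/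
def radialCoord (e : ℝ × ℝ) (q : Space m n) : ℝ := e.1 * ‖q.fst‖ + e.2 * ‖q.snd‖

/-- The vector `(c₁ x / |x|, c₂ y / |y|)` at the point `(x, y)`. -/
def radialVector (q : Space m n) (c : ℝ × ℝ) : Space m n :=
  WithLp.toLp 2 (c.1 • ‖q.fst‖⁻¹ • q.fst, c.2 • ‖q.snd‖⁻¹ • q.snd)

/-- The derivative of the vector field `(φ₁(t) x / |x|, φ₂(t) y / |y|)`, `t = e₁ |x| + e₂ |y|`,
where `φ` has value `c` and derivative `c'`. -/
def radialDeriv (e : ℝ × ℝ) (q : Space m n) (c c' : ℝ × ℝ) (X : Space m n) : Space m n :=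
  WithLp.toLp 2
    ((c'.1 * inner ℝ (radialVector q e) X) • ‖q.fst‖⁻¹ • q.fst + (c.1 / ‖q.fst‖) •
      (X.fst - inner ℝ (‖q.fst‖⁻¹ • q.fst) X.fst • ‖q.fst‖⁻¹ • q.fst),
    (c'.2 * inner ℝ (radialVector q e) X) • ‖q.snd‖⁻¹ • q.snd + (c.2 / ‖q.snd‖) •
      (X.snd - inner ℝ (‖q.snd‖⁻¹ • q.snd) X.snd • ‖q.snd‖⁻¹ • q.snd))

theorem hasFDerivAt_fst (q : Space m n) :
    HasFDerivAt (fun q : Space m n => q.fst)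
      (WithLp.fstL 2 ℝ (EuclideanSpace ℝ (Fin m)) (EuclideanSpace ℝ (Fin n))) q :=
  (WithLp.fstL 2 ℝ _ _).hasFDerivAt

theorem hasFDerivAt_snd (q : Space m n) :
    HasFDerivAt (fun q : Space m n => q.snd)
      (WithLp.sndL 2 ℝ (EuclideanSpace ℝ (Fin m)) (EuclideanSpace ℝ (Fin n))) q :=
  (WithLp.sndL 2 ℝ _ _).hasFDerivAt

variable {q : Space m n} (hx : q.fst ≠ 0) (hy : q.snd ≠ 0)
include hx hy

theorem hasFDerivAt_radialCoord (e : ℝ × ℝ) :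
    HasFDerivAt (radialCoord e) (innerSL ℝ (radialVector q e)) q := by
  have h1 := ((hasFDerivAt_norm_of_ne hx).comp q (hasFDerivAt_fst q)).const_mul e.1
  have h2 := ((hasFDerivAt_norm_of_ne hy).comp q (hasFDerivAt_snd q)).const_mul e.2
  refine (h1.add h2).congr_fderiv ?_
  ext X
  simp [radialVector, real_inner_smul_left]

theorem norm_radialVector_sq (c : ℝ × ℝ) : ‖radialVector q c‖ ^ 2 = c.1 ^ 2 + c.2 ^ 2 := by
  rw [WithLp.prod_norm_sq_eq_of_L2]
  simp [radialVector, norm_smul, hx, hy]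

theorem inner_radialVector (c d : ℝ × ℝ) :
    inner ℝ (radialVector q c) (radialVector q d) = c.1 * d.1 + c.2 * d.2 := by
  have h1 : ‖q.fst‖ ≠ 0 := norm_ne_zero_iff.2 hx
  have h2 : ‖q.snd‖ ≠ 0 := norm_ne_zero_iff.2 hy
  simp only [radialVector, WithLp.prod_inner_apply, real_inner_smul_left, real_inner_smul_right,
    real_inner_self_eq_norm_sq]
  field_simp

/-- Both the unit normal of a rotated graph and the gradient of a function of the radial coordinate
have this form, so one differentiation yields the curvature and the Laplacian. -/
theorem hasFDerivAt_radialField {e : ℝ × ℝ} {φ : ℝ → ℝ × ℝ} {c' : ℝ × ℝ}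
    (hφ : HasDerivAt φ c' (radialCoord e q)) :
    ∃ L : Space m n →L[ℝ] Space m n,
      HasFDerivAt (fun q => radialVector q (φ (radialCoord e q))) L q ∧
      ∀ X, L X = radialDeriv e q (φ (radialCoord e q)) c' X := by
  have h1 : ‖q.fst‖ ≠ 0 := norm_ne_zero_iff.2 hx
  have h2 : ‖q.snd‖ ≠ 0 := norm_ne_zero_iff.2 hy
  have ht := hasFDerivAt_radialCoord hx hy e
  have hf := hφ.hasFDerivAt.comp q ht
  have n1 := ((hasFDerivAt_norm_of_ne hx).comp q (hasFDerivAt_fst q))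
  have n2 := ((hasFDerivAt_norm_of_ne hy).comp q (hasFDerivAt_snd q))
  have i1 := (hasDerivAt_inv h1).hasFDerivAt.comp q n1
  have i2 := (hasDerivAt_inv h2).hasFDerivAt.comp q n2
  have a1 := hf.fst.smul (i1.smul (hasFDerivAt_fst q))
  have a2 := hf.snd.smul (i2.smul (hasFDerivAt_snd q))
  have a := ((WithLp.prodContinuousLinearEquiv 2 ℝ (EuclideanSpace ℝ (Fin m))
    (EuclideanSpace ℝ (Fin n))).symm.hasFDerivAt).comp q (a1.prodMk a2)
  refine ⟨_, a, fun X => ?_⟩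
  simp only [radialDeriv]
  simp [real_inner_smul_left]
  constructor
  · match_scalars <;> field_simp <;> ring_nf
  · match_scalars <;> field_simp
    ring

omit hx hy in
/-- The standard orthonormal basis of `ℝ^m × ℝ^n`. -/
abbrev spaceBasis (m n : ℕ) : OrthonormalBasis (Fin m ⊕ Fin n) ℝ (Space m n) :=
  (EuclideanSpace.basisFun (Fin m) ℝ).prod (EuclideanSpace.basisFun (Fin n) ℝ)

/-- Besides the planar divergence, each of the m - 1 directions tangent to the sphere in x
contributes c₁/|x|, and each of the n - 1 in y contributes c₂/|y|. -/
theorem sum_inner_radialDeriv (e c c' : ℝ × ℝ) :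
    ∑ i, inner ℝ (spaceBasis m n i) (radialDeriv e q c c' (spaceBasis m n i)) =
      c'.1 * e.1 + c'.2 * e.2 + (m - 1) * (c.1 / ‖q.fst‖) + (n - 1) * (c.2 / ‖q.snd‖) := by
  have h1 : ‖q.fst‖ ≠ 0 := norm_ne_zero_iff.2 hx
  have h2 : ‖q.snd‖ ≠ 0 := norm_ne_zero_iff.2 hy
  have s1 : ∑ i, q.fst i ^ 2 = ‖q.fst‖ ^ 2 := (EuclideanSpace.real_norm_sq_eq _).symm
  have s2 : ∑ i, q.snd i ^ 2 = ‖q.snd‖ ^ 2 := (EuclideanSpace.real_norm_sq_eq _).symm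
  rw [Fintype.sum_sum_type]
  have t1 : ∀ i : Fin m, inner ℝ (spaceBasis m n (Sum.inl i))
      (radialDeriv e q c c' (spaceBasis m n (Sum.inl i))) =
      (c'.1 * e.1 - c.1 / ‖q.fst‖) * ‖q.fst‖⁻¹ ^ 2 * q.fst i ^ 2 + c.1 / ‖q.fst‖ := fun i => by
    simp [radialDeriv, radialVector, EuclideanSpace.inner_single_left,
      EuclideanSpace.inner_single_right]
    ring
  have t2 : ∀ i : Fin n, inner ℝ (spaceBasis m n (Sum.inr i))
      (radialDeriv e q c c' (spaceBasis m n (Sum.inr i))) =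
      (c'.2 * e.2 - c.2 / ‖q.snd‖) * ‖q.snd‖⁻¹ ^ 2 * q.snd i ^ 2 + c.2 / ‖q.snd‖ := fun i => by
    simp [radialDeriv, radialVector, EuclideanSpace.inner_single_left,
      EuclideanSpace.inner_single_right]
    ring
  simp_rw [t1, t2, Finset.sum_add_distrib, ← Finset.mul_sum, s1, s2]
  simp
  field_simp
  ring

theorem sum_norm_radialDeriv_sq (e c c' : ℝ × ℝ) :
    ∑ i, ‖radialDeriv e q c c' (spaceBasis m n i)‖ ^ 2 =
      (c'.1 ^ 2 + c'.2 ^ 2) * (e.1 ^ 2 + e.2 ^ 2) + (m - 1) * (c.1 / ‖q.fst‖) ^ 2 +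
        (n - 1) * (c.2 / ‖q.snd‖) ^ 2 := by
  have h1 : ‖q.fst‖ ≠ 0 := norm_ne_zero_iff.2 hx
  have h2 : ‖q.snd‖ ≠ 0 := norm_ne_zero_iff.2 hy
  have s1 : ∑ i, q.fst i ^ 2 = ‖q.fst‖ ^ 2 := (EuclideanSpace.real_norm_sq_eq _).symm
  have s2 : ∑ i, q.snd i ^ 2 = ‖q.snd‖ ^ 2 := (EuclideanSpace.real_norm_sq_eq _).symm
  rw [Fintype.sum_sum_type]
  have t1 : ∀ i : Fin m, ‖radialDeriv e q c c' (spaceBasis m n (Sum.inl i))‖ ^ 2 =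
      ((c'.1 ^ 2 + c'.2 ^ 2) * e.1 ^ 2 - (c.1 / ‖q.fst‖) ^ 2) * ‖q.fst‖⁻¹ ^ 2 * q.fst i ^ 2 +
        (c.1 / ‖q.fst‖) ^ 2 := fun i => by
    rw [WithLp.prod_norm_sq_eq_of_L2]
    simp only [radialDeriv, WithLp.toLp_fst, WithLp.toLp_snd,
      norm_add_sub_inner_sq (norm_inv_norm_smul hx), norm_add_sub_inner_sq (norm_inv_norm_smul hy)]
    simp [radialVector, EuclideanSpace.inner_single_right, real_inner_smul_left]
    ring
  have t2 : ∀ i : Fin n, ‖radialDeriv e q c c' (spaceBasis m n (Sum.inr i))‖ ^ 2 =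
      ((c'.1 ^ 2 + c'.2 ^ 2) * e.2 ^ 2 - (c.2 / ‖q.snd‖) ^ 2) * ‖q.snd‖⁻¹ ^ 2 * q.snd i ^ 2 +
        (c.2 / ‖q.snd‖) ^ 2 := fun i => by
    rw [WithLp.prod_norm_sq_eq_of_L2]
    simp only [radialDeriv, WithLp.toLp_fst, WithLp.toLp_snd,
      norm_add_sub_inner_sq (norm_inv_norm_smul hx), norm_add_sub_inner_sq (norm_inv_norm_smul hy)]
    simp [radialVector, EuclideanSpace.inner_single_right, real_inner_smul_left]
    ring
  simp_rw [t1, t2, Finset.sum_add_distrib, ← Finset.mul_sum, s1, s2]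
  simp
  field_simp
  ring

theorem radialDeriv_radialVector (e c c' d : ℝ × ℝ) :
    radialDeriv e q c c' (radialVector q d) =
      radialVector q ((e.1 * d.1 + e.2 * d.2) * c'.1, (e.1 * d.1 + e.2 * d.2) * c'.2) := by
  have h1 : ‖q.fst‖ ≠ 0 := norm_ne_zero_iff.2 hx
  have h2 : ‖q.snd‖ ≠ 0 := norm_ne_zero_iff.2 hy
  have h3 := inner_radialVector hx hy e d
  have n1 := norm_inv_norm_smul hx
  have n2 := norm_inv_norm_smul hy
  simp only [radialDeriv, h3]
  congr 2
  · simp only [radialVector, WithLp.toLp_fst, WithLp.toLp_snd, real_inner_smul_left, real_inner_smul_right,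
      real_inner_self_eq_norm_sq, n1, n2]
    match_scalars
    field_simp
    ring
  · simp only [radialVector, WithLp.toLp_fst, WithLp.toLp_snd, real_inner_smul_left, real_inner_smul_right,
      real_inner_self_eq_norm_sq, n1, n2]
    match_scalars
    field_simp
    ring

end Radial

end

/-! ### Rotated graphs: minimal surface equation, curvature and Laplacian. -/

section

theorem contDiffAt_deriv {F : Type*} [NormedAddCommGroup F] [NormedSpace ℝ F] {w : ℝ → F} {t : ℝ}
    {k l : ℕ∞ω} (hw : ContDiffAt ℝ k w t) (hl : l + 1 ≤ k) : ContDiffAt ℝ l (deriv w) t := by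
  have h1 : ContDiffAt ℝ l (fun s => fderiv ℝ w s 1) t :=
    (hw.fderiv_right hl).clm_apply contDiffAt_const
  simpa only [fderiv_apply_one_eq_deriv] using h1

theorem contDiffAt_radialCoord {m n : ℕ} {q : Space m n} (hx : q.fst ≠ 0) (hy : q.snd ≠ 0)
    (c : ℝ × ℝ) {k : ℕ∞ω} : ContDiffAt ℝ k (radialCoord c : Space m n → ℝ) q := by
  have a1 : ContDiffAt ℝ k (fun q : Space m n => q.fst) q :=
    (WithLp.fstL 2 ℝ (EuclideanSpace ℝ (Fin m)) (EuclideanSpace ℝ (Fin n))).contDiff.contDiffAt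
  have a2 : ContDiffAt ℝ k (fun q : Space m n => q.snd) q :=
    (WithLp.sndL 2 ℝ (EuclideanSpace ℝ (Fin m)) (EuclideanSpace ℝ (Fin n))).contDiff.contDiffAt
  exact (contDiffAt_const.mul (a1.norm ℝ hx)).add (contDiffAt_const.mul (a2.norm ℝ hy))

/-- `(e, d)` is an orthonormal frame of the plane. -/
structure IsFrame (e d : ℝ × ℝ) : Prop where
  left : e.1 ^ 2 + e.2 ^ 2 = 1
  right : d.1 ^ 2 + d.2 ^ 2 = 1
  orth : e.1 * d.1 + e.2 * d.2 = 0

/-- The unit normal of the graph of `w` in the frame `(e, d)` of the plane. -/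
def graphNormal (e d : ℝ × ℝ) (w : ℝ → ℝ) (t : ℝ) : ℝ × ℝ :=
  ((d.1 - deriv w t * e.1) * (√(1 + deriv w t ^ 2))⁻¹,
    (d.2 - deriv w t * e.2) * (√(1 + deriv w t ^ 2))⁻¹)

theorem graphNormal_sq {e d : ℝ × ℝ} (h : IsFrame e d) (w : ℝ → ℝ) (t : ℝ) :
    (graphNormal e d w t).1 ^ 2 + (graphNormal e d w t).2 ^ 2 = 1 := by
  have h0 : 0 < 1 + deriv w t ^ 2 := by positivity
  have h1 : (√(1 + deriv w t ^ 2))⁻¹ ^ 2 = (1 + deriv w t ^ 2)⁻¹ := by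
    rw [inv_pow, Real.sq_sqrt h0.le]
  simp only [graphNormal, mul_pow, h1]
  field_simp
  linear_combination deriv w t ^ 2 * h.left + h.right - 2 * deriv w t * h.orth

theorem inner_graphNormal {e d : ℝ × ℝ} (h : IsFrame e d) (w : ℝ → ℝ) (t : ℝ) :
    e.1 * (graphNormal e d w t).1 + e.2 * (graphNormal e d w t).2 =
      -deriv w t * (√(1 + deriv w t ^ 2))⁻¹ := by
  simp only [graphNormal]
  linear_combination (√(1 + deriv w t ^ 2))⁻¹ * (h.orth - deriv w t * h.left)

theorem hasDerivAt_graphNormal (e d : ℝ × ℝ) {w : ℝ → ℝ} {t : ℝ} (hw : ContDiffAt ℝ 2 w t) :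
    HasDerivAt (graphNormal e d w)
      (-(deriv (deriv w) t * (√(1 + deriv w t ^ 2))⁻¹ ^ 3) * (e.1 + deriv w t * d.1),
        -(deriv (deriv w) t * (√(1 + deriv w t ^ 2))⁻¹ ^ 3) * (e.2 + deriv w t * d.2)) t := by
  have h0 : 0 < 1 + deriv w t ^ 2 := by positivity
  have hs : √(1 + deriv w t ^ 2) ^ 2 = 1 + deriv w t ^ 2 := Real.sq_sqrt h0.le
  have hs0 : √(1 + deriv w t ^ 2) ≠ 0 := (Real.sqrt_pos.2 h0).ne'
  have h1 : HasDerivAt (deriv w) (deriv (deriv w) t) t := by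
    exact ((contDiffAt_deriv hw (by norm_num)).differentiableAt one_ne_zero).hasDerivAt
  have h2 : HasDerivAt (fun t => √(1 + deriv w t ^ 2)) _ t :=
    (((h1.pow 2).const_add 1).sqrt h0.ne')
  have h3 := h2.inv hs0
  refine HasDerivAt.prodMk ?_ ?_
  · refine (((h1.mul_const e.1).const_sub d.1).mul h3).congr_deriv ?_
    simp
    field_simp
    rw [hs]
    ring
  · refine (((h1.mul_const e.2).const_sub d.2).mul h3).congr_deriv ?_
    simp
    field_simp
    rw [hs]
    ring

theorem hasFDerivAt_graphEquation {m n : ℕ} {e d : ℝ × ℝ} {w : ℝ → ℝ} {q : Space m n}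
    (hx : q.fst ≠ 0) (hy : q.snd ≠ 0) (hw : ContDiffAt ℝ 2 w (radialCoord e q)) :
    HasFDerivAt (fun q : Space m n => radialCoord d q - w (radialCoord e q))
      (√(1 + deriv w (radialCoord e q) ^ 2) •
        innerSL ℝ (radialVector q (graphNormal e d w (radialCoord e q)))) q := by
  have hs0 : √(1 + deriv w (radialCoord e q) ^ 2) ≠ 0 := by positivity
  have a1 := (hw.differentiableAt (by norm_num)).hasDerivAt.hasFDerivAt.comp q
    (hasFDerivAt_radialCoord hx hy e)
  have a2 := (hasFDerivAt_radialCoord hx hy d).sub a1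
  refine a2.congr_fderiv ?_
  ext X
  have b1 : ∀ c : ℝ × ℝ, inner ℝ (radialVector q c) X =
      c.1 * inner ℝ (‖q.fst‖⁻¹ • q.fst) X.fst + c.2 * inner ℝ (‖q.snd‖⁻¹ • q.snd) X.snd :=
    fun c => by
      rw [radialVector, WithLp.prod_inner_apply]
      simp only [real_inner_smul_left]
      rfl
  simp [b1, graphNormal]
  generalize √(1 + deriv w (radialCoord e q) ^ 2) = ρ at *
  field_simp
  ring

/-- Near `p`, off the axes, `S` is the rotation of the graph of `w` in the frame `(e, d)`. -/
structure IsRadialGraphAt {m n : ℕ} (S : Set (Space m n)) (e d : ℝ × ℝ) (w : ℝ → ℝ)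
    (p : Space m n) : Prop where
  mem : p ∈ S
  fst_ne : p.fst ≠ 0
  snd_ne : p.snd ≠ 0
  frame : IsFrame e d
  contDiffAt : ContDiffAt ℝ 2 w (radialCoord e p)
  eventually : ∀ᶠ q in 𝓝 p, q ∈ S ↔ radialCoord d q = w (radialCoord e q)

namespace IsRadialGraphAt

variable {m n : ℕ} {S : Set (Space m n)} {e d : ℝ × ℝ} {w : ℝ → ℝ} {p : Space m n}
  (h : IsRadialGraphAt S e d w p)
include h

theorem exists_isNormalAt : ∃ L, IsNormalAt S
    (fun q => radialVector q (graphNormal e d w (radialCoord e q))) L p ∧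
    ∀ X, L X = radialDeriv e p (graphNormal e d w (radialCoord e p))
      (-(deriv (deriv w) (radialCoord e p) * (√(1 + deriv w (radialCoord e p) ^ 2))⁻¹ ^ 3) *
        (e.1 + deriv w (radialCoord e p) * d.1),
      -(deriv (deriv w) (radialCoord e p) * (√(1 + deriv w (radialCoord e p) ^ 2))⁻¹ ^ 3) *
        (e.2 + deriv w (radialCoord e p) * d.2)) X := by
  obtain ⟨L, hL, hLX⟩ := hasFDerivAt_radialField h.fst_ne h.snd_ne
    (hasDerivAt_graphNormal e d h.contDiffAt)
  have h1 : ∀ᶠ q : Space m n in 𝓝 p, q.fst ≠ 0 :=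
    (WithLp.continuous_fst _ _ _).continuousAt.eventually_ne h.fst_ne
  have h2 : ∀ᶠ q : Space m n in 𝓝 p, q.snd ≠ 0 :=
    (WithLp.continuous_snd _ _ _).continuousAt.eventually_ne h.snd_ne
  have hn : ∀ q : Space m n, q.fst ≠ 0 → q.snd ≠ 0 →
      ‖radialVector q (graphNormal e d w (radialCoord e q))‖ = 1 := fun q hx hy => by
    have := norm_radialVector_sq hx hy (graphNormal e d w (radialCoord e q))
    rw [graphNormal_sq h.frame] at this
    exact (sq_eq_sq₀ (norm_nonneg _) zero_le_one).1 (by rw [this, one_pow])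
  refine ⟨L, ⟨h.mem, hL, ?_, ?_⟩, hLX⟩
  · filter_upwards [h1, h2] with q hx hy using hn q hx hy
  · have h3 : ∀ᶠ q in 𝓝 p, ContDiffAt ℝ 2 w (radialCoord e q) :=
      (hasFDerivAt_radialCoord h.fst_ne h.snd_ne e).continuousAt.eventually
        (h.contDiffAt.eventually (by simp))
    filter_upwards [self_mem_nhdsWithin, mem_nhdsWithin_of_mem_nhds h1,
      mem_nhdsWithin_of_mem_nhds h2, mem_nhdsWithin_of_mem_nhds h3,
      mem_nhdsWithin_of_mem_nhds h.eventually.eventually_nhds] with q hq hx hy hw hev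
    have hs0 : √(1 + deriv w (radialCoord e q) ^ 2) ≠ 0 := by positivity
    refine tangentSpace_eq_orthogonal (f := fun q => radialCoord d q - w (radialCoord e q))
      (r := √(1 + deriv w (radialCoord e q) ^ 2)) hq ?_ ?_ hs0 ?_ ?_
    · exact ((contDiffAt_radialCoord hx hy d).sub
        (hw.comp q (contDiffAt_radialCoord hx hy e))).of_le (by norm_num)
    · simpa only [sub_eq_zero] using hev
    · intro h0
      have := hn q hx hy
      simp [h0] at this
    · exact (hasFDerivAt_graphEquation hx hy hw).fderiv

/-- This is div ν = 0 multiplied by (1 + w'²)^{3/2}. The frame is arbitrary because the profile is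
studied over the ray of the cone, across it at turning points, and over an axis. -/
theorem deriv_deriv_eq (hH : meanCurvatureVector S p = 0) :
    deriv (deriv w) (radialCoord e p) = (1 + deriv w (radialCoord e p) ^ 2) *
      ((m - 1) * (d.1 - deriv w (radialCoord e p) * e.1) / ‖p.fst‖ +
        (n - 1) * (d.2 - deriv w (radialCoord e p) * e.2) / ‖p.snd‖) := by
  obtain ⟨L, hN, hL⟩ := h.exists_isNormalAt
  have h1 := hN.meanCurvatureVector_eq (spaceBasis m n)
  rw [hH] at h1
  have h2 := (smul_eq_zero.1 h1.symm).resolve_right fun h0 => by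
    have := hN.norm_self
    simp [h0] at this
  simp_rw [hL] at h2
  rw [sum_inner_radialDeriv h.fst_ne h.snd_ne, neg_eq_zero] at h2
  simp only [graphNormal] at h2
  have hx : ‖p.fst‖ ≠ 0 := norm_ne_zero_iff.2 h.fst_ne
  have hy : ‖p.snd‖ ≠ 0 := norm_ne_zero_iff.2 h.snd_ne
  have h0 : 0 < 1 + deriv w (radialCoord e p) ^ 2 := by positivity
  have hs : √(1 + deriv w (radialCoord e p) ^ 2) ^ 2 = 1 + deriv w (radialCoord e p) ^ 2 :=
    Real.sq_sqrt h0.le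
  have hs0 : √(1 + deriv w (radialCoord e p) ^ 2) ≠ 0 := (Real.sqrt_pos.2 h0).ne'
  generalize √(1 + deriv w (radialCoord e p) ^ 2) = ρ at *
  generalize deriv w (radialCoord e p) = w1 at *
  rw [← hs]
  generalize deriv (deriv w) (radialCoord e p) = w2 at *
  have hfr : (e.1 + w1 * d.1) * e.1 + (e.2 + w1 * d.2) * e.2 = 1 := by
    linear_combination h.frame.left + w1 * h.frame.orth
  have h3 : -(w2 * ρ⁻¹ ^ 3) * ((e.1 + w1 * d.1) * e.1 + (e.2 + w1 * d.2) * e.2) +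
      (m - 1) * ((d.1 - w1 * e.1) * ρ⁻¹ / ‖p.fst‖) +
      (n - 1) * ((d.2 - w1 * e.2) * ρ⁻¹ / ‖p.snd‖) = 0 := by
    rw [← h2]; ring
  rw [hfr] at h3
  field_simp at h3 ⊢
  linear_combination -h3

/-- The sum of the squares of the principal curvatures: that of the planar curve once, and those of
the two rotations with multiplicities m - 1 and n - 1. -/
theorem normSqA_eq : normSqA S p =
    deriv (deriv w) (radialCoord e p) ^ 2 / (1 + deriv w (radialCoord e p) ^ 2) ^ 3 +
      ((m - 1) * ((d.1 - deriv w (radialCoord e p) * e.1) / ‖p.fst‖) ^ 2 +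
        (n - 1) * ((d.2 - deriv w (radialCoord e p) * e.2) / ‖p.snd‖) ^ 2) /
          (1 + deriv w (radialCoord e p) ^ 2) := by
  obtain ⟨L, hN, hL⟩ := h.exists_isNormalAt
  have hip := inner_graphNormal h.frame w (radialCoord e p)
  rw [hN.normSqA_eq (spaceBasis m n)]
  simp_rw [hL]
  rw [sum_norm_radialDeriv_sq h.fst_ne h.snd_ne, radialDeriv_radialVector h.fst_ne h.snd_ne,
    norm_radialVector_sq h.fst_ne h.snd_ne, h.frame.left, hip]
  simp only [graphNormal]
  have hx : ‖p.fst‖ ≠ 0 := norm_ne_zero_iff.2 h.fst_ne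
  have hy : ‖p.snd‖ ≠ 0 := norm_ne_zero_iff.2 h.snd_ne
  have h0 : 0 < 1 + deriv w (radialCoord e p) ^ 2 := by positivity
  have hs : √(1 + deriv w (radialCoord e p) ^ 2) ^ 2 = 1 + deriv w (radialCoord e p) ^ 2 :=
    Real.sq_sqrt h0.le
  have hs0 : √(1 + deriv w (radialCoord e p) ^ 2) ≠ 0 := (Real.sqrt_pos.2 h0).ne'
  have hfr : (e.1 + deriv w (radialCoord e p) * d.1) ^ 2 +
      (e.2 + deriv w (radialCoord e p) * d.2) ^ 2 = √(1 + deriv w (radialCoord e p) ^ 2) ^ 2 := by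
    rw [hs]
    linear_combination h.frame.left + deriv w (radialCoord e p) ^ 2 * h.frame.right +
      2 * deriv w (radialCoord e p) * h.frame.orth
  generalize √(1 + deriv w (radialCoord e p) ^ 2) = ρ at *
  generalize deriv w (radialCoord e p) = w1 at *
  rw [← hs]
  generalize deriv (deriv w) (radialCoord e p) = w2 at *
  have h3 : (-(w2 * ρ⁻¹ ^ 3) * (e.1 + w1 * d.1)) ^ 2 +
      (-(w2 * ρ⁻¹ ^ 3) * (e.2 + w1 * d.2)) ^ 2 = w2 ^ 2 / ρ ^ 4 := by
    have : (-(w2 * ρ⁻¹ ^ 3) * (e.1 + w1 * d.1)) ^ 2 + (-(w2 * ρ⁻¹ ^ 3) * (e.2 + w1 * d.2)) ^ 2 =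
      w2 ^ 2 * ρ⁻¹ ^ 6 * ((e.1 + w1 * d.1) ^ 2 + (e.2 + w1 * d.2) ^ 2) := by ring
    rw [this, hfr]
    field_simp
  rw [mul_pow (-w1 * ρ⁻¹), mul_pow (-w1 * ρ⁻¹), ← mul_add, h3]
  field_simp
  linear_combination w2 ^ 2 * ‖p.fst‖ ^ 2 * ‖p.snd‖ ^ 2 * hs

/-- Minimality removes the term (div ν) ∂_ν U, and subtracting D²U(ν, ν) multiplies H'' by 1 -
w'²/(1 + w'²) = 1/(1 + w'²). -/
theorem laplaceBeltrami_eq (hH : meanCurvatureVector S p = 0) {u : Space m n → ℝ} {H : ℝ → ℝ}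
    (hu : EqOn u (fun q => H (radialCoord e q)) S) (hH2 : ContDiffAt ℝ 2 H (radialCoord e p)) :
    laplaceBeltrami S u p =
      deriv (deriv H) (radialCoord e p) / (1 + deriv w (radialCoord e p) ^ 2) +
      deriv H (radialCoord e p) * ((m - 1) * e.1 / ‖p.fst‖ + (n - 1) * e.2 / ‖p.snd‖) := by
  obtain ⟨L, hN, hL⟩ := h.exists_isNormalAt
  have hν0 := hN.norm_self
  have h1 := hN.meanCurvatureVector_eq (spaceBasis m n)
  rw [hH] at h1
  have h2 := (smul_eq_zero.1 h1.symm).resolve_right fun h0 => by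
    simp [h0] at hν0
  rw [neg_eq_zero] at h2
  have hd : HasDerivAt (deriv H) (deriv (deriv H) (radialCoord e p)) (radialCoord e p) :=
    ((contDiffAt_deriv hH2 (by norm_num)).differentiableAt one_ne_zero).hasDerivAt
  have hφ : HasDerivAt (fun t => (deriv H t * e.1, deriv H t * e.2))
      (deriv (deriv H) (radialCoord e p) * e.1, deriv (deriv H) (radialCoord e p) * e.2)
      (radialCoord e p) := (hd.mul_const _).prodMk (hd.mul_const _)
  obtain ⟨Z', hZ, hZX⟩ := hasFDerivAt_radialField h.fst_ne h.snd_ne hφ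
  have hU : ∀ᶠ q : Space m n in 𝓝 p, HasFDerivAt (fun q => H (radialCoord e q))
      (innerSL ℝ (radialVector q
        (deriv H (radialCoord e q) * e.1, deriv H (radialCoord e q) * e.2))) q := by
    have h1 : ∀ᶠ q : Space m n in 𝓝 p, q.fst ≠ 0 :=
      (WithLp.continuous_fst _ _ _).continuousAt.eventually_ne h.fst_ne
    have h2 : ∀ᶠ q : Space m n in 𝓝 p, q.snd ≠ 0 :=
      (WithLp.continuous_snd _ _ _).continuousAt.eventually_ne h.snd_ne
    have h3 : ∀ᶠ q in 𝓝 p, ContDiffAt ℝ 2 H (radialCoord e q) :=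
      (hasFDerivAt_radialCoord h.fst_ne h.snd_ne e).continuousAt.eventually
        (hH2.eventually (by simp))
    filter_upwards [h1, h2, h3] with q hx hy hHq
    refine ((hHq.differentiableAt (by norm_num)).hasDerivAt.hasFDerivAt.comp q
      (hasFDerivAt_radialCoord hx hy e)).congr_fderiv ?_
    ext X
    simp [radialVector, real_inner_smul_left]
    ring
  rw [hN.laplaceBeltrami_eq (spaceBasis m n) hu hU hZ, h2]
  simp_rw [hZX]
  have hip := inner_graphNormal h.frame w (radialCoord e p)
  rw [sum_inner_radialDeriv h.fst_ne h.snd_ne, radialDeriv_radialVector h.fst_ne h.snd_ne,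
    inner_radialVector h.fst_ne h.snd_ne, hip]
  have hx : ‖p.fst‖ ≠ 0 := norm_ne_zero_iff.2 h.fst_ne
  have hy : ‖p.snd‖ ≠ 0 := norm_ne_zero_iff.2 h.snd_ne
  have h0 : 0 < 1 + deriv w (radialCoord e p) ^ 2 := by positivity
  have hs : √(1 + deriv w (radialCoord e p) ^ 2) ^ 2 = 1 + deriv w (radialCoord e p) ^ 2 :=
    Real.sq_sqrt h0.le
  have hs0 : √(1 + deriv w (radialCoord e p) ^ 2) ≠ 0 := (Real.sqrt_pos.2 h0).ne'
  generalize √(1 + deriv w (radialCoord e p) ^ 2) = ρ at *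
  generalize deriv w (radialCoord e p) = w1 at *
  rw [← hs]
  generalize deriv (deriv H) (radialCoord e p) = H2 at *
  generalize deriv H (radialCoord e p) = H1 at *
  generalize (graphNormal e d w (radialCoord e p)) = N at *
  have h4 : H2 * e.1 * e.1 + H2 * e.2 * e.2 = H2 := by linear_combination H2 * h.frame.left
  have h5 : N.1 * (-w1 * ρ⁻¹ * (H2 * e.1)) + N.2 * (-w1 * ρ⁻¹ * (H2 * e.2)) =
      H2 * w1 ^ 2 * ρ⁻¹ ^ 2 := by
    linear_combination (-w1 * ρ⁻¹ * H2) * hip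
  simp only [h4, h5]
  field_simp
  linear_combination H2 * ‖p.fst‖ * ‖p.snd‖ * hs

end IsRadialGraphAt


end

/-! ### Planar profiles and their local structure relative to the ray of the cone. -/

section

theorem two_le_infty : (2 : ℕ∞ω) ≤ ∞ := ENat.LEInfty.out

/-- The inner product of the plane. -/
def dot (e z : ℝ × ℝ) : ℝ := e.1 * z.1 + e.2 * z.2

@[fun_prop]
theorem continuous_dot (e : ℝ × ℝ) : Continuous (dot e) := by
  unfold dot; fun_prop

/-- The point with coordinates `(t, s)` in the frame `(e, d)`. -/
def framePoint (e d : ℝ × ℝ) (t s : ℝ) : ℝ × ℝ := (t * e.1 + s * d.1, t * e.2 + s * d.2)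

namespace IsFrame

variable {e d : ℝ × ℝ} (h : IsFrame e d)
include h

theorem symm : IsFrame d e :=
  ⟨h.right, h.left, by linear_combination h.orth⟩

theorem dot_left (t s : ℝ) : dot e (framePoint e d t s) = t := by
  simp only [dot, framePoint]
  linear_combination t * h.left + s * h.orth

theorem dot_right (t s : ℝ) : dot d (framePoint e d t s) = s := by
  simp only [dot, framePoint]
  linear_combination s * h.right + t * h.orth

theorem det_sq : (e.1 * d.2 - e.2 * d.1) ^ 2 = 1 := by
  linear_combination (d.1 ^ 2 + d.2 ^ 2) * h.left + h.right - (e.1 * d.1 + e.2 * d.2) * h.orth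

theorem ext_dot {z z' : ℝ × ℝ} (h1 : dot e z = dot e z') (h2 : dot d z = dot d z') : z = z' := by
  have h0 : e.1 * d.2 - e.2 * d.1 ≠ 0 := fun h0 => by
    have := h.det_sq
    simp [h0] at this
  simp only [dot] at h1 h2
  ext
  · refine mul_left_cancel₀ h0 ?_
    linear_combination d.2 * h1 - e.2 * h2
  · refine mul_left_cancel₀ h0 ?_
    linear_combination e.1 * h2 - d.1 * h1

theorem framePoint_dot (z : ℝ × ℝ) : framePoint e d (dot e z) (dot d z) = z :=
  h.ext_dot (h.dot_left _ _) (h.dot_right _ _)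

/-- The implicit function theorem in the coordinates of the frame; the last relation, obtained by
differentiating F along the graph, determines its slope. -/
theorem exists_graph {Γ : Set (ℝ × ℝ)} {z : ℝ × ℝ} (hz : z ∈ Γ) {F : ℝ × ℝ → ℝ}
    (hF : ContDiffAt ℝ ∞ F z) (hΓ : ∀ᶠ q in 𝓝 z, q ∈ Γ ↔ F q = 0) (hd : fderiv ℝ F z d ≠ 0) :
    ∃ w : ℝ → ℝ, ContDiffAt ℝ ∞ w (dot e z) ∧ w (dot e z) = dot d z ∧
      (∀ᶠ q in 𝓝 z, q ∈ Γ ↔ dot d q = w (dot e q)) ∧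
      fderiv ℝ F z e + deriv w (dot e z) * fderiv ℝ F z d = 0 := by
  have hFz : F z = 0 := hΓ.self_of_nhds.1 hz
  let A : ℝ × ℝ →L[ℝ] ℝ × ℝ := ContinuousLinearMap.coprod
    (ContinuousLinearMap.toSpanSingleton ℝ e) (ContinuousLinearMap.toSpanSingleton ℝ d)
  have hA : ∀ v, A v = framePoint e d v.1 v.2 := fun v => by
    ext <;> simp [A, framePoint]
  set v0 : ℝ × ℝ := (dot e z, dot d z) with hv0
  have hAz : A v0 = z := by rw [hA]; exact h.framePoint_dot z
  set g : ℝ × ℝ → ℝ := fun v => F (A v) with hg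
  have hgs : ContDiffAt ℝ ∞ g v0 :=
    ContDiffAt.comp _ (by rw [hAz]; exact hF) A.contDiff.contDiffAt
  have hg' : HasFDerivAt g ((fderiv ℝ F z).comp A) v0 := by
    have h1 : HasFDerivAt F (fderiv ℝ F z) (A v0) := by
      rw [hAz]; exact (hF.differentiableAt (by simp)).hasFDerivAt
    exact h1.comp v0 A.hasFDerivAt
  have hAe : ∀ t, A (t, 0) = t • e := fun t => by simp [A]
  have hAd : ∀ t, A (0, t) = t • d := fun t => by simp [A]
  have hinv : (fderiv ℝ g v0 ∘L .inr ℝ ℝ ℝ).IsInvertible := by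
    rw [hg'.fderiv]
    refine ⟨ContinuousLinearEquiv.unitsEquivAut ℝ (Units.mk0 _ hd), ?_⟩
    ext
    simp [hAd]
  have hne : (∞ : ℕ∞ω) ≠ 0 := by simp
  set w := hgs.implicitFunction hne hinv with hw
  have hw0 : w (dot e z) = dot d z := hgs.implicitFunction_apply_self hne hinv
  have hgv : g v0 = 0 := by simp only [hg, hAz, hFz]
  have hw1 : ContDiffAt ℝ ∞ w (dot e z) := hgs.contDiffAt_implicitFunction hne hinv
  refine ⟨w, hw1, hw0, ?_, ?_⟩
  · have h1 : ∀ᶠ v in 𝓝 v0, g v = g v0 ↔ w v.1 = v.2 :=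
      hgs.eventually_apply_eq_iff_implicitFunction hne hinv
    have h2 : Tendsto (fun q => (dot e q, dot d q)) (𝓝 z) (𝓝 v0) :=
      ((continuous_dot e).prodMk (continuous_dot d)).tendsto z
    filter_upwards [hΓ, h2.eventually h1] with q h3 h4
    have h5 : g (dot e q, dot d q) = F q := by
      simp only [hg, hA]; rw [h.framePoint_dot]
    rw [h5, hgv] at h4
    rw [h3, h4, eq_comm]
  · have h1 : ∀ᶠ t in 𝓝 (dot e z), g (t, w t) = g v0 :=
      hgs.eventually_apply_implicitFunction hne hinv
    have h2 : HasDerivAt w (deriv w (dot e z)) (dot e z) :=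
      (hw1.differentiableAt (by simp)).hasDerivAt
    have h3 : HasDerivAt (fun t => (t, w t)) ((1 : ℝ), deriv w (dot e z)) (dot e z) :=
      (hasDerivAt_id _).prodMk h2
    have h4 : HasFDerivAt g ((fderiv ℝ F z).comp A) (dot e z, w (dot e z)) := by
      rw [hw0]; exact hg'
    have h5 := h4.comp_hasDerivAt (dot e z) h3
    have h6 : HasDerivAt (g ∘ fun t => (t, w t)) 0 (dot e z) :=
      (hasDerivAt_const (dot e z) (g v0)).congr_of_eventuallyEq h1
    have h7 := h5.unique h6
    have h8 : A (1, deriv w (dot e z)) = e + deriv w (dot e z) • d := by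
      simp [A]
    rw [ContinuousLinearMap.comp_apply, h8, map_add, map_smul] at h7
    simpa using h7

end IsFrame

/-- The profile in the plane of a rotationally symmetric minimal hypersurface which is asymptotic
to a cone, with one sheet at infinity. The ray of the cone is spanned by `(α, β)`; the weights `μ`
and `ν` are the dimensions of the two rotated spheres. -/
structure IsProfile (μ ν α β : ℝ) (Γ : Set (ℝ × ℝ)) : Prop where
  pos_left : 0 < μ
  pos_right : 0 < ν
  cone_left : 0 < α
  cone_right : 0 < β
  cone_unit : α ^ 2 + β ^ 2 = 1
  cone_eq : ν * α ^ 2 = μ * β ^ 2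
  closed : IsClosed Γ
  neg_fst : ∀ a b, (a, b) ∈ Γ → (-a, b) ∈ Γ
  neg_snd : ∀ a b, (a, b) ∈ Γ → (a, -b) ∈ Γ
  connected : IsPreconnected ((fun z : ℝ × ℝ => (|z.1|, |z.2|)) '' Γ)
  exists_eq : ∀ z ∈ Γ, ∃ F : ℝ × ℝ → ℝ, ContDiffAt ℝ ∞ F z ∧ fderiv ℝ F z ≠ 0 ∧
    (z.1 = 0 → fderiv ℝ F z (1, 0) = 0) ∧ (z.2 = 0 → fderiv ℝ F z (0, 1) = 0) ∧
    ∀ᶠ q in 𝓝 z, q ∈ Γ ↔ F q = 0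
  ode : ∀ z ∈ Γ, 0 < z.1 → 0 < z.2 → ∀ (e d : ℝ × ℝ) (w : ℝ → ℝ), IsFrame e d →
    ContDiffAt ℝ 2 w (dot e z) → (∀ᶠ q in 𝓝 z, q ∈ Γ ↔ dot d q = w (dot e q)) →
    deriv (deriv w) (dot e z) = (1 + deriv w (dot e z) ^ 2) *
      (μ * (d.1 - deriv w (dot e z) * e.1) / z.1 + ν * (d.2 - deriv w (dot e z) * e.2) / z.2)
  -- The function describing the end of Σ is not assumed invariant, so each pair of directions
  -- leaves its own trace on the plane. `𝒲` collects these traces and `w₀` belongs to the plane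
  -- itself. A far point lies on the trace of `w₀` unless some trace reaches an axis.
  asymptotic : ∃ (R B : ℝ) (𝒲 : Set (ℝ → ℝ)) (w₀ : ℝ → ℝ), w₀ ∈ 𝒲 ∧
    (∀ w ∈ 𝒲, ContinuousOn w (Ioi R) ∧ Tendsto w atTop (𝓝 0) ∧
      ∀ t > R, (α * t - β * w t, β * t + α * w t) ∈ Γ) ∧
    ∀ z ∈ Γ, 0 ≤ z.1 → 0 ≤ z.2 → B < α * z.1 + β * z.2 →
      (∃ w ∈ 𝒲, ∃ t > R, α * t - β * w t ≤ 0 ∨ β * t + α * w t ≤ 0) ∨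
      ∃ t > R, z = (α * t - β * w₀ t, β * t + α * w₀ t)

namespace IsProfile

variable {μ ν α β : ℝ} {Γ : Set (ℝ × ℝ)} (h : IsProfile μ ν α β Γ)
include h

theorem frame : IsFrame (α, β) (-β, α) :=
  ⟨h.cone_unit, by simpa [add_comm] using h.cone_unit, by simp; ring⟩

/-- The profile near a point of the closed quadrant is a graph over the ray of the cone, or it has
a nondegenerate minimum of the coordinate along the ray. -/
theorem local_structure {z : ℝ × ℝ} (hz : z ∈ Γ) (h1 : 0 ≤ z.1) (h2 : 0 < z.2) :
    (∃ w : ℝ → ℝ, ContDiffAt ℝ ∞ w (dot (α, β) z) ∧ w (dot (α, β) z) = dot (-β, α) z ∧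
      (∀ᶠ q in 𝓝 z, q ∈ Γ ↔ dot (-β, α) q = w (dot (α, β) q)) ∧
      (z.1 = 0 → deriv w (dot (α, β) z) = -β / α)) ∨
    (0 < z.1 ∧ ∃ τ : ℝ → ℝ, ContDiffAt ℝ ∞ τ (dot (-β, α) z) ∧
      τ (dot (-β, α) z) = dot (α, β) z ∧
      (∀ᶠ q in 𝓝 z, q ∈ Γ ↔ dot (α, β) q = τ (dot (-β, α) q)) ∧
      deriv τ (dot (-β, α) z) = 0 ∧ 0 < deriv (deriv τ) (dot (-β, α) z)) := by
  obtain ⟨F, hF, hF0, hFa, -, hΓ⟩ := h.exists_eq z hz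
  have hα := h.cone_left
  have hβ := h.cone_right
  have hlin : ∀ c : ℝ × ℝ, fderiv ℝ F z c =
      c.1 * fderiv ℝ F z (1, 0) + c.2 * fderiv ℝ F z (0, 1) := fun c => by
    have : c = c.1 • ((1, 0) : ℝ × ℝ) + c.2 • ((0, 1) : ℝ × ℝ) := by ext <;> simp
    conv_lhs => rw [this]
    rw [map_add, map_smul, map_smul, smul_eq_mul, smul_eq_mul]
  have hnz : fderiv ℝ F z (1, 0) ≠ 0 ∨ fderiv ℝ F z (0, 1) ≠ 0 := by
    by_contra! hc
    refine hF0 (ContinuousLinearMap.ext fun c => ?_)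
    rw [hlin, hc.1, hc.2]; simp
  by_cases hd : fderiv ℝ F z (-β, α) = 0
  · right
    have he : fderiv ℝ F z (α, β) ≠ 0 := by
      intro he
      rw [hlin] at hd he
      simp only at hd he
      have e1 : fderiv ℝ F z (1, 0) = 0 := by
        linear_combination α * he - β * hd - fderiv ℝ F z (1, 0) * h.cone_unit
      have e2 : fderiv ℝ F z (0, 1) = 0 := by
        linear_combination β * he + α * hd - fderiv ℝ F z (0, 1) * h.cone_unit
      simp [e1, e2] at hnz
    obtain ⟨τ, t1, t2, t3, t4⟩ := h.frame.symm.exists_graph hz hF hΓ he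
    rw [hd, zero_add] at t4
    -- No turning point lies on the axis: there the first partial derivative of F vanishes, so
    -- vanishing along (-β, α) would give dF = 0.
    have t5 := (mul_eq_zero.1 t4).resolve_right he
    have hz1 : 0 < z.1 := by
      refine lt_of_le_of_ne h1 fun h0 => ?_
      have e1 := hFa h0.symm
      rw [hlin, e1] at hd
      simp [hα.ne'] at hd
      simp [e1, hd] at hnz
    refine ⟨hz1, τ, t1, t2, t3, t5, ?_⟩
    -- With τ' = 0 the equation reads τ'' = μα/z₁ + νβ/z₂, which is positive because the ray points
    -- into the open quadrant.
    rw [h.ode z hz hz1 h2 _ _ τ h.frame.symm (t1.of_le two_le_infty) t3, t5]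
    have := h.pos_left
    have := h.pos_right
    simp
    positivity
  · left
    obtain ⟨w, t1, t2, t3, t4⟩ := h.frame.exists_graph hz hF hΓ hd
    refine ⟨w, t1, t2, t3, fun h0 => ?_⟩
    have e1 := hFa h0
    have e2 : fderiv ℝ F z (0, 1) ≠ 0 := by
      intro e2; simp [e1, e2] at hnz
    rw [hlin (α, β), hlin (-β, α), e1] at t4
    simp only [mul_zero, zero_add, ← mul_assoc, ← add_mul] at t4
    have := (mul_eq_zero.1 t4).resolve_right e2
    field_simp
    linear_combination this

end IsProfile

end

/-! ### Turning points and levels met twice by the profile. -/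

section

/-- At a nondegenerate critical point with positive second derivative, a function is strictly
monotone on both sides. -/
theorem exists_strictMonoOn_strictAntiOn {τ : ℝ → ℝ} {s : ℝ} (hτ : ContDiffAt ℝ 2 τ s)
    (h1 : deriv τ s = 0) (h2 : 0 < deriv (deriv τ) s) :
    ∃ ε > 0, StrictMonoOn τ (Icc s (s + ε)) ∧ StrictAntiOn τ (Icc (s - ε) s) ∧
      ContinuousOn τ (Icc (s - ε) (s + ε)) := by
  have h3 : HasDerivAt (deriv τ) (deriv (deriv τ) s) s :=
    ((contDiffAt_deriv hτ (by norm_num)).differentiableAt one_ne_zero).hasDerivAt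
  have h4 : ∀ᶠ y in 𝓝[≠] s, 0 < slope (deriv τ) s y :=
    (hasDerivAt_iff_tendsto_slope.1 h3).eventually (lt_mem_nhds h2)
  have h5 : ∀ᶠ y in 𝓝 s, y ≠ s → 0 < slope (deriv τ) s y := eventually_nhdsWithin_iff.1 h4
  have h6 : ∀ᶠ y in 𝓝 s, ContDiffAt ℝ 2 τ y := hτ.eventually (by simp)
  obtain ⟨ε, hε, h7⟩ := Metric.eventually_nhds_iff.1 (h5.and h6)
  have hsub : ∀ y ∈ Icc (s - ε / 2) (s + ε / 2), dist y s < ε := fun y hy => by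
    rw [Real.dist_eq, abs_lt]
    constructor <;> linarith [hy.1, hy.2]
  have hc : ContinuousOn τ (Icc (s - ε / 2) (s + ε / 2)) := fun y hy =>
    (h7 (hsub y hy)).2.continuousAt.continuousWithinAt
  refine ⟨ε / 2, by positivity, ?_, ?_, hc⟩
  · refine strictMonoOn_of_deriv_pos (convex_Icc _ _)
      (hc.mono (Icc_subset_Icc (by linarith) le_rfl)) fun y hy => ?_
    rw [interior_Icc] at hy
    have := (h7 (hsub y ⟨by linarith [hy.1], hy.2.le⟩)).1 hy.1.ne'
    rw [slope_def_field, h1, sub_zero] at this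
    exact (div_pos_iff_of_pos_right (sub_pos.2 hy.1)).1 this
  · refine strictAntiOn_of_deriv_neg (convex_Icc _ _)
      (hc.mono (Icc_subset_Icc le_rfl (by linarith))) fun y hy => ?_
    rw [interior_Icc] at hy
    have := (h7 (hsub y ⟨hy.1.le, by linarith [hy.2]⟩)).1 hy.2.ne
    rw [slope_def_field, h1, sub_zero] at this
    by_contra! h0
    exact absurd this (not_lt.2 (div_nonpos_of_nonneg_of_nonpos h0 (sub_nonpos.2 hy.2.le)))

/-- The part of a profile in the first quadrant. -/
def quadrantPart (Γ : Set (ℝ × ℝ)) : Set (ℝ × ℝ) := {z ∈ Γ | 0 ≤ z.1 ∧ 0 < z.2}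

/-- Some level of the coordinate along `e` meets the profile in two points. -/
def IsDoubleLevel (e : ℝ × ℝ) (Γ : Set (ℝ × ℝ)) (t : ℝ) : Prop :=
  ∃ z ∈ quadrantPart Γ, ∃ z' ∈ quadrantPart Γ, z ≠ z' ∧ dot e z = t ∧ dot e z' = t

theorem continuous_framePoint_comp {e d : ℝ × ℝ} {a b : ℝ → ℝ} {t : ℝ} (ha : ContinuousAt a t)
    (hb : ContinuousAt b t) : ContinuousAt (fun s => framePoint e d (a s) (b s)) t := by
  unfold framePoint; fun_prop

namespace IsProfile

variable {μ ν α β : ℝ} {Γ : Set (ℝ × ℝ)} (h : IsProfile μ ν α β Γ)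
include h

/-- Where the profile is a graph over the ray of the cone, the points of the graph above the base
point are in the quadrant, and also those below unless the base point is on the axis. -/
theorem graph_mem_quadrantPart {z : ℝ × ℝ} (hz : z ∈ quadrantPart Γ) {w : ℝ → ℝ}
    (hw : ContDiffAt ℝ ∞ w (dot (α, β) z)) (hwz : w (dot (α, β) z) = dot (-β, α) z)
    (hΓ : ∀ᶠ q in 𝓝 z, q ∈ Γ ↔ dot (-β, α) q = w (dot (α, β) q))
    (h0 : z.1 = 0 → deriv w (dot (α, β) z) = -β / α) :
    ∀ᶠ t in 𝓝 (dot (α, β) z),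
      ((dot (α, β) z ≤ t ∨ 0 < z.1) → framePoint (α, β) (-β, α) t (w t) ∈ quadrantPart Γ) ∧
      (z.1 = 0 → t < dot (α, β) z → (framePoint (α, β) (-β, α) t (w t)).1 < 0) := by
  have hα := h.cone_left
  have hβ := h.cone_right
  have hc : ContinuousAt (fun t => framePoint (α, β) (-β, α) t (w t)) (dot (α, β) z) :=
    continuous_framePoint_comp continuousAt_id hw.continuousAt
  have hcz : framePoint (α, β) (-β, α) (dot (α, β) z) (w (dot (α, β) z)) = z := by
    rw [hwz]; exact h.frame.framePoint_dot z
  have hc' : Tendsto (fun t => framePoint (α, β) (-β, α) t (w t)) (𝓝 (dot (α, β) z)) (𝓝 z) := by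
    have := hc.tendsto
    rwa [hcz] at this
  have e1 : ∀ᶠ t in 𝓝 (dot (α, β) z), framePoint (α, β) (-β, α) t (w t) ∈ Γ := by
    filter_upwards [hc'.eventually hΓ] with t ht
    rw [ht, h.frame.dot_left, h.frame.dot_right]
  have e2 : ∀ᶠ t in 𝓝 (dot (α, β) z), 0 < (framePoint (α, β) (-β, α) t (w t)).2 :=
    hc'.eventually (continuous_snd.continuousAt.eventually (lt_mem_nhds hz.2.2))
  rcases hz.2.1.lt_or_eq with hz1 | hz1
  · have e3 : ∀ᶠ t in 𝓝 (dot (α, β) z), 0 < (framePoint (α, β) (-β, α) t (w t)).1 :=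
      hc'.eventually (continuous_fst.continuousAt.eventually (lt_mem_nhds hz1))
    filter_upwards [e1, e2, e3] with t a1 a2 a3
    exact ⟨fun _ => ⟨a1, a3.le, a2⟩, fun a => absurd a hz1.ne'⟩
  -- At an axis point the first coordinate has derivative α + β²/α > 0 along the graph, so it has
  -- the sign of the difference of levels: the graph enters the quadrant upwards and leaves it
  -- downwards.
  · have d1 : HasDerivAt (fun t => (framePoint (α, β) (-β, α) t (w t)).1)
        (1 * α + (-β / α) * (-β)) (dot (α, β) z) := by
      have := (hw.differentiableAt (by simp)).hasDerivAt
      rw [h0 hz1.symm] at this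
      exact ((hasDerivAt_id _).mul_const _).add (this.mul_const _)
    have d2 : 0 < 1 * α + (-β / α) * (-β) := by
      have : 1 * α + (-β / α) * (-β) = α + β ^ 2 / α := by ring
      rw [this]; positivity
    have d3 := eventually_nhdsWithin_iff.1
      ((hasDerivAt_iff_tendsto_slope.1 d1).eventually (lt_mem_nhds d2))
    filter_upwards [e1, e2, d3] with t a1 a2 a3
    rcases lt_trichotomy t (dot (α, β) z) with ht | ht | ht
    · refine ⟨fun a => ?_, fun _ _ => ?_⟩
      · rcases a with a | a
        · exact absurd ht (not_lt.2 a)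
        · exact absurd a hz1.not_lt
      · have := a3 ht.ne
        rw [slope_def_field, hcz, ← hz1, sub_zero] at this
        by_contra! hn
        exact absurd this (not_lt.2 (div_nonpos_of_nonneg_of_nonpos hn (by linarith)))
    · rw [ht, hcz]
      exact ⟨fun _ => hz, fun _ a => absurd a (lt_irrefl _)⟩
    · refine ⟨fun _ => ⟨a1, ?_, a2⟩, fun _ a => absurd a (not_lt.2 ht.le)⟩
      have := a3 ht.ne'
      rw [slope_def_field, hcz, ← hz1, sub_zero] at this
      exact ((div_pos_iff_of_pos_right (by linarith)).1 this).le

theorem turn_mem_quadrantPart {z : ℝ × ℝ} (hz : z ∈ quadrantPart Γ) (hz1 : 0 < z.1) {τ : ℝ → ℝ}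
    (hτ : ContDiffAt ℝ ∞ τ (dot (-β, α) z)) (hτz : τ (dot (-β, α) z) = dot (α, β) z)
    (hΓ : ∀ᶠ q in 𝓝 z, q ∈ Γ ↔ dot (α, β) q = τ (dot (-β, α) q)) {O : Set (ℝ × ℝ)}
    (hO : O ∈ 𝓝 z) :
    ∀ᶠ s in 𝓝 (dot (-β, α) z), framePoint (α, β) (-β, α) (τ s) s ∈ quadrantPart Γ ∩ O := by
  have hc : ContinuousAt (fun s => framePoint (α, β) (-β, α) (τ s) s) (dot (-β, α) z) :=
    continuous_framePoint_comp hτ.continuousAt continuousAt_id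
  have hcz : framePoint (α, β) (-β, α) (τ (dot (-β, α) z)) (dot (-β, α) z) = z := by
    rw [hτz]; exact h.frame.framePoint_dot z
  have hc' : Tendsto (fun s => framePoint (α, β) (-β, α) (τ s) s) (𝓝 (dot (-β, α) z)) (𝓝 z) := by
    have := hc.tendsto
    rwa [hcz] at this
  filter_upwards [hc'.eventually hΓ, hc'.eventually hO,
    hc'.eventually (continuous_fst.continuousAt.eventually (lt_mem_nhds hz1)),
    hc'.eventually (continuous_snd.continuousAt.eventually (lt_mem_nhds hz.2.2))] with t a1 a2 a3 a4
  rw [h.frame.dot_left, h.frame.dot_right] at a1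
  exact ⟨⟨a1.2 rfl, a3.le, a4⟩, a2⟩

/-- Both branches of a nondegenerate minimum reach every slightly higher level, by the intermediate
value theorem on each side; above the minimum the two points differ. -/
theorem exists_turn_pair {z : ℝ × ℝ} (hz : z ∈ quadrantPart Γ) (hz1 : 0 < z.1) {τ : ℝ → ℝ}
    (hτ : ContDiffAt ℝ ∞ τ (dot (-β, α) z)) (hτz : τ (dot (-β, α) z) = dot (α, β) z)
    (hΓ : ∀ᶠ q in 𝓝 z, q ∈ Γ ↔ dot (α, β) q = τ (dot (-β, α) q))
    (hτ1 : deriv τ (dot (-β, α) z) = 0) (hτ2 : 0 < deriv (deriv τ) (dot (-β, α) z))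
    {O : Set (ℝ × ℝ)} (hO : O ∈ 𝓝 z) :
    ∀ᶠ t in 𝓝[≥] (dot (α, β) z), ∃ z1 ∈ quadrantPart Γ ∩ O, ∃ z2 ∈ quadrantPart Γ ∩ O,
      dot (α, β) z1 = t ∧ dot (α, β) z2 = t ∧ (dot (α, β) z < t → z1 ≠ z2) := by
  obtain ⟨ε, hε, hm, ha, hcτ⟩ := exists_strictMonoOn_strictAntiOn (hτ.of_le two_le_infty) hτ1 hτ2
  obtain ⟨ε', hε', hev⟩ :=
    Metric.eventually_nhds_iff.1 (h.turn_mem_quadrantPart hz hz1 hτ hτz hΓ hO)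
  set s := dot (-β, α) z with hs
  set η := min ε (ε' / 2) with hη
  have hη0 : 0 < η := lt_min hε (by positivity)
  have hηε : η ≤ ε := min_le_left _ _
  have hηε' : η < ε' := (min_le_right _ _).trans_lt (by linarith)
  have hr : τ s < τ (s + η) := hm ⟨le_rfl, by linarith⟩ ⟨by linarith, by linarith⟩ (by linarith)
  have hl : τ s < τ (s - η) := ha ⟨by linarith, by linarith⟩ ⟨by linarith, le_rfl⟩ (by linarith)
  rw [← hτz]
  have hnear : ∀ x ∈ Icc (s - η) (s + η), dist x s < ε' := fun x hx => by
    rw [Real.dist_eq, abs_lt]; constructor <;> linarith [hx.1, hx.2]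
  filter_upwards [Ico_mem_nhdsGE (lt_min hr hl)] with t ht
  obtain ⟨x1, hx1, e1⟩ := intermediate_value_Icc (by linarith : s ≤ s + η)
    (hcτ.mono (Icc_subset_Icc (by linarith) (by linarith)))
    ⟨ht.1, ht.2.le.trans (min_le_left _ _)⟩
  obtain ⟨x2, hx2, e2⟩ := intermediate_value_Icc' (by linarith : s - η ≤ s)
    (hcτ.mono (Icc_subset_Icc (by linarith) (by linarith)))
    ⟨ht.1, ht.2.le.trans (min_le_right _ _)⟩
  refine ⟨_, hev (hnear x1 ⟨by linarith [hx1.1], hx1.2⟩), _,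
    hev (hnear x2 ⟨hx2.1, by linarith [hx2.2]⟩), ?_, ?_, fun hlt hne => ?_⟩
  · rw [h.frame.dot_left, e1]
  · rw [h.frame.dot_left, e2]
  · have h3 := congrArg (dot (-β, α)) hne
    rw [h.frame.dot_right, h.frame.dot_right] at h3
    have : x1 = s := le_antisymm (h3.le.trans hx2.2) hx1.1
    rw [← e1, this] at hlt
    exact lt_irrefl _ hlt

/-- Near each of its points the profile meets the levels just above. -/
theorem exists_above {z : ℝ × ℝ} (hz : z ∈ quadrantPart Γ) {O : Set (ℝ × ℝ)} (hO : O ∈ 𝓝 z) :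
    ∀ᶠ t in 𝓝[≥] (dot (α, β) z), ∃ z' ∈ quadrantPart Γ ∩ O, dot (α, β) z' = t := by
  rcases h.local_structure hz.1 hz.2.1 hz.2.2 with ⟨w, w1, w2, w3, w4⟩ | ⟨hz1, τ, t1, t2, t3, t4, t5⟩
  · have hc : ContinuousAt (fun t => framePoint (α, β) (-β, α) t (w t)) (dot (α, β) z) :=
      continuous_framePoint_comp continuousAt_id w1.continuousAt
    have hcz : framePoint (α, β) (-β, α) (dot (α, β) z) (w (dot (α, β) z)) = z := by
      rw [w2]; exact h.frame.framePoint_dot z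
    have hO' : ∀ᶠ t in 𝓝 (dot (α, β) z), framePoint (α, β) (-β, α) t (w t) ∈ O :=
      hc (by simp only [hcz]; exact hO)
    filter_upwards [mem_nhdsWithin_of_mem_nhds (h.graph_mem_quadrantPart hz w1 w2 w3 w4),
      mem_nhdsWithin_of_mem_nhds hO', self_mem_nhdsWithin] with t a1 a2 a3
    exact ⟨_, ⟨a1.1 (Or.inl a3), a2⟩, h.frame.dot_left _ _⟩
  · filter_upwards [h.exists_turn_pair hz hz1 t1 t2 t3 t4 t5 hO] with t ⟨z1, a1, _, _, a2, _⟩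
    exact ⟨z1, a1, a2⟩

/-- Near each of its points the profile meets the levels at or below in at most one point. -/
theorem eventually_unique_below {z : ℝ × ℝ} (hz : z ∈ quadrantPart Γ) :
    ∃ O ∈ 𝓝 z, ∀ z1 ∈ Γ ∩ O, ∀ z2 ∈ Γ ∩ O, dot (α, β) z1 = dot (α, β) z2 →
      dot (α, β) z1 ≤ dot (α, β) z → z1 = z2 := by
  rcases h.local_structure hz.1 hz.2.1 hz.2.2 with ⟨w, w1, w2, w3, w4⟩ | ⟨hz1, τ, t1, t2, t3, t4, t5⟩
  · refine ⟨_, w3, fun z1 h1 z2 h2 h3 _ => h.frame.ext_dot h3 ?_⟩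
    rw [h1.2.1 h1.1, h2.2.1 h2.1, h3]
  · obtain ⟨ε, hε, hm, ha, -⟩ := exists_strictMonoOn_strictAntiOn (t1.of_le two_le_infty) t4 t5
    have hev : ∀ᶠ q in 𝓝 z, dist (dot (-β, α) q) (dot (-β, α) z) < ε :=
      (continuous_dot _).continuousAt.eventually (Metric.ball_mem_nhds _ hε)
    refine ⟨_, t3.and hev, ?_⟩
    -- Strict monotonicity of τ on both sides leaves the turning point as the only nearby point at
    -- or below its level.
    have key : ∀ z1 ∈ Γ ∩ {q | (q ∈ Γ ↔ dot (α, β) q = τ (dot (-β, α) q)) ∧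
        dist (dot (-β, α) q) (dot (-β, α) z) < ε},
        dot (α, β) z1 ≤ dot (α, β) z → dot (-β, α) z1 = dot (-β, α) z := by
      intro z1 h1 h2
      have e1 := h1.2.1.1 h1.1
      have e2 := h1.2.2
      rw [Real.dist_eq, abs_lt] at e2
      rw [e1, ← t2] at h2
      rcases lt_trichotomy (dot (-β, α) z1) (dot (-β, α) z) with hlt | heq | hlt
      · exact absurd h2 (not_le.2 (ha ⟨by linarith, hlt.le⟩ ⟨by linarith, le_rfl⟩ hlt))
      · exact heq
      · exact absurd h2 (not_le.2 (hm ⟨le_rfl, by linarith⟩ ⟨hlt.le, by linarith⟩ hlt))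
    intro z1 h1 z2 h2 h3 h4
    exact h.frame.ext_dot h3 ((key z1 h1 h4).trans (key z2 h2 (h3 ▸ h4)).symm)

/-- Each of the two points continues upwards inside its own neighbourhood, and disjoint
neighbourhoods keep the continuations apart. -/
theorem isDoubleLevel_eventually_right {t : ℝ} (ht : IsDoubleLevel (α, β) Γ t) :
    ∀ᶠ s in 𝓝[≥] t, IsDoubleLevel (α, β) Γ s := by
  obtain ⟨z, hz, z', hz', hne, h1, h2⟩ := ht
  obtain ⟨O, O', hO, hO', hd⟩ := t2_separation_nhds hne
  have e1 := h.exists_above hz hO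
  have e2 := h.exists_above hz' hO'
  rw [h1] at e1
  rw [h2] at e2
  filter_upwards [e1, e2] with s ⟨a, ha, hs⟩ ⟨b, hb, hs'⟩
  exact ⟨a, ha.1, b, hb.1, fun hab => hd.le_bot ⟨ha.2, hab ▸ hb.2⟩, hs, hs'⟩

end IsProfile

end

/-! ### Topology of the quadrant part and persistence of double levels. -/

section

namespace IsProfile

variable {μ ν α β : ℝ} {Γ : Set (ℝ × ℝ)} (h : IsProfile μ ν α β Γ)
  (hs : ∀ z ∈ Γ, β * |z.1| < α * |z.2|)
include h hs

theorem snd_ne_zero {z : ℝ × ℝ} (hz : z ∈ Γ) : z.2 ≠ 0 := fun h0 => by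
  have := hs z hz
  rw [h0, abs_zero, mul_zero] at this
  exact absurd this (not_lt.2 (mul_nonneg h.cone_right.le (abs_nonneg _)))

theorem mem_quadrantPart {z : ℝ × ℝ} (hz : z ∈ Γ) (h1 : 0 ≤ z.1) (h2 : 0 ≤ z.2) :
    z ∈ quadrantPart Γ :=
  ⟨hz, h1, h2.lt_of_ne' (h.snd_ne_zero hs hz)⟩

/-- The strict inequality on the second coordinate costs nothing: the side condition keeps the
profile off that axis. -/
theorem isClosed_quadrantPart : IsClosed (quadrantPart Γ) := by
  have : quadrantPart Γ = Γ ∩ ({z | 0 ≤ z.1} ∩ {z | 0 ≤ z.2}) := by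
    ext z
    exact ⟨fun hz => ⟨hz.1, hz.2.1, hz.2.2.le⟩, fun hz => h.mem_quadrantPart hs hz.1 hz.2.1 hz.2.2⟩
  rw [this]
  exact h.closed.inter ((isClosed_le continuous_const continuous_fst).inter
    (isClosed_le continuous_const continuous_snd))

theorem isCompact_sublevel (T : ℝ) : IsCompact (quadrantPart Γ ∩ {z | dot (α, β) z ≤ T}) := by
  have hα := h.cone_left
  have hβ := h.cone_right
  refine (isCompact_Icc (a := ((0 : ℝ), (0 : ℝ))) (b := (T / α, T / β))).of_isClosed_subset
    ((h.isClosed_quadrantPart hs).inter (isClosed_le (continuous_dot _) continuous_const)) ?_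
  rintro z ⟨hz, hzT⟩
  have hzT : α * z.1 + β * z.2 ≤ T := hzT
  have h1 := mul_nonneg hα.le hz.2.1
  have h2 := mul_pos hβ hz.2.2
  refine ⟨⟨hz.2.1, hz.2.2.le⟩, ?_, ?_⟩
  · show z.1 ≤ T / α
    rw [le_div_iff₀ hα]; linarith
  · show z.2 ≤ T / β
    rw [le_div_iff₀ hβ]; linarith

/-- By the two reflections, the quadrant part is the image of the profile under taking absolute
values, which is the connected quotient of Σ. -/
theorem isPreconnected_quadrantPart : IsPreconnected (quadrantPart Γ) := by
  have : quadrantPart Γ = (fun z : ℝ × ℝ => (|z.1|, |z.2|)) '' Γ := by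
    ext z
    constructor
    · intro hz
      exact ⟨z, hz.1, by simp [abs_of_nonneg hz.2.1, abs_of_pos hz.2.2]⟩
    · rintro ⟨⟨a, b⟩, hz, rfl⟩
      refine h.mem_quadrantPart hs ?_ (abs_nonneg _) (abs_nonneg _)
      rcases abs_choice a with ha | ha <;> rcases abs_choice b with hb | hb <;> simp only [ha, hb]
      · exact hz
      · exact h.neg_snd _ _ hz
      · exact h.neg_fst _ _ hz
      · exact h.neg_snd _ _ (h.neg_fst _ _ hz)
  rw [this]
  exact h.connected

theorem quadrantPart_subset_of_clopen {C : Set (ℝ × ℝ)} (hC : IsClosed C)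
    (hne : (quadrantPart Γ ∩ C).Nonempty)
    (hO : ∀ z ∈ quadrantPart Γ ∩ C, ∃ O ∈ 𝓝 z, quadrantPart Γ ∩ O ⊆ C) : quadrantPart Γ ⊆ C := by
  have key := isPreconnected_iff_subset_of_disjoint.1 (h.isPreconnected_quadrantPart hs)
    (interior {z | z ∈ quadrantPart Γ → z ∈ C}) Cᶜ isOpen_interior hC.isOpen_compl ?_ ?_
  · rcases key with h1 | h1
    · exact fun z hz => interior_subset (h1 hz) hz
    · obtain ⟨z, hz, hzC⟩ := hne
      exact absurd hzC (h1 hz)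
  · intro z hz
    by_cases hzC : z ∈ C
    · left
      obtain ⟨O, hO1, hO2⟩ := hO z ⟨hz, hzC⟩
      exact mem_interior_iff_mem_nhds.2 (mem_of_superset hO1 fun q hq hqQ => hO2 ⟨hqQ, hq⟩)
    · exact Or.inr hzC
  · ext z
    simp only [mem_inter_iff, mem_empty_iff_false, iff_false]
    rintro ⟨hz, h1, h2⟩
    exact h2 (interior_subset h1 hz)

/-- Compact sublevels provide limits of the two points. They cannot merge, since near a point of the
profile every level at or below its own is met at most once; this is why the approach must be from
below. -/
theorem isDoubleLevel_of_tendsto_left {t : ℝ} {u : ℕ → ℝ} (hu : Tendsto u atTop (𝓝 t))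
    (hut : ∀ k, u k ≤ t) (hd : ∀ k, IsDoubleLevel (α, β) Γ (u k)) :
    IsDoubleLevel (α, β) Γ t := by
  choose z hz z' hz' hne e1 e2 using hd
  have hK := h.isCompact_sublevel hs t
  obtain ⟨⟨x, x'⟩, hx, φ, hφ, hlim⟩ := (hK.prod hK).tendsto_subseq
    (x := fun k => (z k, z' k))
    (fun k => ⟨⟨hz k, (e1 k).trans_le (hut k)⟩, ⟨hz' k, (e2 k).trans_le (hut k)⟩⟩)
  have l1 : Tendsto (fun k => z (φ k)) atTop (𝓝 x) := (continuous_fst.tendsto _).comp hlim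
  have l2 : Tendsto (fun k => z' (φ k)) atTop (𝓝 x') := (continuous_snd.tendsto _).comp hlim
  have hux := hu.comp hφ.tendsto_atTop
  have d1 : dot (α, β) x = t := by
    refine tendsto_nhds_unique (((continuous_dot (α, β)).tendsto x).comp l1) (hux.congr fun k => ?_)
    exact (e1 _).symm
  have d2 : dot (α, β) x' = t := by
    refine tendsto_nhds_unique (((continuous_dot (α, β)).tendsto x').comp l2)
      (hux.congr fun k => ?_)
    exact (e2 _).symm
  refine ⟨x, hx.1.1, x', hx.2.1, fun hxx => ?_, d1, d2⟩
  obtain ⟨O, hO, huniq⟩ := h.eventually_unique_below hx.1.1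
  rw [← hxx] at l2
  obtain ⟨k, k1, k2⟩ := ((l1.eventually hO).and (l2.eventually hO)).exists
  refine hne (φ k) (huniq _ ⟨(hz _).1, k1⟩ _ ⟨(hz' _).1, k2⟩ ?_ ?_)
  · exact (e1 _).trans (e2 _).symm
  · rw [show dot (α, β) (x, x').1 = t from d1, e1]; exact hut _

/-- Double levels persist upwards. -/
theorem isDoubleLevel_mono {t t' : ℝ} (ht : IsDoubleLevel (α, β) Γ t) (htt : t ≤ t') :
    IsDoubleLevel (α, β) Γ t' := by
  by_contra hn
  -- At the first level where doubleness could fail it still holds, being a limit from below, and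
  -- then it holds slightly above, against the choice of the infimum.
  set A := {s | t ≤ s ∧ ¬ IsDoubleLevel (α, β) Γ s} with hA
  have hAb : BddBelow A := ⟨t, fun s hs => hs.1⟩
  have hAne : A.Nonempty := ⟨t', htt, hn⟩
  set s := sInf A with hsdef
  have hts : t ≤ s := le_csInf hAne fun x hx => hx.1
  have hbelow : ∀ x, t ≤ x → x < s → IsDoubleLevel (α, β) Γ x := fun x h1 h2 => by
    by_contra h3
    exact absurd (csInf_le hAb ⟨h1, h3⟩) (not_le.2 h2)
  have hsd : IsDoubleLevel (α, β) Γ s := by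
    rcases hts.eq_or_lt with heq | hlt
    · rwa [← heq]
    · obtain ⟨u, -, hu2, hu3⟩ := exists_seq_strictMono_tendsto' hlt
      exact h.isDoubleLevel_of_tendsto_left hs hu3 (fun k => (hu2 k).2.le)
        fun k => hbelow _ (hu2 k).1.le (hu2 k).2
  obtain ⟨x, hx, hsx⟩ := mem_nhdsGE_iff_exists_Ico_subset.1 (h.isDoubleLevel_eventually_right hsd)
  have hx : s < x := hx
  obtain ⟨y, hy, hyx⟩ := exists_lt_of_csInf_lt hAne hx
  exact hy.2 (hsx ⟨csInf_le hAb hy, hyx⟩)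

end IsProfile

end

/-! ### One sheet at infinity: no level is met twice. -/

section

namespace IsProfile

variable {μ ν α β : ℝ} {Γ : Set (ℝ × ℝ)} (h : IsProfile μ ν α β Γ)
  (hs : ∀ z ∈ Γ, β * |z.1| < α * |z.2|)
include h

omit h in
theorem framePoint_cone (t s : ℝ) :
    framePoint (α, β) (-β, α) t s = (α * t - β * s, β * t + α * s) := by
  simp only [framePoint]
  ext <;> simp <;> ring

theorem tendsto_coord {w : ℝ → ℝ} (hw : Tendsto w atTop (𝓝 0)) :
    Tendsto (fun t => α * t - β * w t) atTop atTop ∧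
    Tendsto (fun t => β * t + α * w t) atTop atTop := by
  constructor
  · simp only [sub_eq_add_neg]
    refine (tendsto_id.const_mul_atTop h.cone_left).atTop_add (C := 0) ?_
    simpa using (hw.const_mul β).neg
  · refine (tendsto_id.const_mul_atTop h.cone_right).atTop_add (C := 0) ?_
    simpa using hw.const_mul α

include hs

/-- If an asymptotic sheet reaches the axis, it is the whole profile. -/
theorem subset_of_reaches_axis {R t₀ : ℝ} {w : ℝ → ℝ} (hw : ContinuousOn w (Ioi R))
    (hΓ : ∀ t > R, (α * t - β * w t, β * t + α * w t) ∈ Γ)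
    (hb : ∀ t > R, 0 < β * t + α * w t) (hR : R < t₀) (h0 : α * t₀ - β * w t₀ = 0) :
    quadrantPart Γ ⊆ {z | t₀ ≤ dot (α, β) z ∧ dot (-β, α) z = w (max (dot (α, β) z) t₀)} := by
  -- The truncation keeps the argument in (R, ∞), where w is continuous, so the set of the statement
  -- is closed; it remains to see that it is relatively open.
  have hwc : Continuous fun t => w (max t t₀) :=
    hw.comp_continuous (continuous_id.max continuous_const) fun t =>
      hR.trans_le (le_max_right _ _)
  have hz0 : framePoint (α, β) (-β, α) t₀ (w t₀) ∈ quadrantPart Γ := by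
    rw [framePoint_cone]
    exact ⟨hΓ t₀ hR, h0.ge, hb t₀ hR⟩
  refine h.quadrantPart_subset_of_clopen hs ?_ ⟨_, hz0, ?_⟩ ?_
  · exact (isClosed_le continuous_const (continuous_dot _)).inter
      (isClosed_eq (continuous_dot _) (hwc.comp (continuous_dot _)))
  · simp only [mem_ofPred_eq, h.frame.dot_left, h.frame.dot_right, max_self, le_refl, true_and]
  · rintro z ⟨hz, hz1, hz2⟩
    rw [max_eq_left hz1] at hz2
    have hzR : R < dot (α, β) z := hR.trans_le hz1
    have hwz : ContinuousAt w (dot (α, β) z) := hw.continuousAt (Ioi_mem_nhds hzR)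
    have hzz : framePoint (α, β) (-β, α) (dot (α, β) z) (w (dot (α, β) z)) = z := by
      rw [← hz2]; exact h.frame.framePoint_dot z
    have hc : Tendsto (fun t => framePoint (α, β) (-β, α) t (w t)) (𝓝 (dot (α, β) z)) (𝓝 z) := by
      have : ContinuousAt (fun t => framePoint (α, β) (-β, α) t (w t)) (dot (α, β) z) :=
        continuous_framePoint_comp continuousAt_id hwz
      have := this.tendsto
      rwa [hzz] at this
    have hcΓ : ∀ᶠ t in 𝓝 (dot (α, β) z), framePoint (α, β) (-β, α) t (w t) ∈ Γ := by
      filter_upwards [Ioi_mem_nhds hzR] with t ht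
      rw [framePoint_cone]; exact hΓ t ht
    rcases h.local_structure hz.1 hz.2.1 hz.2.2 with
      ⟨w', w1, w2, w3, w4⟩ | ⟨hz1', τ, t1, t2, t3, t4, t5⟩
    · have hww : ∀ᶠ t in 𝓝 (dot (α, β) z), w t = w' t := by
        filter_upwards [hcΓ, hc.eventually w3] with t a1 a2
        have := a2.1 a1
        rwa [h.frame.dot_left, h.frame.dot_right] at this
      have hd := (continuous_dot (α, β)).tendsto z
      have hev := (hd.eventually hww).and (w3.and
        (hd.eventually (h.graph_mem_quadrantPart hz w1 w2 w3 w4)))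
      have hev2 : ∀ᶠ q in 𝓝 z, t₀ < dot (α, β) z → t₀ < dot (α, β) q := by
        rcases hz1.eq_or_lt with heq | hlt
        · exact Eventually.of_forall fun q hq => absurd hq heq.not_lt
        · filter_upwards [hd.eventually (lt_mem_nhds hlt)] with q hq _ using hq
      refine ⟨_, hev.and hev2, ?_⟩
      rintro q ⟨hq, ⟨a1, a2, a3⟩, a4⟩
      have hqw := a2.1 hq.1
      have hq0 : t₀ ≤ dot (α, β) q := by
        rcases hz1.eq_or_lt with heq | hlt
        -- At the axis point itself the graph has negative first coordinate below t₀, so no nearby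
        -- point of the quadrant lies lower.
        · by_contra! hlt
          have hz10 : z.1 = 0 := by
            rw [← hzz, framePoint_cone, ← heq]; exact h0
          have := a3.2 hz10 (heq ▸ hlt)
          rw [← hqw, h.frame.framePoint_dot] at this
          exact absurd this (not_lt.2 hq.2.1)
        · exact (a4 hlt).le
      exact ⟨hq0, by rw [max_eq_left hq0, a1]; exact hqw⟩
    · exfalso
      -- A turning point would be a local minimum of the level on Γ, whereas the sheet passes
      -- through it with the level as parameter and takes lower values.
      have hmin : IsLocalMin τ (dot (-β, α) z) :=
        isLocalMin_of_deriv_deriv_pos t5 t4 t1.continuousAt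
      have hd : Tendsto w (𝓝 (dot (α, β) z)) (𝓝 (dot (-β, α) z)) := by
        have := hwz.tendsto; rwa [← hz2] at this
      have hge : ∀ᶠ t in 𝓝 (dot (α, β) z), dot (α, β) z ≤ t := by
        filter_upwards [hcΓ, hc.eventually t3, hd.eventually hmin] with t a1 a2 a3
        have := a2.1 a1
        rw [h.frame.dot_left, h.frame.dot_right] at this
        rw [this, ← t2]; exact a3
      obtain ⟨t, ht1, ht2⟩ := ((hge.filter_mono
        (nhdsWithin_le_nhds (s := Iio (dot (α, β) z)))).and eventually_mem_nhdsWithin).exists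
      exact absurd ht2 (not_lt.2 ht1)

/-- A double level persists up to levels beyond B, where only the sheet of `w₀` remains; and if some
trace reaches the axis, that trace already is the whole quadrant part, which is then a graph. -/
theorem not_isDoubleLevel (t : ℝ) : ¬ IsDoubleLevel (α, β) Γ t := by
  intro ht
  obtain ⟨R, B, 𝒲, w₀, hw₀, h𝒲, hB⟩ := h.asymptotic
  have hca : ∀ w ∈ 𝒲, ContinuousOn (fun t => α * t - β * w t) (Ioi R) := fun w hw =>
    (continuousOn_const.mul continuousOn_id).sub (continuousOn_const.mul (h𝒲 w hw).1)
  have hcb : ∀ w ∈ 𝒲, ContinuousOn (fun t => β * t + α * w t) (Ioi R) := fun w hw =>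
    (continuousOn_const.mul continuousOn_id).add (continuousOn_const.mul (h𝒲 w hw).1)
  have hb : ∀ w ∈ 𝒲, ∀ t > R, 0 < β * t + α * w t := by
    intro w hw t ht
    -- A trace that is nonpositive somewhere and positive far out would cross the axis which the
    -- side condition excludes.
    by_contra! hn
    obtain ⟨T, hT1, hT2⟩ := (((h.tendsto_coord (h𝒲 w hw).2.1).2.eventually_gt_atTop 0).and
      (eventually_ge_atTop t)).exists
    obtain ⟨x, hx, hx0⟩ := intermediate_value_Icc hT2
      ((hcb w hw).mono fun y hy => ht.trans_le hy.1) ⟨hn, hT1.le⟩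
    exact h.snd_ne_zero hs ((h𝒲 w hw).2.2 x (ht.trans_le hx.1)) hx0
  by_cases hax : ∃ w ∈ 𝒲, ∃ t > R, α * t - β * w t ≤ 0
  · obtain ⟨w, hw, t1, ht1, hle⟩ := hax
    obtain ⟨T, hT1, hT2⟩ := (((h.tendsto_coord (h𝒲 w hw).2.1).1.eventually_gt_atTop 0).and
      (eventually_ge_atTop t1)).exists
    obtain ⟨t0, ht0, h0⟩ := intermediate_value_Icc hT2
      ((hca w hw).mono fun y hy => ht1.trans_le hy.1) ⟨hle, hT1.le⟩
    have hsub := h.subset_of_reaches_axis hs (h𝒲 w hw).1 (h𝒲 w hw).2.2 (hb w hw)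
      (ht1.trans_le ht0.1) h0
    obtain ⟨z, hz, z', hz', hne, e1, e2⟩ := ht
    refine hne (h.frame.ext_dot (e1.trans e2.symm) ?_)
    rw [(hsub hz).2, (hsub hz').2, e1, e2]
  · push Not at hax
    have hT := h.isDoubleLevel_mono hs ht (le_max_left t (B + 1))
    obtain ⟨z, hz, z', hz', hne, e1, e2⟩ := hT
    have key : ∀ z ∈ quadrantPart Γ, dot (α, β) z = max t (B + 1) →
        dot (-β, α) z = w₀ (max t (B + 1)) := by
      intro z hz hzt
      have hBz : B < dot (α, β) z := by
        rw [hzt]; exact (lt_add_one B).trans_le (le_max_right _ _)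
      rcases hB z hz.1 hz.2.1 hz.2.2.le hBz with ⟨w, hw, s, hsR, h1 | h1⟩ | ⟨s, -, hsz⟩
      · exact absurd h1 (not_le.2 (hax w hw s hsR))
      · exact absurd h1 (not_le.2 (hb w hw s hsR))
      · rw [← framePoint_cone] at hsz
        rw [hsz, h.frame.dot_left] at hzt
        rw [hsz, h.frame.dot_right, hzt]
    exact hne (h.frame.ext_dot (e1.trans e2.symm) ((key z hz e1).trans (key z' hz' e2).symm))

/-- Compactness of the sublevels gives a lowest level, and connectedness together with the unbounded
sheet `w₀` gives all levels above it. -/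
theorem exists_levels : ∃ t₀ : ℝ, (∀ z ∈ quadrantPart Γ, t₀ ≤ dot (α, β) z) ∧
    ∀ t ≥ t₀, ∃ z ∈ quadrantPart Γ, dot (α, β) z = t := by
  obtain ⟨R, B, 𝒲, w₀, hw₀, h𝒲, -⟩ := h.asymptotic
  obtain ⟨-, hw, hΓ⟩ := h𝒲 w₀ hw₀
  have hlarge : ∀ᶠ t in atTop, framePoint (α, β) (-β, α) t (w₀ t) ∈ quadrantPart Γ := by
    filter_upwards [(h.tendsto_coord hw).1.eventually_gt_atTop 0,
      (h.tendsto_coord hw).2.eventually_gt_atTop 0, eventually_gt_atTop R] with t h1 h2 h3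
    rw [framePoint_cone]
    exact ⟨hΓ t h3, h1.le, h2⟩
  obtain ⟨t1, ht1⟩ := hlarge.exists
  obtain ⟨z0, hz0, hmin⟩ := (h.isCompact_sublevel hs t1).exists_isMinOn
    ⟨_, ht1, (h.frame.dot_left _ _).le⟩ (continuous_dot (α, β)).continuousOn
  refine ⟨dot (α, β) z0, fun z hz => ?_, fun t ht => ?_⟩
  · rcases le_total (dot (α, β) z) t1 with hz1 | hz1
    · exact hmin ⟨hz, hz1⟩
    · exact (show dot (α, β) z0 ≤ t1 from hz0.2).trans hz1
  · obtain ⟨T, hT1, hT2⟩ := (hlarge.and (eventually_ge_atTop t)).exists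
    obtain ⟨z, hz, hzt⟩ := (h.isPreconnected_quadrantPart hs).intermediate_value hz0.1 hT1
      (continuous_dot (α, β)).continuousOn ⟨ht, by rw [h.frame.dot_left]; exact hT2⟩
    exact ⟨z, hz, hzt⟩

end IsProfile

end

/-! ### The profile as a graph over the ray of the cone. -/

section

/-- A function which is negative at first and decreases at its zeros stays negative. -/
theorem neg_of_deriv_neg_at_zeros {φ : ℝ → ℝ} {t₀ : ℝ} (hd : ∀ t > t₀, DifferentiableAt ℝ φ t)
    (hz : ∀ t > t₀, φ t = 0 → deriv φ t < 0) (h0 : ∀ᶠ t in 𝓝[>] t₀, φ t < 0) :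
    ∀ t > t₀, φ t < 0 := by
  intro t1 ht1
  by_contra! hn
  obtain ⟨u, hu, hneg⟩ := mem_nhdsGT_iff_exists_Ioo_subset.1 h0
  have hu : t₀ < u := hu
  have hu1 : u ≤ t1 := by
    by_contra! hlt
    exact absurd (hneg ⟨ht1, hlt⟩) (not_lt.2 hn)
  have hcont : ContinuousOn φ (Icc u t1) := fun t ht =>
    (hd t (hu.trans_le ht.1)).continuousAt.continuousWithinAt
  have hK : IsCompact (Icc u t1 ∩ φ ⁻¹' Ici 0) :=
    isCompact_Icc.of_isClosed_subset (hcont.preimage_isClosed_of_isClosed isClosed_Icc isClosed_Ici)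
      inter_subset_left
  obtain ⟨s, ⟨hs1, hs2⟩, hs3⟩ := hK.exists_isLeast ⟨t1, ⟨hu1, le_rfl⟩, hn⟩
  have hs0 : t₀ < s := hu.trans_le hs1.1
  have hbelow : ∀ y ∈ Ioo t₀ s, φ y < 0 := by
    intro y hy
    rcases lt_or_ge y u with hyu | hyu
    · exact hneg ⟨hy.1, hyu⟩
    · by_contra! hc
      exact absurd (hs3 ⟨⟨hyu, hy.2.le.trans hs1.2⟩, hc⟩) (not_le.2 hy.2)
  have hev : ∀ᶠ y in 𝓝[<] s, φ y < 0 := by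
    filter_upwards [Ioo_mem_nhdsLT hs0] with y hy using hbelow y hy
  have hφs : φ s = 0 := by
    refine le_antisymm ?_ hs2
    exact le_of_tendsto ((hd s hs0).continuousAt.tendsto.mono_left nhdsWithin_le_nhds)
      (hev.mono fun y hy => hy.le)
  have hsl := ((hasDerivAt_iff_tendsto_slope.1 (hd s hs0).hasDerivAt).eventually
    (gt_mem_nhds (hz s hs0 hφs))).filter_mono (nhdsLT_le_nhdsNE s)
  obtain ⟨y, hy1, hy2, hy3⟩ := (hev.and (hsl.and eventually_mem_nhdsWithin)).exists
  rw [slope_def_field, hφs, sub_zero] at hy2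
  have hy3 : y < s := hy3
  exact absurd hy2 (not_lt.2 (div_nonneg_of_nonpos hy1.le (by linarith)))

namespace IsProfile

variable {μ ν α β : ℝ} {Γ : Set (ℝ × ℝ)} (h : IsProfile μ ν α β Γ)
  (hs : ∀ z ∈ Γ, β * |z.1| < α * |z.2|)
include h hs

/-- A turning point would create double levels just above it. -/
theorem exists_local_graph {z : ℝ × ℝ} (hz : z ∈ quadrantPart Γ) :
    ∃ w : ℝ → ℝ, ContDiffAt ℝ ∞ w (dot (α, β) z) ∧ w (dot (α, β) z) = dot (-β, α) z ∧
      (∀ᶠ q in 𝓝 z, q ∈ Γ ↔ dot (-β, α) q = w (dot (α, β) q)) ∧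
      (z.1 = 0 → deriv w (dot (α, β) z) = -β / α) := by
  rcases h.local_structure hz.1 hz.2.1 hz.2.2 with hw | ⟨hz1, τ, t1, t2, t3, t4, t5⟩
  · exact hw
  · exfalso
    have h1 := (h.exists_turn_pair hz hz1 t1 t2 t3 t4 t5 univ_mem).filter_mono
      (nhdsWithin_mono _ Ioi_subset_Ici_self)
    obtain ⟨t, ⟨a, ha, b, hb, e1, e2, hne⟩, ht⟩ := (h1.and eventually_mem_nhdsWithin).exists
    exact h.not_isDoubleLevel hs t ⟨a, ha.1, b, hb.1, hne ht, e1, e2⟩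

/-- The profile is globally a graph over the ray of the cone. -/
theorem exists_graph_cone : ∃ (t₀ : ℝ) (W : ℝ → ℝ),
    (∀ t ≥ t₀, framePoint (α, β) (-β, α) t (W t) ∈ quadrantPart Γ) ∧
    (∀ z ∈ quadrantPart Γ, t₀ ≤ dot (α, β) z ∧ dot (-β, α) z = W (dot (α, β) z)) ∧
    (∀ t > t₀, ContDiffAt ℝ ∞ W t ∧ 0 < (framePoint (α, β) (-β, α) t (W t)).1 ∧
      ∀ᶠ q in 𝓝 (framePoint (α, β) (-β, α) t (W t)), q ∈ Γ ↔ dot (-β, α) q = W (dot (α, β) q)) ∧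
    ∃ w : ℝ → ℝ, ContDiffAt ℝ ∞ w t₀ ∧ deriv w t₀ = -β / α ∧ W =ᶠ[𝓝[≥] t₀] w ∧
      (framePoint (α, β) (-β, α) t₀ (W t₀)).1 = 0 := by
  obtain ⟨t₀, ht₀, hlev⟩ := h.exists_levels hs
  choose! Z hZ hZt using hlev
  set W : ℝ → ℝ := fun t => dot (-β, α) (Z t) with hW
  have huniq : ∀ z ∈ quadrantPart Γ, ∀ z' ∈ quadrantPart Γ, dot (α, β) z = dot (α, β) z' → z = z' :=
    fun z hz z' hz' he => by
      by_contra hne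
      exact h.not_isDoubleLevel hs _ ⟨z, hz, z', hz', hne, he, rfl⟩
  have hZW : ∀ t ≥ t₀, framePoint (α, β) (-β, α) t (W t) = Z t := fun t ht => by
    have := h.frame.framePoint_dot (Z t)
    rwa [hZt t ht] at this
  have hQW : ∀ z ∈ quadrantPart Γ, dot (-β, α) z = W (dot (α, β) z) := fun z hz => by
    rw [hW, huniq z hz (Z (dot (α, β) z)) (hZ _ (ht₀ z hz)) (hZt _ (ht₀ z hz)).symm, hZt]
    exact ht₀ z hz
  -- The global W, defined by choosing points, agrees with the local smooth graph wherever the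
  -- latter stays in the quadrant, since levels are simple: on both sides off the axis, only upwards
  -- on it.
  have hWw : ∀ t ≥ t₀, ∀ w : ℝ → ℝ, ContDiffAt ℝ ∞ w t → w t = W t →
      (∀ᶠ q in 𝓝 (Z t), q ∈ Γ ↔ dot (-β, α) q = w (dot (α, β) q)) →
      ((Z t).1 = 0 → deriv w t = -β / α) → ∀ᶠ s in 𝓝 t,
        ((t ≤ s ∨ 0 < (Z t).1) → t₀ ≤ s ∧ W s = w s) ∧
        ((Z t).1 = 0 → s < t → (framePoint (α, β) (-β, α) s (w s)).1 < 0) := by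
    intro t ht w w1 w2 w3 w4
    have hg := h.graph_mem_quadrantPart (z := Z t) (w := w) (hZ t ht)
    rw [hZt t ht] at hg
    filter_upwards [hg w1 w2 w3 w4] with s hs
    refine ⟨fun hts => ?_, hs.2⟩
    have h1 := hs.1 hts
    have h2 := ht₀ _ h1
    have h3 := hQW _ h1
    rw [h.frame.dot_left] at h2 h3
    rw [h.frame.dot_right] at h3
    exact ⟨h2, h3.symm⟩
  -- A point on the axis is the lowest one: the points at or above its level form a relatively
  -- clopen subset, since just below it the graph leaves the quadrant.
  have haxis : ∀ t ≥ t₀, (Z t).1 = 0 → t = t₀ := by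
    intro t ht hz0
    obtain ⟨w, w1, w2, w3, w4⟩ := h.exists_local_graph hs (hZ t ht)
    rw [hZt t ht] at w1 w2 w4
    have hsub : quadrantPart Γ ⊆ {z | t ≤ dot (α, β) z} := by
      refine h.quadrantPart_subset_of_clopen hs (isClosed_le continuous_const (continuous_dot _))
        ⟨Z t, hZ t ht, (hZt t ht).ge⟩ ?_
      rintro q ⟨hq, hqt⟩
      rcases (show t ≤ dot (α, β) q from hqt).eq_or_lt with heq | hlt
      · have hqZ : q = Z t := huniq q hq _ (hZ t ht) (by rw [hZt t ht, ← heq])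
        have hev := ((continuous_dot (α, β)).tendsto q).eventually
          (by rw [← heq]; exact hWw t ht w w1 w2 w3 w4)
        rw [hqZ] at hev
        rw [hqZ]
        refine ⟨_, hev.and w3, ?_⟩
        rintro p ⟨hp, a1, a2⟩
        by_contra! hlt
        have := a1.2 hz0 (not_le.1 hlt)
        rw [← a2.1 hp.1, h.frame.framePoint_dot] at this
        exact absurd this (not_lt.2 hp.2.1)
      · exact ⟨_, (continuous_dot (α, β)).continuousAt.eventually (lt_mem_nhds hlt),
          fun p hp => (show t < dot (α, β) p from hp.2).le⟩
    have := hsub (hZ t₀ le_rfl)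
    rw [mem_ofPred_eq, hZt t₀ le_rfl] at this
    exact le_antisymm this ht
  have hpos : ∀ t > t₀, 0 < (Z t).1 := fun t ht =>
    (hZ t ht.le).2.1.lt_of_ne' fun h0 => ht.ne' (haxis t ht.le h0)
  refine ⟨t₀, W, fun t ht => by rw [hZW t ht]; exact hZ t ht,
    fun z hz => ⟨ht₀ z hz, hQW z hz⟩, fun t ht => ?_, ?_⟩
  · rw [hZW t ht.le]
    obtain ⟨w, w1, w2, w3, w4⟩ := h.exists_local_graph hs (hZ t ht.le)
    rw [hZt t ht.le] at w1 w2 w4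
    have hev : W =ᶠ[𝓝 t] w := (hWw t ht.le w w1 w2 w3 w4).mono fun s hs =>
      (hs.1 (Or.inr (hpos t ht))).2
    refine ⟨w1.congr_of_eventuallyEq hev, hpos t ht, ?_⟩
    have hd := (continuous_dot (α, β)).tendsto (Z t)
    rw [hZt t ht.le] at hd
    filter_upwards [w3, hd.eventually hev] with q a1 a2
    rw [a1, a2]
  · obtain ⟨w, w1, w2, w3, w4⟩ := h.exists_local_graph hs (hZ t₀ le_rfl)
    rw [hZt t₀ le_rfl] at w1 w2 w4
    have hev := hWw t₀ le_rfl w w1 w2 w3 w4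
    -- Otherwise the local graph would continue inside the quadrant below the lowest level.
    have hz0 : (Z t₀).1 = 0 := by
      refine le_antisymm ?_ (hZ t₀ le_rfl).2.1
      by_contra! hpos'
      obtain ⟨s, h1, h2⟩ := ((hev.filter_mono (nhdsWithin_le_nhds (s := Iio t₀))).and
        eventually_mem_nhdsWithin).exists
      exact absurd (h1.1 (Or.inr hpos')).1 (not_le.2 h2)
    refine ⟨w, w1, w4 hz0, ?_, by rw [hZW t₀ le_rfl]; exact hz0⟩
    filter_upwards [mem_nhdsWithin_of_mem_nhds hev, self_mem_nhdsWithin] with s a1 a2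
    exact (a1.1 (Or.inl a2)).2

end IsProfile

end

/-! ### The profile as a graph over an axis, with slope bounds. -/

section

/-- An even positive function whose graph and its reflection form a minimal profile. -/
structure IsProfileGraph (μ ν α β : ℝ) (g : ℝ → ℝ) : Prop where
  smooth : ContDiff ℝ ∞ g
  even : ∀ x, g (-x) = g x
  pos : ∀ x, 0 < g x
  ode : ∀ x > 0, deriv (deriv g) x = (1 + deriv g x ^ 2) * (ν / g x - μ * deriv g x / x)
  deriv_nonneg : ∀ x ≥ 0, 0 ≤ deriv g x
  deriv_le : ∀ x ≥ 0, α * deriv g x ≤ β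
  side : ∀ x, β * x < α * g x

theorem isFrame_std : IsFrame (1, 0) (0, 1) := ⟨by norm_num, by norm_num, by norm_num⟩

theorem dot_std_left (z : ℝ × ℝ) : dot (1, 0) z = z.1 := by simp [dot]

theorem dot_std_right (z : ℝ × ℝ) : dot (0, 1) z = z.2 := by simp [dot]

theorem deriv_neg_of_even {g : ℝ → ℝ} (he : ∀ x, g (-x) = g x) (x : ℝ) :
    deriv g (-x) = -deriv g x := by
  have h1 := deriv_comp_neg g x
  rw [show (fun x => g (-x)) = g from funext he] at h1
  rw [h1, neg_neg]

/-- A function which increases where it is negative and vanishes at `0` is nonnegative. -/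
theorem nonneg_of_deriv_pos {φ : ℝ → ℝ} (hc : Continuous φ) (h0 : φ 0 = 0)
    (hd : ∀ x > 0, DifferentiableAt ℝ φ x) (hp : ∀ x > 0, φ x < 0 → 0 < deriv φ x) :
    ∀ x ≥ 0, 0 ≤ φ x := by
  intro x hx
  by_contra! hneg
  obtain ⟨y, hy, hmin⟩ := isCompact_Icc.exists_isMinOn (nonempty_Icc.2 hx) hc.continuousOn
  have hy1 : φ y < 0 := (hmin (right_mem_Icc.2 hx)).trans_lt hneg
  have hy0 : 0 < y := hy.1.lt_of_ne fun h => by rw [← h, h0] at hy1; exact lt_irrefl _ hy1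
  have hsl := ((hasDerivAt_iff_tendsto_slope.1 (hd y hy0).hasDerivAt).eventually
    (lt_mem_nhds (hp y hy0 hy1))).filter_mono (nhdsLT_le_nhdsNE y)
  obtain ⟨s, h1, h2⟩ := (hsl.and (Ioo_mem_nhdsLT hy0)).exists
  have h3 : φ y ≤ φ s := hmin ⟨h2.1.le, h2.2.le.trans hy.2⟩
  rw [slope_def_field] at h1
  exact absurd h1 (not_lt.2 (div_nonpos_of_nonneg_of_nonpos (by linarith) (by linarith [h2.2])))

namespace IsProfile

variable {μ ν α β : ℝ} {Γ : Set (ℝ × ℝ)} (h : IsProfile μ ν α β Γ)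
  (hs : ∀ z ∈ Γ, β * |z.1| < α * |z.2|)
include h

theorem abs_mem {x y : ℝ} : (|x|, |y|) ∈ Γ ↔ (x, y) ∈ Γ := by
  have h1 : ∀ a b, (-a, b) ∈ Γ ↔ (a, b) ∈ Γ := fun a b =>
    ⟨fun hz => by simpa using h.neg_fst _ _ hz, h.neg_fst _ _⟩
  have h2 : ∀ a b, (a, -b) ∈ Γ ↔ (a, b) ∈ Γ := fun a b =>
    ⟨fun hz => by simpa using h.neg_snd _ _ hz, h.neg_snd _ _⟩
  rcases abs_choice x with hx | hx <;> rcases abs_choice y with hy | hy <;>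
    simp only [hx, hy, h1, h2]

include hs

/-- The profile is a graph over the axis. -/
theorem exists_graph_axis : ∃ g : ℝ → ℝ, IsProfileGraph μ ν α β g ∧
    ∀ x y, (x, y) ∈ Γ ↔ |y| = g x := by
  obtain ⟨t₀, W, hW1, hW2, hW3, w, hw1, hw2, hw3, hax⟩ := h.exists_graph_cone hs
  have hα := h.cone_left
  have hβ := h.cone_right
  have hμ := h.pos_left
  have hν := h.pos_right
  have hWpos : ∀ t ≥ t₀, 0 < W t := fun t ht => by
    obtain ⟨k1, k2, k3⟩ := hW1 t ht
    have := hs _ k1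
    rw [abs_of_nonneg k2, abs_of_pos k3] at this
    simp only [framePoint] at this
    have e : α * (t * β + W t * α) - β * (t * α + W t * -β) = W t := by
      linear_combination W t * h.cone_unit
    linarith
  have hWd : ∀ t > t₀, HasDerivAt W (deriv W t) t := fun t ht =>
    ((hW3 t ht).1.differentiableAt (by simp)).hasDerivAt
  -- At the axis W' = -β/α < 0. At a zero of W' the equation gives W'' = -αβ(μ + ν) W / (ab), with
  -- a, b the two coordinates: the terms proportional to t cancel because the ray is a minimal cone,
  -- and W > 0 on this side.
  have hneg : ∀ t > t₀, deriv W t < 0 := by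
    refine neg_of_deriv_neg_at_zeros (fun t ht => ?_) (fun t ht h0 => ?_) ?_
    · exact (contDiffAt_deriv (hW3 t ht).1 (l := 1) two_le_infty).differentiableAt (by simp)
    · have hz := hW1 t ht.le
      obtain ⟨k1, k2, k3⟩ := hW3 t ht
      have := h.ode _ hz.1 k2 hz.2.2 _ _ W h.frame
      rw [h.frame.dot_left] at this
      rw [this (k1.of_le two_le_infty) k3, h0]
      have e1 : 0 < μ * β / (framePoint (α, β) (-β, α) t (W t)).1 := by positivity
      have hz2 := hz.2.2
      have hWt := hWpos t ht.le
      have e2 : μ * -β / (framePoint (α, β) (-β, α) t (W t)).1 +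
          ν * α / (framePoint (α, β) (-β, α) t (W t)).2 =
          - (α * β * (μ + ν) * W t) / ((framePoint (α, β) (-β, α) t (W t)).1 *
            (framePoint (α, β) (-β, α) t (W t)).2) := by
        rw [div_add_div _ _ k2.ne' hz2.ne']
        congr 1
        simp only [framePoint]
        linear_combination t * h.cone_eq
      simp only [zero_mul, sub_zero]
      rw [e2]
      have : 0 < α * β * (μ + ν) * W t := by positivity
      have := div_pos this (mul_pos k2 hz2)
      rw [neg_div]
      norm_num
      exact this
    · obtain ⟨u, hu, hev⟩ := mem_nhdsGE_iff_exists_Ico_subset.1 hw3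
      have hwc : ContinuousAt (deriv w) t₀ :=
        (contDiffAt_deriv hw1 (l := 0) (by simp)).continuousAt
      have : deriv w t₀ < 0 := by
        rw [hw2]; exact div_neg_of_neg_of_pos (by linarith) hα
      filter_upwards [(hwc.eventually (gt_mem_nhds this)).filter_mono nhdsWithin_le_nhds,
        Ioo_mem_nhdsGT hu] with s h1 h2
      have : W =ᶠ[𝓝 s] w := by
        filter_upwards [Ioo_mem_nhds h2.1 h2.2] with r hr using hev ⟨hr.1.le, hr.2⟩
      rwa [this.deriv_eq]
  have hWc : ContinuousOn W (Ici t₀) := by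
    intro t ht
    rcases (show t₀ ≤ t from ht).eq_or_lt with heq | hlt
    · rw [← heq]
      exact hw1.continuousAt.continuousWithinAt.congr_of_eventuallyEq hw3
        (hw3.self_of_nhdsWithin self_mem_Ici)
    · exact (hWd t hlt).continuousAt.continuousWithinAt
  have hWanti : StrictAntiOn W (Ici t₀) := by
    refine strictAntiOn_of_deriv_neg (convex_Ici _) hWc fun t ht => ?_
    rw [interior_Ici] at ht
    exact hneg t ht
  set a : ℝ → ℝ := fun t => α * t - β * W t with ha
  have hac : ContinuousOn a (Ici t₀) := by fun_prop
  have hamono : StrictMonoOn a (Ici t₀) := fun s hs' t ht hst => by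
    have h1 := hWanti hs' ht hst
    have := mul_lt_mul_of_pos_left h1 hβ
    have := mul_lt_mul_of_pos_left hst hα
    simp only [ha]; linarith
  have ha1 : ∀ t, (framePoint (α, β) (-β, α) t (W t)).1 = a t := fun t => by
    simp only [framePoint, ha]; ring
  have ha0 : a t₀ = 0 := by rw [← ha1]; exact hax
  have hatop : Tendsto a atTop atTop := by
    refine tendsto_atTop_mono' atTop (f₁ := fun t => α * t + -(β * W t₀)) ?_ ?_
    · filter_upwards [eventually_ge_atTop t₀] with t ht
      have := mul_le_mul_of_nonneg_left (hWanti.antitoneOn self_mem_Ici ht ht) hβ.le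
      simp only [ha]; linarith
    · exact tendsto_atTop_add_const_right _ _ (tendsto_id.const_mul_atTop hα)
  have hsurj : ∀ x ≥ 0, ∃ t ≥ t₀, a t = x := by
    intro x hx
    obtain ⟨t1, h1, h2⟩ := ((hatop.eventually_ge_atTop x).and (eventually_ge_atTop t₀)).exists
    have := intermediate_value_Icc h2 (hac.mono Icc_subset_Ici_self)
    obtain ⟨t, ht, hte⟩ := this ⟨by rw [ha0]; exact hx, h1⟩
    exact ⟨t, ht.1, hte⟩
  choose! T hT0 hT using hsurj
  set g : ℝ → ℝ := fun x => β * T |x| + α * W (T |x|) with hg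
  have hgT : ∀ x, framePoint (α, β) (-β, α) (T |x|) (W (T |x|)) = (|x|, g x) := fun x => by
    ext
    · rw [ha1, hT _ (abs_nonneg x)]
    · simp only [framePoint, hg]; ring
  have hgq : ∀ x, (|x|, g x) ∈ quadrantPart Γ := fun x => by
    rw [← hgT]; exact hW1 _ (hT0 _ (abs_nonneg x))
  have hΓ : ∀ x y, (x, y) ∈ Γ ↔ |y| = g x := by
    intro x y
    rw [← h.abs_mem]
    constructor
    · intro hz
      have hq : (|x|, |y|) ∈ quadrantPart Γ := h.mem_quadrantPart hs hz (abs_nonneg _) (abs_nonneg _)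
      obtain ⟨k1, k2⟩ := hW2 _ hq
      have k3 := h.frame.framePoint_dot (|x|, |y|)
      rw [k2] at k3
      have k4 : dot (α, β) (|x|, |y|) = T |x| := by
        refine hamono.injOn k1 (hT0 _ (abs_nonneg x)) ?_
        rw [hT _ (abs_nonneg x), ← ha1, k3]
      rw [k4, hgT] at k3
      exact (congrArg Prod.snd k3).symm
    · intro hy
      rw [hy]; exact (hgq x).1
  have heven : ∀ x, g (-x) = g x := fun x => by simp only [hg, abs_neg]
  have hgpos : ∀ x, 0 < g x := fun x => (hgq x).2.2
  -- Off the axis the tangent (α - βW', β + αW') has positive first component, and on the axis it is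
  -- (1, 0). Hence the derivative of F in the second variable is nonzero, and a local equation can
  -- be solved over the axis.
  have hgloc : ∀ x ≥ 0, ContDiffAt ℝ ∞ g x ∧ (0 < x → α * deriv g x ≤ β) := by
    intro x hx
    have hzx : ((x, g x) : ℝ × ℝ) ∈ Γ := by rw [hΓ, abs_of_pos (hgpos x)]
    obtain ⟨F, hF, hF0, hFa, -, hFΓ⟩ := h.exists_eq _ hzx
    have hlin : ∀ c : ℝ × ℝ, fderiv ℝ F (x, g x) c =
        c.1 * fderiv ℝ F (x, g x) (1, 0) + c.2 * fderiv ℝ F (x, g x) (0, 1) := fun c => by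
      have : c = c.1 • ((1, 0) : ℝ × ℝ) + c.2 • ((0, 1) : ℝ × ℝ) := by ext <;> simp
      conv_lhs => rw [this]
      rw [map_add, map_smul, map_smul, smul_eq_mul, smul_eq_mul]
    have hnz : fderiv ℝ F (x, g x) (1, 0) = 0 → fderiv ℝ F (x, g x) (0, 1) ≠ 0 := fun e1 e2 =>
      hF0 (ContinuousLinearMap.ext fun c => by rw [hlin, e1, e2]; simp)
    have htan : 0 < x → (α - β * deriv W (T x)) * fderiv ℝ F (x, g x) (1, 0) +
        (β + α * deriv W (T x)) * fderiv ℝ F (x, g x) (0, 1) = 0 ∧ deriv W (T x) < 0 := by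
      intro hx0
      have ht : t₀ < T x := (hT0 x hx).lt_of_ne fun he => by
        have := hT x hx; rw [← he, ha0] at this; exact hx0.ne this
      refine ⟨?_, hneg _ ht⟩
      have hgx := hgT x
      rw [abs_of_nonneg hx] at hgx
      have hd : HasDerivAt (fun t => framePoint (α, β) (-β, α) t (W t))
          (α - β * deriv W (T x), β + α * deriv W (T x)) (T x) := by
        have h1 := hWd _ ht
        have := (((hasDerivAt_id (T x)).mul_const α).add (h1.mul_const (-β))).prodMk
          (((hasDerivAt_id (T x)).mul_const β).add (h1.mul_const α))
        exact this.congr_deriv (by simp only [Prod.mk.injEq]; constructor <;> ring)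
      have hF' : HasFDerivAt F (fderiv ℝ F (x, g x))
          (framePoint (α, β) (-β, α) (T x) (W (T x))) := by
        rw [hgx]; exact (hF.differentiableAt (by simp)).hasFDerivAt
      have h5 := hF'.comp_hasDerivAt (T x) hd
      have h6 : HasDerivAt (F ∘ fun t => framePoint (α, β) (-β, α) t (W t)) 0 (T x) := by
        refine (hasDerivAt_const (T x) (0 : ℝ)).congr_of_eventuallyEq ?_
        have hc := hd.continuousAt.tendsto
        rw [hgx] at hc
        filter_upwards [hc.eventually hFΓ, Ioi_mem_nhds ht] with s s1 s2
        exact s1.1 (hW1 s (le_of_lt s2)).1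
      have h7 := h5.unique h6
      rw [hlin] at h7
      exact h7
    have hd : fderiv ℝ F (x, g x) (0, 1) ≠ 0 := by
      intro e2
      rcases hx.eq_or_lt with h0 | h0
      · exact hnz (hFa h0.symm) e2
      · obtain ⟨k1, k2⟩ := htan h0
        rw [e2, mul_zero, add_zero] at k1
        have : 0 < α - β * deriv W (T x) := by nlinarith
        exact hnz ((mul_eq_zero.1 k1).resolve_left this.ne') e2
    obtain ⟨v, v1, v2, v3, v4⟩ := isFrame_std.exists_graph hzx hF hFΓ hd
    simp only [dot_std_left, dot_std_right] at v1 v2 v3 v4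
    have hev : g =ᶠ[𝓝 x] v := by
      have hc : Tendsto (fun y => (y, v y)) (𝓝 x) (𝓝 (x, g x)) := by
        have := tendsto_id.prodMk_nhds v1.continuousAt.tendsto
        rwa [v2] at this
      have hvp : 0 < v x := by rw [v2]; exact hgpos x
      filter_upwards [hc.eventually v3, v1.continuousAt.eventually (lt_mem_nhds hvp)] with y y1 y2
      have := (hΓ _ _).1 (y1.2 rfl)
      rw [← this, abs_of_pos y2]
    refine ⟨v1.congr_of_eventuallyEq hev, fun h0 => ?_⟩
    obtain ⟨k1, k2⟩ := htan h0
    rw [hev.deriv_eq]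
    have k3 : (β + α * deriv W (T x)) - deriv v x * (α - β * deriv W (T x)) = 0 := by
      refine (mul_eq_zero.1 ?_).resolve_right hd
      linear_combination k1 - (α - β * deriv W (T x)) * v4
    -- In terms of W the slope is g' = (β + αW')/(α - βW'), so W' < 0 is exactly the bound g' < β/α.
    have k4 : (β - α * deriv v x) * (α - β * deriv W (T x)) = - deriv W (T x) := by
      linear_combination α * k3 - deriv W (T x) * h.cone_unit
    have k5 : 0 < α - β * deriv W (T x) := by nlinarith
    by_contra! hc
    nlinarith
  have hsmooth : ContDiff ℝ ∞ g := by
    rw [contDiff_iff_contDiffAt]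
    intro x
    rcases le_total 0 x with hx | hx
    · exact (hgloc x hx).1
    · have h1 := (hgloc (-x) (by linarith)).1
      have h2 := h1.comp x contDiff_neg.contDiffAt
      exact h2.congr_of_eventuallyEq (Eventually.of_forall fun y => (heven y).symm)
  have hcd : Continuous (deriv g) := hsmooth.continuous_deriv (by simp)
  have hd0 : deriv g 0 = 0 := by
    have := deriv_neg_of_even heven 0
    rw [neg_zero] at this; linarith
  have hode : ∀ x > 0, deriv (deriv g) x =
      (1 + deriv g x ^ 2) * (ν / g x - μ * deriv g x / x) := by
    intro x hx
    have hzx : ((x, g x) : ℝ × ℝ) ∈ Γ := by rw [hΓ, abs_of_pos (hgpos x)]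
    have := h.ode _ hzx hx (hgpos x) _ _ g isFrame_std
    simp only [dot_std_left, dot_std_right] at this
    rw [this (hsmooth.contDiffAt.of_le two_le_infty)]
    · ring
    · filter_upwards [continuous_snd.continuousAt.eventually
        (lt_mem_nhds (show (0 : ℝ) < (x, g x).2 from hgpos x))] with q hq
      rw [show q = (q.1, q.2) from rfl, hΓ, abs_of_pos hq]
  refine ⟨g, ⟨hsmooth, heven, hgpos, hode, ?_, ?_, ?_⟩, hΓ⟩
  -- Wherever g' < 0 both terms of the equation make g'' positive, so g' cannot become negative
  -- after starting at 0.
  · refine nonneg_of_deriv_pos hcd hd0 (fun x _ => ?_) fun x hx hneg => ?_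
    · exact (contDiffAt_deriv hsmooth.contDiffAt (l := 1) two_le_infty).differentiableAt (by simp)
    · rw [hode x hx]
      have h1 : 0 < ν / g x := div_pos hν (hgpos x)
      have h2 : μ * deriv g x / x ≤ 0 :=
        div_nonpos_of_nonpos_of_nonneg (mul_nonpos_of_nonneg_of_nonpos hμ.le hneg.le) hx.le
      have h3 : 0 < ν / g x - μ * deriv g x / x := by linarith
      positivity
  · intro x hx
    rcases hx.eq_or_lt with h0 | h0
    · rw [← h0, hd0]; simpa using hβ.le
    · exact (hgloc x hx).2 h0
  · intro x
    have := hs (x, g x) ((hΓ _ _).2 (abs_of_pos (hgpos x)))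
    rw [abs_of_pos (hgpos x)] at this
    exact (mul_le_mul_of_nonneg_left (le_abs_self x) hβ.le).trans_lt this

end IsProfile

end

/-! ### Averages over dilations, and smoothness of even functions of the norm. -/

section

section ScaledMean

variable {E : Type*} [NormedAddCommGroup E] [NormedSpace ℝ E]

/-- The weighted average `∫₀¹ tʲ φ(t r) dt` over dilations. -/
def scaledMean (j : ℕ) (φ : ℝ → E) (r : ℝ) : E := ∫ t in (0 : ℝ)..1, t ^ j • φ (t * r)

theorem continuous_scaledMean (j : ℕ) {φ : ℝ → E} (hφ : Continuous φ) :
    Continuous (scaledMean j φ) := by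
  refine intervalIntegral.continuous_parametric_intervalIntegral_of_continuous' ?_ _ _
  simp only [Function.uncurry_def]
  fun_prop

theorem hasDerivAt_scaledMean (j : ℕ) {φ : ℝ → E} (hφ : ContDiff ℝ 1 φ) (r : ℝ) :
    HasDerivAt (scaledMean j φ) (scaledMean (j + 1) (deriv φ) r) r := by
  have hc' : Continuous (deriv φ) := hφ.continuous_deriv le_rfl
  have hc : Continuous φ := hφ.continuous
  obtain ⟨C, hC⟩ := (isCompact_Icc (a := -(|r| + 1)) (b := |r| + 1)).exists_bound_of_continuousOn
    hc'.continuousOn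
  have hC0 : 0 ≤ C := (norm_nonneg _).trans (hC 0 ⟨by linarith [abs_nonneg r],
    by linarith [abs_nonneg r]⟩)
  refine (intervalIntegral.hasDerivAt_integral_of_dominated_loc_of_deriv_le
    (F := fun x t => t ^ j • φ (t * x)) (F' := fun x t => t ^ (j + 1) • deriv φ (t * x))
    (bound := fun _ => C) (Metric.ball_mem_nhds r one_pos) ?_ ?_ ?_ ?_ ?_ ?_).2
  · refine Eventually.of_forall fun x => Continuous.aestronglyMeasurable ?_
    fun_prop
  · refine Continuous.intervalIntegrable ?_ _ _
    fun_prop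
  · refine Continuous.aestronglyMeasurable ?_
    fun_prop
  · refine Eventually.of_forall fun t ht x hx => ?_
    rw [uIoc_of_le zero_le_one] at ht
    have h1 : |x| ≤ |r| + 1 := by
      rw [Metric.mem_ball, Real.dist_eq] at hx
      have := abs_sub_abs_le_abs_sub x r
      linarith
    have h2 : |t * x| ≤ |r| + 1 := by
      rw [abs_mul, abs_of_pos ht.1]
      exact (mul_le_of_le_one_left (abs_nonneg x) ht.2).trans h1
    rw [norm_smul, norm_pow, Real.norm_eq_abs, abs_of_pos ht.1]
    calc t ^ (j + 1) * ‖deriv φ (t * x)‖ ≤ 1 * C :=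
          mul_le_mul (pow_le_one₀ ht.1.le ht.2) (hC _ (abs_le.1 h2)) (norm_nonneg _) zero_le_one
      _ = C := one_mul C
  · exact intervalIntegrable_const
  · refine Eventually.of_forall fun t _ x _ => ?_
    have h1 : HasDerivAt φ (deriv φ (t * x)) (t * x) :=
      ((hφ.differentiable one_ne_zero) _).hasDerivAt
    have h2 := (h1.scomp x ((hasDerivAt_id x).const_mul t)).const_smul (t ^ j)
    refine h2.congr_deriv ?_
    rw [mul_one, smul_smul, pow_succ]

/-- Differentiation only raises the weight j by one and replaces φ by φ', so no regularity is lost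
at r = 0, where r^{-(j+1)} ∫₀^r sʲφ looks singular. -/
theorem contDiff_scaledMean {n : ℕ} (j : ℕ) {φ : ℝ → E} (hφ : ContDiff ℝ n φ) :
    ContDiff ℝ n (scaledMean j φ) := by
  induction n generalizing j φ with
  | zero => exact contDiff_zero.2 (continuous_scaledMean j hφ.continuous)
  | succ n ih =>
    have h1 : ContDiff ℝ 1 φ := hφ.of_le (by simp)
    have hd : deriv (scaledMean j φ) = scaledMean (j + 1) (deriv φ) :=
      funext fun r => (hasDerivAt_scaledMean j h1 r).deriv
    rw [Nat.cast_succ, contDiff_succ_iff_deriv] at hφ ⊢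
    refine ⟨fun r => (hasDerivAt_scaledMean j h1 r).differentiableAt, by simp, ?_⟩
    rw [hd]
    exact ih (j + 1) hφ.2.2

/-- Hadamard's lemma on the line. -/
theorem smul_scaledMean_deriv [CompleteSpace E] {φ : ℝ → E} (hφ : ContDiff ℝ 1 φ) (h0 : φ 0 = 0)
    (r : ℝ) : r • scaledMean 0 (deriv φ) r = φ r := by
  have hc' : Continuous (deriv φ) := hφ.continuous_deriv le_rfl
  have h1 : r • scaledMean 0 (deriv φ) r = ∫ t in (0 : ℝ)..1, r • deriv φ (t * r) := by
    simp [scaledMean, intervalIntegral.integral_smul]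
  rw [h1, intervalIntegral.integral_eq_sub_of_hasDerivAt (f := fun t => φ (t * r))]
  · simp [h0]
  · intro t _
    have h2 : HasDerivAt φ (deriv φ (t * r)) (t * r) :=
      ((hφ.differentiable one_ne_zero) _).hasDerivAt
    exact (h2.scomp t ((hasDerivAt_id t).mul_const r)).congr_deriv (by rw [one_mul])
  · refine Continuous.intervalIntegrable ?_ _ _
    fun_prop

end ScaledMean

/-- A smooth even function of the norm is smooth. -/
theorem contDiff_comp_norm {F : Type*} [NormedAddCommGroup F] [InnerProductSpace ℝ F] {H : ℝ → ℝ}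
    (hH : ContDiff ℝ ∞ H) (he : ∀ r, H (-r) = H r) : ContDiff ℝ ∞ fun x : F => H ‖x‖ := by
  rw [contDiff_infty]
  intro n
  induction n generalizing H with
  | zero => exact contDiff_zero.2 (hH.continuous.comp continuous_norm)
  | succ n ih =>
    have hd : ContDiff ℝ ∞ (deriv H) := (contDiff_infty_iff_deriv.1 hH).2
    have hdd : ContDiff ℝ ∞ (deriv (deriv H)) := (contDiff_infty_iff_deriv.1 hd).2
    have hodd := deriv_neg_of_even he
    have h0 : deriv H 0 = 0 := by
      have := hodd 0
      rw [neg_zero] at this; linarith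
    -- k(r) = H'(r)/r extended across 0; it is again smooth and even. The derivative of x ↦ H(‖x‖)
    -- is k(‖x‖)⟨x, ·⟩, so the induction applies to k.
    set k := scaledMean 0 (deriv (deriv H)) with hk
    have hkr : ∀ r, r * k r = deriv H r := smul_scaledMean_deriv (hd.of_le (by simp)) h0
    have hks : ContDiff ℝ ∞ k := contDiff_infty.2 fun l =>
      contDiff_scaledMean 0 (hdd.of_le (by exact_mod_cast le_top))
    have hke : ∀ r, k (-r) = k r := fun r => by
      have h2 : ∀ s, deriv (deriv H) (-s) = deriv (deriv H) s := fun s => by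
        have h1 := deriv_comp_neg (deriv H) s
        rw [show (fun x => deriv H (-x)) = fun x => -deriv H x from funext hodd,
          deriv.fun_neg] at h1
        linarith
      simp only [hk, scaledMean, mul_neg, h2]
    rw [Nat.cast_succ, contDiff_succ_iff_hasFDerivAt]
    refine ⟨fun x => k ‖x‖ • innerSL ℝ x, (ih hks hke).smul (innerSL ℝ).contDiff, fun x => ?_⟩
    have hHd : HasDerivAt H (deriv H ‖x‖) ‖x‖ := (hH.differentiable (by simp) _).hasDerivAt
    by_cases hx : x = 0
    · rw [hx] at hHd ⊢
      rw [norm_zero, h0] at hHd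
      have : k ‖(0 : F)‖ • innerSL ℝ (0 : F) = 0 := by simp
      change HasFDerivAt _ (k ‖(0 : F)‖ • innerSL ℝ (0 : F)) _
      rw [this]
      rw [hasDerivAt_iff_isLittleO] at hHd
      rw [hasFDerivAt_iff_isLittleO]
      have ht : Tendsto (fun y : F => ‖y‖) (𝓝 0) (𝓝 0) := tendsto_norm_zero
      have := (hHd.comp_tendsto ht)
      refine Asymptotics.IsLittleO.of_norm_right ?_
      simpa [Function.comp_def] using this
    · have h1 : HasFDerivAt (fun y : F => ‖y‖) (‖x‖⁻¹ • innerSL ℝ x) x := by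
        have h2 := (hasStrictFDerivAt_norm_sq x).hasFDerivAt.sqrt (by simpa using hx)
        simp only [Real.sqrt_sq (norm_nonneg _)] at h2
        refine h2.congr_fderiv ?_
        ext y
        simp
        field_simp
      refine (hHd.comp_hasFDerivAt x h1).congr_fderiv ?_
      rw [smul_smul, ← hkr]
      congr 1
      have : ‖x‖ ≠ 0 := by simpa using hx
      field_simp


end

/-! ### A singular initial value problem as a fixed point equation. -/

section

section SingularIntegral

variable {E : Type*} [NormedAddCommGroup E] [NormedSpace ℝ E]

/-- The solution `H` of `(sʲ ρ H')' = sʲ ρ φ` with `H(0) = H'(0) = 0`. -/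
def singularIntegral (j : ℕ) (ρ : ℝ → ℝ) (φ : ℝ → E) (a : ℝ) : E :=
  ∫ s in (0 : ℝ)..a, s • (ρ s)⁻¹ • scaledMean j (fun r => ρ r • φ r) s

variable {j : ℕ} {ρ : ℝ → ℝ} {φ ψ : ℝ → E}

theorem continuous_singularIntegrand (hρ : Continuous ρ) (hpos : ∀ a, 0 < ρ a)
    (hφ : Continuous φ) :
    Continuous fun s => s • (ρ s)⁻¹ • scaledMean j (fun r => ρ r • φ r) s :=
  continuous_id.smul ((hρ.inv₀ fun a => (hpos a).ne').smul (continuous_scaledMean j (hρ.smul hφ)))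

theorem hasDerivAt_singularIntegral [CompleteSpace E] (hρ : Continuous ρ) (hpos : ∀ a, 0 < ρ a)
    (hφ : Continuous φ) (a : ℝ) :
    HasDerivAt (singularIntegral j ρ φ) (a • (ρ a)⁻¹ • scaledMean j (fun r => ρ r • φ r) a) a :=
  (continuous_singularIntegrand hρ hpos hφ).integral_hasStrictDerivAt 0 a |>.hasDerivAt

theorem singularIntegral_neg (hρ : ∀ a, ρ (-a) = ρ a) (hφ : ∀ a, φ (-a) = φ a) (a : ℝ) :
    singularIntegral j ρ φ (-a) = singularIntegral j ρ φ a := by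
  have h1 : ∀ s, scaledMean j (fun r => ρ r • φ r) (-s) = scaledMean j (fun r => ρ r • φ r) s :=
    fun s => by simp only [scaledMean, mul_neg, hρ, hφ]
  have h2 := intervalIntegral.integral_comp_neg (a := (0 : ℝ)) (b := a)
    (fun s => s • (ρ s)⁻¹ • scaledMean j (fun r => ρ r • φ r) s)
  simp only [hρ, h1, neg_smul, neg_neg, neg_zero, intervalIntegral.integral_neg] at h2
  unfold singularIntegral
  rw [intervalIntegral.integral_symm, ← h2, neg_neg]

theorem singularIntegral_sub (hρ : Continuous ρ) (hpos : ∀ a, 0 < ρ a)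
    (hφ : Continuous φ) (hψ : Continuous ψ) (a : ℝ) :
    singularIntegral j ρ φ a - singularIntegral j ρ ψ a = singularIntegral j ρ (φ - ψ) a := by
  unfold singularIntegral
  rw [← intervalIntegral.integral_sub
    ((continuous_singularIntegrand hρ hpos hφ).intervalIntegrable _ _)
    ((continuous_singularIntegrand hρ hpos hψ).intervalIntegrable _ _)]
  congr 1
  ext s
  rw [← smul_sub, ← smul_sub]
  congr 2
  unfold scaledMean
  rw [← intervalIntegral.integral_sub]
  · simp [smul_sub]
  · exact Continuous.intervalIntegrable (by fun_prop) _ _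
  · exact Continuous.intervalIntegrable (by fun_prop) _ _

/-- Since ρ is nondecreasing, dividing the average by ρ leaves at most C e^{κs²}. The factor s is
the derivative needed to integrate this weight, and the gain 1/(2κ) makes the operator a contraction
for large κ. -/
theorem norm_singularIntegral_le (hρ : Continuous ρ) (hpos : ∀ a, 0 < ρ a)
    (hmono : MonotoneOn ρ (Ici 0)) {C κ : ℝ} (hκ : 0 < κ)
    (hC : ∀ r, ‖φ r‖ ≤ C * Real.exp (κ * r ^ 2)) {a : ℝ} (ha : 0 ≤ a) :
    ‖singularIntegral j ρ φ a‖ ≤ C / (2 * κ) * Real.exp (κ * a ^ 2) := by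
  have hC0 : 0 ≤ C := by
    have := (norm_nonneg _).trans (hC 0)
    simpa using this
  have h1 : ∀ s ≥ 0, ‖(ρ s)⁻¹ • scaledMean j (fun r => ρ r • φ r) s‖ ≤
      C * Real.exp (κ * s ^ 2) := by
    intro s hs
    have h2 : ‖scaledMean j (fun r => ρ r • φ r) s‖ ≤ ρ s * (C * Real.exp (κ * s ^ 2)) := by
      have := intervalIntegral.norm_integral_le_of_norm_le_const (a := (0 : ℝ)) (b := 1)
        (f := fun t => t ^ j • (fun r => ρ r • φ r) (t * s))
        (C := ρ s * (C * Real.exp (κ * s ^ 2))) ?_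
      · simpa [scaledMean] using this
      · intro t ht
        rw [uIoc_of_le zero_le_one] at ht
        have hts : t * s ≤ s := mul_le_of_le_one_left hs ht.2
        have hts0 : 0 ≤ t * s := mul_nonneg ht.1.le hs
        rw [norm_smul, norm_smul, norm_pow, Real.norm_eq_abs, Real.norm_eq_abs,
          abs_of_pos ht.1, abs_of_pos (hpos _)]
        have h3 : ρ (t * s) ≤ ρ s := hmono hts0 hs hts
        have h4 : ‖φ (t * s)‖ ≤ C * Real.exp (κ * s ^ 2) := by
          refine (hC _).trans ?_
          gcongr
        calc t ^ j * (ρ (t * s) * ‖φ (t * s)‖) ≤ 1 * (ρ (t * s) * ‖φ (t * s)‖) :=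
              mul_le_mul_of_nonneg_right (pow_le_one₀ ht.1.le ht.2)
                (mul_nonneg (hpos _).le (norm_nonneg _))
          _ ≤ ρ s * (C * Real.exp (κ * s ^ 2)) := by
              rw [one_mul]
              exact mul_le_mul h3 h4 (norm_nonneg _) (hpos _).le
    rw [norm_smul, norm_inv, Real.norm_eq_abs, abs_of_pos (hpos s), inv_mul_le_iff₀ (hpos s)]
    exact h2
  have h5 : ∀ s, HasDerivAt (fun s => C / (2 * κ) * Real.exp (κ * s ^ 2))
      (C * (s * Real.exp (κ * s ^ 2))) s := fun s => by
    refine ((((hasDerivAt_pow 2 s).const_mul κ).exp).const_mul (C / (2 * κ))).congr_deriv ?_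
    field_simp
    simp
  have h6 : ∫ s in (0 : ℝ)..a, C * (s * Real.exp (κ * s ^ 2)) =
      C / (2 * κ) * Real.exp (κ * a ^ 2) - C / (2 * κ) * Real.exp (κ * 0 ^ 2) :=
    intervalIntegral.integral_eq_sub_of_hasDerivAt (fun s _ => h5 s)
      (Continuous.intervalIntegrable (by fun_prop) _ _)
  have h7 := intervalIntegral.norm_integral_le_of_norm_le (f := fun s => s • (ρ s)⁻¹ •
    scaledMean j (fun r => ρ r • φ r) s) (g := fun s => C * (s * Real.exp (κ * s ^ 2)))
    (μ := MeasureTheory.volume) ha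
    (Eventually.of_forall fun s hs => by
      rw [norm_smul, Real.norm_eq_abs, abs_of_pos hs.1]
      have := mul_le_mul_of_nonneg_left (h1 s hs.1.le) hs.1.le
      linarith)
    (Continuous.intervalIntegrable (by fun_prop) _ _)
  refine h7.trans ?_
  rw [h6]
  have : 0 ≤ C / (2 * κ) * Real.exp (κ * 0 ^ 2) := by positivity
  linarith

/-- Banach's fixed point theorem in the sup norm with weight e^{κr²}. The choice κ = L + 1 makes the
contraction factor L/(2κ) ≤ 1/2, so the solution is global without any smallness. -/
theorem exists_eq_add_singularIntegral [CompleteSpace E] (j : ℕ) (hρ : Continuous ρ)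
    (hpos : ∀ a, 0 < ρ a) (heven : ∀ a, ρ (-a) = ρ a) (hmono : MonotoneOn ρ (Ici 0))
    {G : ℝ → E → E} (hG : Continuous (Function.uncurry G)) (hGe : ∀ a x, G (-a) x = G a x)
    {L M : ℝ} (hL : ∀ a x y, ‖G a x - G a y‖ ≤ L * ‖x - y‖) (hM : ∀ a, ‖G a 0‖ ≤ M) (x₀ : E) :
    ∃ H : ℝ → E, Continuous H ∧ (∀ a, H (-a) = H a) ∧
      ∀ a, H a = x₀ + singularIntegral j ρ (fun r => G r (H r)) a := by
  wlog hL0 : 0 ≤ L generalizing L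
  · exact this (L := |L|) (fun a x y => (hL a x y).trans
      (mul_le_mul_of_nonneg_right (le_abs_self L) (norm_nonneg _))) (abs_nonneg L)
  have hM0 : 0 ≤ M := (norm_nonneg _).trans (hM 0)
  set κ := L + 1 with hκdef
  have hκ : 0 < κ := by positivity
  set Ω : ℝ → ℝ := fun r => Real.exp (κ * r ^ 2) with hΩ
  have hΩ0 : ∀ r, 0 < Ω r := fun r => Real.exp_pos _
  have hΩ1 : ∀ r, 1 ≤ Ω r := fun r => Real.one_le_exp (by positivity)
  have hΩc : Continuous Ω := by fun_prop
  have hΩe : ∀ r, Ω (-r) = Ω r := fun r => by simp [hΩ]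
  -- The unknown is u with H = Ωu. Reading u at |r| makes the integrand even for every u, so all
  -- bounds reduce to a ≥ 0; the fixed point is even, which removes the absolute value at the end.
  set Φ : BoundedContinuousFunction ℝ E → ℝ → E := fun u r => G r (Ω r • u |r|) with hΦ
  have hΦc : ∀ u, Continuous (Φ u) := fun u => by
    have : Continuous fun r : ℝ => (r, Ω r • u |r|) :=
      continuous_id.prodMk (hΩc.smul (u.continuous.comp continuous_abs))
    exact hG.comp this
  have hΦe : ∀ u r, Φ u (-r) = Φ u r := fun u r => by simp only [hΦ, hΩe, abs_neg, hGe]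
  have hΦsub : ∀ u v r, ‖Φ u r - Φ v r‖ ≤ L * ‖u - v‖ * Ω r := fun u v r => by
    refine (hL _ _ _).trans ?_
    rw [← smul_sub, norm_smul, Real.norm_eq_abs, abs_of_pos (hΩ0 r)]
    have := (u - v).norm_coe_le_norm |r|
    have := mul_le_mul_of_nonneg_left this (mul_nonneg hL0 (hΩ0 r).le)
    simp only [BoundedContinuousFunction.coe_sub, Pi.sub_apply] at this
    linarith
  have hΦb : ∀ u r, ‖Φ u r‖ ≤ (M + L * ‖u‖) * Ω r := fun u r => by
    have h1 := hΦsub u 0 r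
    have h2 : ‖Φ 0 r‖ ≤ M * Ω r := by
      simp only [hΦ, BoundedContinuousFunction.coe_zero, Pi.zero_apply, smul_zero]
      exact (hM r).trans (le_mul_of_one_le_right hM0 (hΩ1 r))
    rw [sub_zero] at h1
    have h3 := norm_add_le (Φ u r - Φ 0 r) (Φ 0 r)
    rw [sub_add_cancel] at h3
    linarith
  have habs : ∀ u a, singularIntegral j ρ (Φ u) a = singularIntegral j ρ (Φ u) |a| := fun u a => by
    rcases abs_choice a with h | h <;> rw [h]
    exact (singularIntegral_neg heven (hΦe u) a).symm
  have hΩabs : ∀ a, Ω |a| = Ω a := fun a => by simp [hΩ]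
  have hint : ∀ u a, ‖singularIntegral j ρ (Φ u) a‖ ≤ (M + L * ‖u‖) / (2 * κ) * Ω a := fun u a => by
    rw [habs, ← hΩabs a]
    exact norm_singularIntegral_le hρ hpos hmono hκ (hΦb u) (abs_nonneg a)
  have hintsub : ∀ u v a, ‖singularIntegral j ρ (Φ u) a - singularIntegral j ρ (Φ v) a‖ ≤
      (L * ‖u - v‖) / (2 * κ) * Ω a := fun u v a => by
    rw [habs, habs v, ← hΩabs a, singularIntegral_sub hρ hpos (hΦc u) (hΦc v)]
    exact norm_singularIntegral_le hρ hpos hmono hκ (hΦsub u v) (abs_nonneg a)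
  have hIc : ∀ u, Continuous (singularIntegral j ρ (Φ u)) := fun u =>
    continuous_iff_continuousAt.2 fun a =>
      (hasDerivAt_singularIntegral hρ hpos (hΦc u) a).continuousAt
  have hTb : ∀ u a, ‖(Ω a)⁻¹ • (x₀ + singularIntegral j ρ (Φ u) a)‖ ≤
      ‖x₀‖ + (M + L * ‖u‖) / (2 * κ) := fun u a => by
    rw [norm_smul, norm_inv, Real.norm_eq_abs, abs_of_pos (hΩ0 a), inv_mul_le_iff₀ (hΩ0 a)]
    have h1 := norm_add_le x₀ (singularIntegral j ρ (Φ u) a)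
    have h2 := hint u a
    have h3 := le_mul_of_one_le_left (norm_nonneg x₀) (hΩ1 a)
    linarith
  let T : BoundedContinuousFunction ℝ E → BoundedContinuousFunction ℝ E := fun u =>
    BoundedContinuousFunction.ofNormedAddCommGroup
      (fun a => (Ω a)⁻¹ • (x₀ + singularIntegral j ρ (Φ u) a))
      ((hΩc.inv₀ fun a => (hΩ0 a).ne').smul (continuous_const.add (hIc u))) _ (hTb u)
  have hT : ContractingWith (1 / 2) T := by
    refine ⟨by rw [← NNReal.coe_lt_coe]; norm_num, LipschitzWith.of_dist_le_mul fun u v => ?_⟩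
    rw [dist_eq_norm, dist_eq_norm]
    refine (BoundedContinuousFunction.norm_le (by positivity)).2 fun a => ?_
    have h1 : (T u - T v) a =
        (Ω a)⁻¹ • (singularIntegral j ρ (Φ u) a - singularIntegral j ρ (Φ v) a) := by
      change (Ω a)⁻¹ • (x₀ + singularIntegral j ρ (Φ u) a) -
        (Ω a)⁻¹ • (x₀ + singularIntegral j ρ (Φ v) a) = _
      rw [← smul_sub, add_sub_add_left_eq_sub]
    rw [h1, norm_smul, norm_inv, Real.norm_eq_abs, abs_of_pos (hΩ0 a), inv_mul_le_iff₀ (hΩ0 a)]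
    refine (hintsub u v a).trans ?_
    rw [mul_comm]
    refine mul_le_mul_of_nonneg_left ?_ (hΩ0 a).le
    rw [div_le_iff₀ (by positivity)]
    have : L ≤ κ := by linarith
    have := mul_le_mul_of_nonneg_right this (norm_nonneg (u - v))
    simp only [NNReal.coe_div, NNReal.coe_one, NNReal.coe_ofNat]
    linarith
  set u := ContractingWith.fixedPoint T hT with hu
  have hfix : T u = u := hT.fixedPoint_isFixedPt
  have hH : ∀ a, Ω a • u a = x₀ + singularIntegral j ρ (Φ u) a := fun a => by
    conv_lhs => rw [← hfix]
    exact smul_inv_smul₀ (hΩ0 a).ne' _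
  have hHe : ∀ a, Ω (-a) • u (-a) = Ω a • u a := fun a => by
    rw [hH, hH, singularIntegral_neg heven (hΦe u)]
  refine ⟨fun a => Ω a • u a, hΩc.smul u.continuous, hHe, fun a => ?_⟩
  have : Φ u = fun r => G r (Ω r • u r) := funext fun r => by
    simp only [hΦ]
    rcases abs_choice r with h | h <;> rw [h]
    rw [← hHe r, hΩe]
  rw [← this]
  exact hH a

/-- The equation satisfied by the second derivative of a singular integral. -/
theorem hasDerivAt_deriv_singularIntegral [CompleteSpace E] (hρ : Differentiable ℝ ρ)
    (hpos : ∀ a, 0 < ρ a) (hφ : Continuous φ) {a : ℝ} (ha : 0 < a) :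
    HasDerivAt (deriv (singularIntegral j ρ φ))
      (φ a - (j / a + deriv ρ a / ρ a) • deriv (singularIntegral j ρ φ) a) a := by
  have hρc := hρ.continuous
  have hd : deriv (singularIntegral j ρ φ) =
      fun a => a • (ρ a)⁻¹ • scaledMean j (fun r => ρ r • φ r) a :=
    funext fun a => (hasDerivAt_singularIntegral hρc hpos hφ a).deriv
  set N : ℝ → E := fun s => ∫ r in (0 : ℝ)..s, r ^ j • ρ r • φ r with hN
  have hNd : HasDerivAt N (a ^ j • ρ a • φ a) a :=
    (Continuous.integral_hasStrictDerivAt (f := fun r => r ^ j • ρ r • φ r)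
      (by fun_prop) 0 a).hasDerivAt
  -- The substitution r = ts turns the average into s^{-(j+1)} ∫₀^s; away from 0 the derivative is
  -- then (sʲρ)⁻¹ N, to which the product rule applies.
  have hs : ∀ s > 0, (s ^ j * ρ s)⁻¹ • N s =
      s • (ρ s)⁻¹ • scaledMean j (fun r => ρ r • φ r) s := fun s hs => by
    have h1 : N s = s • s ^ j • scaledMean j (fun r => ρ r • φ r) s := by
      have h2 := intervalIntegral.smul_integral_comp_mul_right
        (f := fun r => r ^ j • ρ r • φ r) (a := (0 : ℝ)) (b := 1) s
      rw [zero_mul, one_mul] at h2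
      rw [hN]
      simp only
      rw [← h2]
      congr 1
      rw [scaledMean, ← intervalIntegral.integral_smul]
      congr 1
      ext t
      simp only [smul_smul, mul_pow]
      congr 1
      ring
    rw [h1, smul_smul, smul_smul, smul_smul]
    congr 1
    have := (hpos s).ne'
    field_simp
  have hev : deriv (singularIntegral j ρ φ) =ᶠ[𝓝 a] fun s => (s ^ j * ρ s)⁻¹ • N s := by
    filter_upwards [Ioi_mem_nhds ha] with s h
    rw [hd, hs s h]
  have hq : HasDerivAt (fun s => (s ^ j * ρ s)⁻¹)
      (-(j / a + deriv ρ a / ρ a) * (a ^ j * ρ a)⁻¹) a := by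
    have h1 : HasDerivAt ρ (deriv ρ a) a := (hρ a).hasDerivAt
    have h2 := ((hasDerivAt_pow j a).mul h1).inv
      (mul_ne_zero (pow_ne_zero _ ha.ne') (hpos a).ne')
    refine h2.congr_deriv ?_
    have := (hpos a).ne'
    rcases j with _ | j
    · simp; field_simp
    · simp only [Nat.add_sub_cancel, Pi.mul_apply]
      field_simp
      ring
  have := (hq.smul hNd).congr_of_eventuallyEq hev
  refine this.congr_deriv ?_
  rw [hev.self_of_nhds, mul_smul, smul_smul, smul_smul, neg_smul]
  have h3 : (a ^ j * ρ a)⁻¹ * (a ^ j * ρ a) = 1 :=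
    inv_mul_cancel₀ (mul_ne_zero (pow_ne_zero _ ha.ne') (hpos a).ne')
  rw [mul_assoc, h3, one_smul, ← sub_eq_add_neg]

/-- Bootstrap: H' is s ρ⁻¹ times an average of ρφ, so φ of class Cⁿ gives H of class Cⁿ⁺¹, across s
= 0 as well. -/
theorem contDiff_of_eq_add_singularIntegral [CompleteSpace E] (hρ : ContDiff ℝ ∞ ρ)
    (hpos : ∀ a, 0 < ρ a) (hφ : Continuous φ) {H : ℝ → E} {x₀ : E}
    (hH : ∀ a, H a = x₀ + singularIntegral j ρ φ a)
    (hs : ∀ n : ℕ, ContDiff ℝ n H → ContDiff ℝ n φ) : ContDiff ℝ ∞ H := by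
  have hHd : ∀ a, HasDerivAt H (a • (ρ a)⁻¹ • scaledMean j (fun r => ρ r • φ r) a) a := fun a => by
    rw [show H = fun a => x₀ + singularIntegral j ρ φ a from funext hH]
    exact (hasDerivAt_singularIntegral hρ.continuous hpos hφ a).const_add x₀
  rw [contDiff_infty]
  intro n
  induction n with
  | zero => exact contDiff_zero.2 (continuous_iff_continuousAt.2 fun a => (hHd a).continuousAt)
  | succ n ih =>
    rw [Nat.cast_succ, contDiff_succ_iff_deriv]
    refine ⟨fun a => (hHd a).differentiableAt, by simp, ?_⟩
    rw [show deriv H = _ from funext fun a => (hHd a).deriv]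
    have hρn : ContDiff ℝ n ρ := hρ.of_le (by exact_mod_cast le_top)
    exact contDiff_id.smul ((hρn.inv fun a => (hpos a).ne').smul
      (contDiff_scaledMean j (hρn.smul (hs n ih))))

end SingularIntegral


end

/-! ### Curvature of a profile graph compared with that of the cone. -/

section

/-- The smooth extension of `g' / a` across the axis, for a profile graph `g`. -/
def slopeQuotient (μ ν : ℝ) (g : ℝ → ℝ) (a : ℝ) : ℝ :=
  (ν / g a - deriv (deriv g) a / (1 + deriv g a ^ 2)) / μ

/-- The squared norm of the second fundamental form along a profile graph. -/
def profileNormSqA (μ ν : ℝ) (g : ℝ → ℝ) (a : ℝ) : ℝ :=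
  ((ν / g a - μ * slopeQuotient μ ν g a) ^ 2 + μ * slopeQuotient μ ν g a ^ 2 + ν / g a ^ 2) /
    (1 + deriv g a ^ 2)

/-- The density of the Laplace operator along a profile graph, without the factor `a ^ μ`. -/
def profileDensity (ν : ℝ) (g : ℝ → ℝ) (a : ℝ) : ℝ :=
  Real.exp (ν * Real.log (g a) - Real.log (1 + deriv g a ^ 2) / 2)

namespace IsProfileGraph

variable {μ ν α β : ℝ} {g : ℝ → ℝ} (h : IsProfileGraph μ ν α β g)
include h

theorem contDiff_deriv : ContDiff ℝ ∞ (deriv g) := (contDiff_infty_iff_deriv.1 h.smooth).2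

theorem contDiff_deriv_deriv : ContDiff ℝ ∞ (deriv (deriv g)) :=
  (contDiff_infty_iff_deriv.1 h.contDiff_deriv).2

theorem deriv_neg (a : ℝ) : deriv g (-a) = -deriv g a := deriv_neg_of_even h.even a

theorem deriv_zero : deriv g 0 = 0 := by
  have := h.deriv_neg 0
  rw [neg_zero] at this; linarith

theorem deriv_deriv_neg (a : ℝ) : deriv (deriv g) (-a) = deriv (deriv g) a := by
  have h1 := deriv_comp_neg (deriv g) a
  rw [show (fun x => deriv g (-x)) = fun x => -deriv g x from funext h.deriv_neg,
    deriv.fun_neg] at h1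
  linarith

theorem one_add_pos (a : ℝ) : 0 < 1 + deriv g a ^ 2 := by positivity

theorem slopeQuotient_neg (a : ℝ) : slopeQuotient μ ν g (-a) = slopeQuotient μ ν g a := by
  simp only [slopeQuotient, h.even, h.deriv_deriv_neg, h.deriv_neg, neg_sq]

theorem profileNormSqA_neg (a : ℝ) : profileNormSqA μ ν g (-a) = profileNormSqA μ ν g a := by
  simp only [profileNormSqA, h.even, h.slopeQuotient_neg, h.deriv_neg, neg_sq]

theorem profileDensity_neg (a : ℝ) : profileDensity ν g (-a) = profileDensity ν g a := by
  simp only [profileDensity, h.even, h.deriv_neg, neg_sq]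

theorem contDiff_slopeQuotient : ContDiff ℝ ∞ (slopeQuotient μ ν g) :=
  ((contDiff_const.div h.smooth fun a => (h.pos a).ne').sub
    (h.contDiff_deriv_deriv.div (contDiff_const.add (h.contDiff_deriv.pow 2))
      fun a => (h.one_add_pos a).ne')).div_const μ

theorem contDiff_profileNormSqA : ContDiff ℝ ∞ (profileNormSqA μ ν g) := by
  have h1 := h.contDiff_slopeQuotient
  have h2 : ContDiff ℝ ∞ fun a => ν / g a :=
    contDiff_const.div h.smooth fun a => (h.pos a).ne'
  have h3 : ContDiff ℝ ∞ fun a => ν / g a ^ 2 :=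
    contDiff_const.div (h.smooth.pow 2) fun a => (pow_pos (h.pos a) 2).ne'
  exact ((((h2.sub (contDiff_const.mul h1)).pow 2).add (contDiff_const.mul (h1.pow 2))).add h3).div
    (contDiff_const.add (h.contDiff_deriv.pow 2)) fun a => (h.one_add_pos a).ne'

theorem contDiff_profileDensity : ContDiff ℝ ∞ (profileDensity ν g) :=
  ((contDiff_const.mul (h.smooth.log fun a => (h.pos a).ne')).sub
    (((contDiff_const.add (h.contDiff_deriv.pow 2)).log
      fun a => (h.one_add_pos a).ne').div_const 2)).exp

omit h in
theorem profileDensity_pos (a : ℝ) : 0 < profileDensity ν g a := Real.exp_pos _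

/-- `slopeQuotient` is the profile equation solved for g'/a; that expression is not singular at a =
0, where the identity holds since g'(0) = 0. -/
theorem mul_slopeQuotient (hμ : 0 < μ) {a : ℝ} (ha : 0 ≤ a) :
    a * slopeQuotient μ ν g a = deriv g a := by
  rcases ha.eq_or_lt with h0 | h0
  · rw [← h0, zero_mul, h.deriv_zero]
  · rw [slopeQuotient, h.ode a h0, mul_div_cancel_left₀ _ (h.one_add_pos a).ne']
    field_simp
    ring

/-- The density is g^ν/√(1 + g'²). Its logarithmic derivative g'(ν/g - g''/(1 + g'²)) simplifies by
the profile equation. -/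
theorem deriv_profileDensity (hμ : 0 < μ) {a : ℝ} (ha : 0 ≤ a) :
    deriv (profileDensity ν g) a / profileDensity ν g a =
      μ * (deriv g a * slopeQuotient μ ν g a) := by
  have h1 : HasDerivAt g (deriv g a) a := (h.smooth.differentiable (by simp) a).hasDerivAt
  have h2 : HasDerivAt (deriv g) (deriv (deriv g) a) a :=
    (h.contDiff_deriv.differentiable (by simp) a).hasDerivAt
  have h3 := (((h1.log (h.pos a).ne').const_mul ν).sub
    ((((h2.pow 2).const_add 1).log (h.one_add_pos a).ne').div_const 2)).exp
  have h4 : deriv (profileDensity ν g) a = _ := h3.deriv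
  rw [h4, mul_comm, profileDensity]
  simp only [Pi.sub_apply, Pi.pow_apply]
  rw [mul_div_assoc, div_self (Real.exp_pos _).ne', slopeQuotient]
  have := (h.one_add_pos a).ne'
  have := (h.pos a).ne'
  field_simp
  ring

theorem slopeQuotient_nonneg (hμ : 0 < μ) {a : ℝ} (ha : 0 < a) : 0 ≤ slopeQuotient μ ν g a := by
  have h1 := h.mul_slopeQuotient hμ ha.le
  have h2 := h.deriv_nonneg a ha.le
  rw [← h1] at h2
  exact nonneg_of_mul_nonneg_right h2 ha

theorem monotoneOn_profileDensity (hμ : 0 < μ) : MonotoneOn (profileDensity ν g) (Ici 0) := by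
  refine monotoneOn_of_deriv_nonneg (convex_Ici _) h.contDiff_profileDensity.continuous.continuousOn
    (h.contDiff_profileDensity.differentiable (by simp)).differentiableOn fun a ha => ?_
  rw [interior_Ici] at ha
  have ha : 0 < a := ha
  have h1 := h.deriv_profileDensity hμ ha.le
  rw [div_eq_iff (profileDensity_pos a).ne'] at h1
  rw [h1]
  exact mul_nonneg (mul_nonneg hμ.le (mul_nonneg (h.deriv_nonneg a ha.le)
    (h.slopeQuotient_nonneg hμ ha))) (profileDensity_pos a).le

set_option maxHeartbeats 800000 in
/-- The squared norm of the second fundamental form agrees with that of the cone up to an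
integrable error. -/
theorem exists_normSqA_bound (hμ : 0 < μ) (hν : 0 < ν) (hα : 0 < α) (hβ : 0 < β)
    (hcone : ν * α ^ 2 = μ * β ^ 2) : ∃ D > 0, ∀ a ≥ 0,
    √(1 + a ^ 2) * |profileNormSqA μ ν g a - μ / (1 + a ^ 2)| ≤
      D * (1 / (1 + a ^ 2) + (β / α - deriv g a)) := by
  set c := β / α with hc
  have hc0 : 0 < c := div_pos hβ hα
  have hy : ∀ a ≥ 0, 0 ≤ deriv g a ∧ deriv g a ≤ c := fun a ha =>
    ⟨h.deriv_nonneg a ha, by rw [hc, le_div_iff₀ hα, mul_comm]; exact h.deriv_le a ha⟩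
  have hv : ∀ a, c * a < g a := fun a => by
    have := h.side a
    rw [hc, div_mul_eq_mul_div, div_lt_iff₀ hα]; linarith
  have hcone' : μ * c ^ 2 = ν := by
    rw [hc, div_pow, mul_div_assoc', ← hcone]; field_simp
  -- The vertical distance to the cone does not increase, because g' ≤ c.
  have hvanti : ∀ a ≥ 0, g a - c * a ≤ g 0 := by
    have hd : ∀ a, HasDerivAt (fun a => g a - c * a) (deriv g a - c) a := fun a =>
      (((h.smooth.differentiable (by simp) a).hasDerivAt).sub
        ((hasDerivAt_id a).const_mul c)).congr_deriv (by rw [mul_one])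
    have : AntitoneOn (fun a => g a - c * a) (Ici 0) := by
      refine antitoneOn_of_deriv_nonpos (convex_Ici _)
        (fun a _ => (hd a).continuousAt.continuousWithinAt)
        (fun a _ => (hd a).differentiableAt.differentiableWithinAt) fun a ha => ?_
      rw [interior_Ici] at ha
      rw [(hd a).deriv]
      have := (hy a (le_of_lt ha)).2
      linarith
    intro a ha
    have := this self_mem_Ici ha ha
    simpa using this
  have hcont : Continuous fun a => √(1 + a ^ 2) * |profileNormSqA μ ν g a - μ / (1 + a ^ 2)| := by
    refine (Real.continuous_sqrt.comp (by fun_prop)).mul (continuous_abs.comp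
      (h.contDiff_profileNormSqA.continuous.sub (continuous_const.div (by fun_prop) fun a => ?_)))
    positivity
  obtain ⟨C₀, hC₀⟩ := (isCompact_Icc (a := (0 : ℝ)) (b := 1)).exists_bound_of_continuousOn
    hcont.continuousOn
  set V := g 0 / c ^ 2 with hV
  have hV0 : 0 < V := div_pos (h.pos 0) (by positivity)
  set N := ν / c + μ * c with hN
  have hN0 : 0 < N := by positivity
  set C₁ := N * (ν + μ) + 2 * ν / c with hC₁
  have hC₁0 : 0 < C₁ := by positivity
  refine ⟨2 * |C₀| + 4 * (C₁ * V + μ) + 2 * C₁, by positivity, fun a ha => ?_⟩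
  have hp1 : 0 < 1 / (1 + a ^ 2) := by positivity
  have hu2 : 0 ≤ c - deriv g a := sub_nonneg.2 (hy a ha).2
  rcases le_total a 1 with ha1 | ha1
  · have h1 := hC₀ a ⟨ha, ha1⟩
    rw [Real.norm_eq_abs] at h1
    have h2 : 1 ≤ 2 * (1 / (1 + a ^ 2)) := by
      rw [mul_one_div, le_div_iff₀ (by positivity)]; nlinarith
    calc _ ≤ |C₀| * 1 := by rw [mul_one]; exact (le_abs_self _).trans (h1.trans (le_abs_self _))
      _ ≤ |C₀| * (2 * (1 / (1 + a ^ 2))) := mul_le_mul_of_nonneg_left h2 (abs_nonneg _)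
      _ = 2 * |C₀| * (1 / (1 + a ^ 2)) := by ring
      _ ≤ _ := by gcongr <;> linarith [abs_nonneg C₀, mul_pos hC₁0 hV0]
  · have ha0 : 0 < a := by linarith
    set y := deriv g a with hydef
    have hy0 := (hy a ha).1
    have hyc := (hy a ha).2
    have hga := h.pos a
    have hk : slopeQuotient μ ν g a = y / a := by
      rw [eq_div_iff ha0.ne', mul_comm]; exact h.mul_slopeQuotient hμ ha
    -- u₁ and u₂ measure the deviation from the cone, where a/g = 1/c and g' = c. u₁ is O(1/a) by
    -- `hvanti`, while u₂ has finite integral because g - ca is bounded.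
    set u₁ := 1 / c - a / g a with hu₁
    set u₂ := c - y with hu₂
    have hu1 : u₁ = (g a - c * a) / (c * g a) := by
      rw [hu₁]; field_simp
    have hu10 : 0 ≤ u₁ := by
      rw [hu1]; exact div_nonneg (by linarith [hv a]) (by positivity)
    have hu1c : u₁ ≤ 1 / c := by
      have : 0 < a / g a := by positivity
      linarith
    have hu1V : u₁ ≤ V / a := by
      rw [hu1, hV, div_div]
      refine div_le_div₀ (h.pos 0).le (hvanti a ha) (by positivity) ?_
      have := mul_le_mul_of_nonneg_left (hv a).le hc0.le
      linarith
    -- By μc² = ν the terms without u₁, u₂ cancel, and what remains is at most linear in them since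
    -- both are bounded.
    have hkey : (1 + y ^ 2) * (a ^ 2 * profileNormSqA μ ν g a - μ) =
        (ν * u₁ - μ * u₂) ^ 2 - ν * u₁ * (2 / c - u₁) := by
      rw [profileNormSqA, hk, hu₂, hu₁, ← hydef, ← hcone']
      have : 1 + y ^ 2 ≠ 0 := by positivity
      field_simp
      ring
    have hb1 : (ν * u₁ - μ * u₂) ^ 2 ≤ N * (ν * u₁ + μ * u₂) := by
      have e1 : |ν * u₁ - μ * u₂| ≤ ν * u₁ + μ * u₂ := by
        have e3 : 0 ≤ ν * u₁ := by positivity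
        have e4 : 0 ≤ μ * u₂ := by positivity
        rw [abs_le]; constructor <;> linarith only [e3, e4]
      have e2 : ν * u₁ + μ * u₂ ≤ N := by
        have := mul_le_mul_of_nonneg_left hu1c hν.le
        have := mul_le_mul_of_nonneg_left (show u₂ ≤ c by linarith) hμ.le
        rw [hN, div_eq_mul_one_div]; linarith
      have e3 : 0 ≤ ν * u₁ + μ * u₂ := by positivity
      rw [← sq_abs]
      have e4 := abs_nonneg (ν * u₁ - μ * u₂)
      calc |ν * u₁ - μ * u₂| ^ 2 ≤ (ν * u₁ + μ * u₂) ^ 2 := pow_le_pow_left₀ e4 e1 2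
        _ = (ν * u₁ + μ * u₂) * (ν * u₁ + μ * u₂) := sq _
        _ ≤ N * (ν * u₁ + μ * u₂) := mul_le_mul_of_nonneg_right e2 e3
    have hb2 : 0 ≤ ν * u₁ * (2 / c - u₁) ∧ ν * u₁ * (2 / c - u₁) ≤ 2 * ν / c * u₁ := by
      have e0 : 2 / c = 1 / c + 1 / c := by ring
      have e1 : 0 ≤ 2 / c - u₁ := by
        have : 0 < 1 / c := by positivity
        linarith
      refine ⟨by positivity, ?_⟩
      have e2 : 2 * ν / c * u₁ = ν * u₁ * (2 / c) := by ring
      rw [e2]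
      exact mul_le_mul_of_nonneg_left (by linarith) (by positivity)
    have hb3 : |a ^ 2 * profileNormSqA μ ν g a - μ| ≤ C₁ * (V / a + u₂) := by
      have e1 : |(1 + y ^ 2) * (a ^ 2 * profileNormSqA μ ν g a - μ)| ≤ C₁ * (u₁ + u₂) := by
        rw [hkey, hC₁]
        have e4 : 0 ≤ 2 * ν / c * u₂ := by positivity
        have e5 : 0 ≤ N * ν * u₂ := by positivity
        have e6 : 0 ≤ N * μ * u₁ := by positivity
        have e7 : 0 ≤ N * ν * u₁ := by positivity
        have e8 : 0 ≤ N * μ * u₂ := by positivity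
        have e9 : 0 ≤ 2 * ν / c * u₁ := by positivity
        have e10 := sq_nonneg (ν * u₁ - μ * u₂)
        have e11 : (N * (ν + μ) + 2 * ν / c) * (u₁ + u₂) = N * (ν * u₁ + μ * u₂) +
            N * ν * u₂ + N * μ * u₁ + 2 * ν / c * u₁ + 2 * ν / c * u₂ := by ring
        have e12 : N * (ν * u₁ + μ * u₂) = N * ν * u₁ + N * μ * u₂ := by ring
        rw [abs_le, e11]
        constructor <;>
          linarith only [hb1, hb2.1, hb2.2, e4, e5, e6, e7, e8, e9, e10, e12]
      rw [abs_mul, abs_of_pos (by positivity : 0 < 1 + y ^ 2)] at e1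
      have e2 := le_mul_of_one_le_left (abs_nonneg (a ^ 2 * profileNormSqA μ ν g a - μ))
        (le_add_of_nonneg_right (sq_nonneg y) : 1 ≤ 1 + y ^ 2)
      refine (e2.trans e1).trans ?_
      gcongr
    have hb4 : |profileNormSqA μ ν g a - μ / (1 + a ^ 2)| ≤
        (C₁ * (V / a + u₂) + μ / (1 + a ^ 2)) / a ^ 2 := by
      have e1 : profileNormSqA μ ν g a - μ / (1 + a ^ 2) =
          ((a ^ 2 * profileNormSqA μ ν g a - μ) + μ / (1 + a ^ 2)) / a ^ 2 := by
        have : 1 + a ^ 2 ≠ 0 := by positivity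
        field_simp
        ring
      rw [e1, abs_div, abs_of_pos (by positivity : 0 < a ^ 2)]
      gcongr
      refine (abs_add_le _ _).trans ?_
      rw [abs_of_pos (by positivity : 0 < μ / (1 + a ^ 2))]
      gcongr
    have ha2 : 1 ≤ a ^ 2 := one_le_pow₀ ha1
    have hb5 : √(1 + a ^ 2) ≤ 2 * a := by
      rw [Real.sqrt_le_left (by positivity)]; nlinarith only [ha2]
    have hb6 : 1 / a ^ 2 ≤ 2 * (1 / (1 + a ^ 2)) := by
      rw [mul_one_div, div_le_div_iff₀ (by positivity) (by positivity)]; linarith only [ha2]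
    have hμa : μ / (1 + a ^ 2) / a ≤ μ / a ^ 2 := by
      rw [div_div]
      exact div_le_div_of_nonneg_left hμ.le (by positivity) (by nlinarith only [ha1, ha2, ha0])
    have hu2a : u₂ / a ≤ u₂ := div_le_self hu2 ha1
    calc _ ≤ 2 * a * ((C₁ * (V / a + u₂) + μ / (1 + a ^ 2)) / a ^ 2) :=
          mul_le_mul hb5 hb4 (abs_nonneg _) (by positivity)
      _ = 2 * (C₁ * V / a ^ 2 + C₁ * (u₂ / a) + μ / (1 + a ^ 2) / a) := by
          have : 1 + a ^ 2 ≠ 0 := by positivity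
          field_simp
      _ ≤ 2 * (C₁ * V / a ^ 2 + C₁ * u₂ + μ / a ^ 2) := by gcongr
      _ = 2 * (C₁ * V + μ) * (1 / a ^ 2) + 2 * C₁ * u₂ := by ring
      _ ≤ 2 * (C₁ * V + μ) * (2 * (1 / (1 + a ^ 2))) + 2 * C₁ * u₂ := by gcongr
      _ = 4 * (C₁ * V + μ) * (1 / (1 + a ^ 2)) + 2 * C₁ * u₂ := by ring
      _ ≤ _ := by
          have e5 : (2 * |C₀| + 4 * (C₁ * V + μ) + 2 * C₁) * (1 / (1 + a ^ 2) + u₂) =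
              4 * (C₁ * V + μ) * (1 / (1 + a ^ 2)) + 2 * C₁ * u₂ +
              (2 * |C₀| * (1 / (1 + a ^ 2)) + 2 * |C₀| * u₂ + 4 * (C₁ * V + μ) * u₂ +
                2 * C₁ * (1 / (1 + a ^ 2))) := by ring
          rw [e5]
          exact le_add_of_nonneg_right (by positivity)

end IsProfileGraph

end

/-! ### The energy estimate. -/

section

/-- Grönwall's inequality in differential form. -/
theorem le_exp_mul_of_deriv_le {f Θ f' Θ' : ℝ → ℝ} (hf : ContinuousOn f (Ici 0))
    (hΘ : ContinuousOn Θ (Ici 0)) (hf' : ∀ a > 0, HasDerivAt f (f' a) a)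
    (hΘ' : ∀ a > 0, HasDerivAt Θ (Θ' a) a) (hle : ∀ a > 0, f' a ≤ Θ' a * f a) {a : ℝ}
    (ha : 0 ≤ a) : f a ≤ Real.exp (Θ a - Θ 0) * f 0 := by
  have hd : ∀ a > 0, HasDerivAt (fun a => f a * Real.exp (-Θ a))
      ((f' a - Θ' a * f a) * Real.exp (-Θ a)) a := fun a ha =>
    ((hf' a ha).mul (hΘ' a ha).neg.exp).congr_deriv (by simp only [Pi.neg_apply]; ring)
  have hanti : AntitoneOn (fun a => f a * Real.exp (-Θ a)) (Ici 0) := by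
    refine antitoneOn_of_deriv_nonpos (convex_Ici _)
      (hf.mul (Real.continuous_exp.comp_continuousOn hΘ.neg))
      (fun a ha => ?_) fun a ha => ?_
    · rw [interior_Ici] at ha
      exact (hd a ha).differentiableAt.differentiableWithinAt
    · rw [interior_Ici] at ha
      rw [(hd a ha).deriv]
      exact mul_nonpos_of_nonpos_of_nonneg (sub_nonpos.2 (hle a ha)) (Real.exp_pos _).le
  have := hanti self_mem_Ici ha ha
  have h2 := mul_le_mul_of_nonneg_right this (Real.exp_pos (Θ a)).le
  simp only [mul_assoc, ← Real.exp_add] at h2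
  rw [neg_add_cancel, Real.exp_zero, mul_one] at h2
  rw [mul_comm, show Θ a - Θ 0 = -Θ 0 + Θ a by ring]
  exact h2

namespace IsProfileGraph

variable {μ ν α β : ℝ} {g : ℝ → ℝ} (h : IsProfileGraph μ ν α β g)
include h

/-- The slope is at most that of the cone, for which 1 + (β/α)² = 1/α². -/
theorem one_add_sq_le (hα : 0 < α) (hunit : α ^ 2 + β ^ 2 = 1) {a : ℝ} (ha : 0 ≤ a) :
    α ^ 2 * (1 + deriv g a ^ 2) ≤ 1 := by
  have h1 := pow_le_pow_left₀ (mul_nonneg hα.le (h.deriv_nonneg a ha)) (h.deriv_le a ha) 2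
  rw [mul_pow] at h1
  linarith

/-- The energy estimate for the motion in a potential along a profile graph. -/
theorem potential_le (hμ : 0 < μ) (hν : 0 < ν) (hα : 0 < α) (hβ : 0 < β)
    (hunit : α ^ 2 + β ^ 2 = 1) {D : ℝ} (hD : 0 < D)
    (hbound : ∀ a ≥ 0, √(1 + a ^ 2) * |profileNormSqA μ ν g a - μ / (1 + a ^ 2)| ≤
      D * (1 / (1 + a ^ 2) + (β / α - deriv g a)))
    {E : Type*} [NormedAddCommGroup E] [InnerProductSpace ℝ E] {H H' : ℝ → E} {f : E → E}
    {Ψ : E → ℝ} (hΨ : ∀ x, HasFDerivAt Ψ (-innerSL ℝ (f x)) x) (hΨ0 : ∀ x, 0 ≤ Ψ x)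
    (hH : ∀ a, HasDerivAt H (H' a) a) (hHc : Continuous H') (hH0 : H' 0 = 0)
    (hode : ∀ a > 0, HasDerivAt H' ((1 + deriv g a ^ 2) • (f (H a) - profileNormSqA μ ν g a • H a) -
      (μ * (1 + deriv g a ^ 2) / a) • H' a) a) {a : ℝ} (ha : 0 ≤ a) :
    Ψ (H a) ≤ Real.exp (D / (α * √μ) * (Real.pi / 2 + g 0)) * (μ / 2 * ‖H 0‖ ^ 2 + Ψ (H 0)) := by
  set K := D / (α * √μ) with hK
  have hsμ : 0 < √μ := Real.sqrt_pos.2 hμ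
  have hK0 : 0 < K := by positivity
  -- The term |A|²H is not a gradient with constant coefficient, so its cone model μ/(1 + a²) is put
  -- into the energy; this coefficient decreases in a, which helps.
  set En : ℝ → ℝ := fun a => (1 + deriv g a ^ 2)⁻¹ * ‖H' a‖ ^ 2 / 2 +
    μ * (1 + a ^ 2)⁻¹ * ‖H a‖ ^ 2 / 2 + Ψ (H a) with hEn
  -- An antiderivative of the growth rate. Its increase is at most K(π/2 + g(0)), because g - (β/α)a
  -- is positive and equals g(0) at 0.
  set Θ : ℝ → ℝ := fun a => K * (Real.arctan a - (g a - β / α * a)) with hΘ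
  have hHcont : Continuous H := continuous_iff_continuousAt.2 fun a => (hH a).continuousAt
  have hΨcont : Continuous Ψ := continuous_iff_continuousAt.2 fun x => (hΨ x).continuousAt
  have hEnc : Continuous En := by
    have h1 : Continuous fun a => (1 + deriv g a ^ 2)⁻¹ :=
      (continuous_const.add (h.contDiff_deriv.continuous.pow 2)).inv₀
        fun a => (h.one_add_pos a).ne'
    have h2 : Continuous fun a : ℝ => (1 + a ^ 2)⁻¹ :=
      (continuous_const.add (continuous_id.pow 2)).inv₀
        fun a => (by positivity : (0 : ℝ) < 1 + a ^ 2).ne'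
    fun_prop
  have hΘc : Continuous Θ := by
    have := h.smooth.continuous
    have := Real.continuous_arctan
    fun_prop
  have hgd : ∀ a, HasDerivAt g (deriv g a) a := fun a =>
    (h.smooth.differentiable (by simp) a).hasDerivAt
  have hΘd : ∀ a > 0, HasDerivAt Θ (K * (1 / (1 + a ^ 2) + (β / α - deriv g a))) a := fun a _ =>
    (((Real.hasDerivAt_arctan a).sub ((hgd a).sub ((hasDerivAt_id a).const_mul
      (β / α)))).const_mul K).congr_deriv (by ring)
  -- The force cancels against the derivative of Ψ. The profile equation turns the |H'|² terms into
  -- damping, as g' ≥ 0; only the product of ⟨H, H'⟩ with the curvature error has no sign.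
  have hEnd : ∀ a > 0, HasDerivAt En
      (-((1 + deriv g a ^ 2)⁻¹ * (deriv g a * ν / g a + μ / a)) * ‖H' a‖ ^ 2 +
        (μ / (1 + a ^ 2) - profileNormSqA μ ν g a) * inner ℝ (H a) (H' a) -
        μ * a / (1 + a ^ 2) ^ 2 * ‖H a‖ ^ 2) a := by
    intro a ha
    have h2 : HasDerivAt (deriv g) (deriv (deriv g) a) a :=
      (h.contDiff_deriv.differentiable (by simp) a).hasDerivAt
    have d1 := ((((h2.pow 2).const_add 1).inv (h.one_add_pos a).ne').mul
      ((hode a ha).norm_sq)).div_const 2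
    have d2 := (((((hasDerivAt_pow 2 a).const_add 1).inv
      (by positivity : (1 : ℝ) + a ^ 2 ≠ 0)).const_mul μ).mul (hH a).norm_sq).div_const 2
    have d3 := (hΨ (H a)).comp_hasDerivAt a (hH a)
    refine ((d1.add d2).add d3).congr_deriv ?_
    have hg := h.pos a
    have h1 := (h.one_add_pos a).ne'
    have h3 : (1 : ℝ) + a ^ 2 ≠ 0 := by positivity
    simp only [inner_sub_right, inner_smul_right, real_inner_self_eq_norm_sq, Pi.pow_apply,
      Pi.inv_apply, ContinuousLinearMap.neg_apply, innerSL_apply_apply, h.ode a ha]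
    rw [real_inner_comm (H' a) (H a), real_inner_comm (H' a) (f (H a))]
    field_simp
    ring
  have hle : ∀ a > 0, -((1 + deriv g a ^ 2)⁻¹ * (deriv g a * ν / g a + μ / a)) * ‖H' a‖ ^ 2 +
        (μ / (1 + a ^ 2) - profileNormSqA μ ν g a) * inner ℝ (H a) (H' a) -
        μ * a / (1 + a ^ 2) ^ 2 * ‖H a‖ ^ 2 ≤
      K * (1 / (1 + a ^ 2) + (β / α - deriv g a)) * En a := by
    intro a ha
    have hb := hbound a ha.le
    have hm := h.one_add_sq_le hα hunit ha.le
    have hg := h.pos a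
    have hg' := h.deriv_nonneg a ha.le
    set A := profileNormSqA μ ν g a
    set R := 1 / (1 + a ^ 2) + (β / α - deriv g a)
    set s := √(1 + a ^ 2) with hs
    have hs0 : 0 < s := Real.sqrt_pos.2 (by positivity)
    have hs2 : s ^ 2 = 1 + a ^ 2 := Real.sq_sqrt (by positivity)
    have hR0 : 0 ≤ R := nonneg_of_mul_nonneg_right ((mul_nonneg hs0.le (abs_nonneg _)).trans hb) hD
    set E₀ := (1 + deriv g a ^ 2)⁻¹ * ‖H' a‖ ^ 2 / 2 + μ * (1 + a ^ 2)⁻¹ * ‖H a‖ ^ 2 / 2 with hE₀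
    have hE₀n : 0 ≤ E₀ := by positivity
    have t1 : 0 ≤ (1 + deriv g a ^ 2)⁻¹ * (deriv g a * ν / g a + μ / a) * ‖H' a‖ ^ 2 := by
      positivity
    have t2 : 0 ≤ μ * a / (1 + a ^ 2) ^ 2 * ‖H a‖ ^ 2 := by positivity
    have t3 : (μ / (1 + a ^ 2) - A) * inner ℝ (H a) (H' a) ≤
        |A - μ / (1 + a ^ 2)| * (‖H a‖ * ‖H' a‖) := by
      refine (le_abs_self _).trans ?_
      rw [abs_mul, abs_sub_comm]
      exact mul_le_mul_of_nonneg_left (abs_real_inner_le_norm _ _) (abs_nonneg _)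
    -- The inequality of arithmetic and geometric means, with α² ≤ 1/(1 + g'²). It costs the factor
    -- s = √(1 + a²), which is why the curvature error is bounded with that weight.
    have t4 : α * √μ * (‖H a‖ * ‖H' a‖) ≤ s * E₀ := by
      have e1 : α ^ 2 ≤ (1 + deriv g a ^ 2)⁻¹ := by
        rw [← one_div, le_div_iff₀ (h.one_add_pos a)]; exact hm
      have e2 : α ^ 2 * ‖H' a‖ ^ 2 / 2 + μ * (s ^ 2)⁻¹ * ‖H a‖ ^ 2 / 2 ≤ E₀ := by
        rw [hE₀, hs2]; gcongr
      refine le_trans ?_ (mul_le_mul_of_nonneg_left e2 hs0.le)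
      have e3 : s * (α ^ 2 * ‖H' a‖ ^ 2 / 2 + μ * (s ^ 2)⁻¹ * ‖H a‖ ^ 2 / 2) -
          α * √μ * (‖H a‖ * ‖H' a‖) = (s * α * ‖H' a‖ - √μ * ‖H a‖) ^ 2 / (2 * s) := by
        have : μ = √μ ^ 2 := (Real.sq_sqrt hμ.le).symm
        rw [show μ * (s ^ 2)⁻¹ = √μ ^ 2 * (s ^ 2)⁻¹ by rw [← this]]
        field_simp
        ring
      have : 0 ≤ (s * α * ‖H' a‖ - √μ * ‖H a‖) ^ 2 / (2 * s) := by positivity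
      linarith only [e3, this]
    have t5 : |A - μ / (1 + a ^ 2)| * (‖H a‖ * ‖H' a‖) ≤ K * R * E₀ := by
      have e1 := mul_le_mul_of_nonneg_left t4 (abs_nonneg (A - μ / (1 + a ^ 2)))
      have e2 := mul_le_mul_of_nonneg_right hb hE₀n
      rw [hK, div_mul_eq_mul_div, div_mul_eq_mul_div, le_div_iff₀ (by positivity)]
      linarith only [e1, e2]
    have t6 : K * R * E₀ ≤ K * R * En a := by
      refine mul_le_mul_of_nonneg_left ?_ (by positivity)
      have := hΨ0 (H a)
      simp only [hEn, ← hE₀]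
      linarith only [this]
    linarith only [t1, t2, t3, t5, t6]
  have hfin := le_exp_mul_of_deriv_le hEnc.continuousOn hΘc.continuousOn hEnd hΘd hle ha
  have hE0 : En 0 = μ / 2 * ‖H 0‖ ^ 2 + Ψ (H 0) := by
    simp [hEn, hH0]; ring
  have hEa : Ψ (H a) ≤ En a := by
    have h1 : 0 ≤ (1 + deriv g a ^ 2)⁻¹ * ‖H' a‖ ^ 2 / 2 + μ * (1 + a ^ 2)⁻¹ * ‖H a‖ ^ 2 / 2 := by
      positivity
    simp only [hEn]; linarith only [h1]
  rw [hE0] at hfin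
  refine hEa.trans (hfin.trans ?_)
  refine mul_le_mul_of_nonneg_right (Real.exp_le_exp.2 ?_)
    (by have := hΨ0 (H 0); positivity)
  have hv : 0 ≤ g a - β / α * a := by
    have := h.side a
    rw [sub_nonneg, div_mul_eq_mul_div, div_le_iff₀ hα]; linarith only [this]
  simp only [hΘ, Real.arctan_zero, mul_zero, sub_zero, zero_sub]
  rw [← mul_sub]
  refine mul_le_mul_of_nonneg_left ?_ hK0.le
  linarith only [Real.arctan_lt_pi_div_two a, hv]

end IsProfileGraph

end

/-! ### The cut off interaction and global solvability. -/

section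

/-- The exponential interaction, cut off to be bounded. -/
def cutoffExp (u : ℝ) : ℝ := Real.exp (-(√2 * max u 0))

/-- The decreasing antiderivative of the cut off interaction which vanishes at `+∞`. -/
def cutoffPotential (u : ℝ) : ℝ := (√2)⁻¹ - ∫ s in (0 : ℝ)..u, cutoffExp s

theorem continuous_cutoffExp : Continuous cutoffExp := by unfold cutoffExp; fun_prop

theorem cutoffExp_of_nonneg {u : ℝ} (hu : 0 ≤ u) : cutoffExp u = Real.exp (-(√2 * u)) := by
  rw [cutoffExp, max_eq_left hu]

theorem cutoffExp_of_nonpos {u : ℝ} (hu : u ≤ 0) : cutoffExp u = 1 := by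
  rw [cutoffExp, max_eq_right hu, mul_zero, neg_zero, Real.exp_zero]

theorem abs_cutoffExp_le (u : ℝ) : |cutoffExp u| ≤ 1 := by
  rw [cutoffExp, abs_of_pos (Real.exp_pos _), Real.exp_le_one_iff, neg_nonpos]
  positivity

theorem abs_cutoffExp_sub_le (u v : ℝ) : |cutoffExp u - cutoffExp v| ≤ √2 * |u - v| := by
  wlog huv : u ≤ v generalizing u v
  · rw [abs_sub_comm, abs_sub_comm u]
    exact this v u (le_of_not_ge huv)
  have h1 : max u 0 ≤ max v 0 := max_le_max_right 0 huv
  have h2 : max v 0 - max u 0 ≤ v - u := by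
    rcases le_total v 0 with hv | hv
    · rw [max_eq_right hv, max_eq_right (huv.trans hv)]; linarith
    · rw [max_eq_left hv]; linarith [le_max_left u 0]
  have h3 : cutoffExp v = cutoffExp u * Real.exp (-(√2 * (max v 0 - max u 0))) := by
    rw [cutoffExp, cutoffExp, ← Real.exp_add]; congr 1; ring
  have h4 := Real.add_one_le_exp (-(√2 * (max v 0 - max u 0)))
  have h5 : Real.exp (-(√2 * (max v 0 - max u 0))) ≤ 1 := by
    rw [Real.exp_le_one_iff, neg_nonpos]
    exact mul_nonneg (Real.sqrt_nonneg _) (by linarith)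
  have h6 : 0 ≤ cutoffExp u := (Real.exp_pos _).le
  have h7 : cutoffExp u ≤ 1 := (le_abs_self _).trans (abs_cutoffExp_le u)
  have h8 : |u - v| = v - u := by rw [abs_sub_comm, abs_of_nonneg (by linarith)]
  rw [h8, h3, show cutoffExp u - cutoffExp u * Real.exp (-(√2 * (max v 0 - max u 0))) =
    cutoffExp u * (1 - Real.exp (-(√2 * (max v 0 - max u 0)))) by ring,
    abs_of_nonneg (mul_nonneg h6 (by linarith))]
  calc _ ≤ 1 * (√2 * (max v 0 - max u 0)) := mul_le_mul h7 (by linarith) (by linarith) zero_le_one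
    _ ≤ √2 * (v - u) := by rw [one_mul]; gcongr

theorem hasDerivAt_cutoffPotential (u : ℝ) : HasDerivAt cutoffPotential (-cutoffExp u) u :=
  (continuous_cutoffExp.integral_hasStrictDerivAt 0 u).hasDerivAt.const_sub _

theorem cutoffPotential_of_nonneg {u : ℝ} (hu : 0 ≤ u) :
    cutoffPotential u = (√2)⁻¹ * Real.exp (-(√2 * u)) := by
  have h1 : ∫ s in (0 : ℝ)..u, cutoffExp s = ∫ s in (0 : ℝ)..u, Real.exp (-(√2 * s)) := by
    refine intervalIntegral.integral_congr fun s hs => ?_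
    rw [uIcc_of_le hu] at hs
    exact cutoffExp_of_nonneg hs.1
  have h0 : √2 ≠ 0 := by positivity
  have h2 : ∀ s, HasDerivAt (fun s => -((√2)⁻¹ * Real.exp (-(√2 * s)))) (Real.exp (-(√2 * s))) s :=
    fun s => (((((hasDerivAt_id s).const_mul √2).neg).exp).const_mul (√2)⁻¹).neg.congr_deriv (by
      simp; field_simp)
  rw [cutoffPotential, h1, intervalIntegral.integral_eq_sub_of_hasDerivAt (fun s _ => h2 s)
    (Continuous.intervalIntegrable (by fun_prop) _ _)]
  simp

theorem cutoffPotential_of_nonpos {u : ℝ} (hu : u ≤ 0) : (√2)⁻¹ ≤ cutoffPotential u := by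
  have h1 : ∫ s in (0 : ℝ)..u, cutoffExp s = ∫ _s in (0 : ℝ)..u, (1 : ℝ) := by
    refine intervalIntegral.integral_congr fun s hs => ?_
    rw [uIcc_of_ge hu] at hs
    exact cutoffExp_of_nonpos hs.2
  rw [cutoffPotential, h1]
  simpa using hu

theorem cutoffPotential_nonneg (u : ℝ) : 0 ≤ cutoffPotential u := by
  rcases le_total 0 u with hu | hu
  · rw [cutoffPotential_of_nonneg hu]; positivity
  · exact le_trans (by positivity) (cutoffPotential_of_nonpos hu)

namespace IsProfileGraph

variable {j : ℕ} {ν α β : ℝ} {g : ℝ → ℝ} (h : IsProfileGraph (j : ℝ) ν α β g)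
include h

theorem exists_bound_normSqA (hμ : 0 < (j : ℝ)) (hν : 0 < ν) (hα : 0 < α) (hβ : 0 < β)
    (hcone : ν * α ^ 2 = j * β ^ 2) : ∃ M > 0, ∀ a, |profileNormSqA j ν g a| ≤ M := by
  obtain ⟨D, hD, hb⟩ := h.exists_normSqA_bound hμ hν hα hβ hcone
  have hpos : ∀ a ≥ 0, |profileNormSqA j ν g a| ≤ j + D * (1 + β / α) := by
    intro a ha
    have h0 := hb a ha
    have h1 : (1 : ℝ) ≤ √(1 + a ^ 2) := Real.one_le_sqrt.2 (by linarith [sq_nonneg a])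
    have h2 : 1 / (1 + a ^ 2) ≤ 1 := by
      rw [div_le_one (by positivity)]; linarith [sq_nonneg a]
    have h3 : (j : ℝ) / (1 + a ^ 2) ≤ j := div_le_self hμ.le (by linarith [sq_nonneg a])
    have h4 : 0 ≤ (j : ℝ) / (1 + a ^ 2) := by positivity
    have h5 := le_mul_of_one_le_left (abs_nonneg (profileNormSqA j ν g a - j / (1 + a ^ 2))) h1
    have h6 : D * (1 / (1 + a ^ 2) + (β / α - deriv g a)) ≤ D * (1 + β / α) :=
      mul_le_mul_of_nonneg_left (by linarith [h.deriv_nonneg a ha]) hD.le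
    have h7 := abs_add_le (profileNormSqA j ν g a - j / (1 + a ^ 2)) (j / (1 + a ^ 2))
    rw [sub_add_cancel, abs_of_nonneg h4] at h7
    linarith
  refine ⟨j + D * (1 + β / α), by positivity, fun a => ?_⟩
  rcases le_total 0 a with ha | ha
  · exact hpos a ha
  · rw [← h.profileNormSqA_neg]; exact hpos (-a) (by linarith)

/-- The equation `H'' / (1 + g'²) + (j / a) H' + |A|² H = f(H)` for a Lipschitz force `f`. -/
theorem exists_solution (hμ : 0 < (j : ℝ)) (hν : 0 < ν) (hα : 0 < α) (hβ : 0 < β)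
    (hunit : α ^ 2 + β ^ 2 = 1) (hcone : ν * α ^ 2 = j * β ^ 2)
    {E : Type*} [NormedAddCommGroup E] [NormedSpace ℝ E] [CompleteSpace E] {f : E → E} {L : ℝ}
    (hf : ∀ x y, ‖f x - f y‖ ≤ L * ‖x - y‖) (x₀ : E) :
    ∃ H : ℝ → E, H 0 = x₀ ∧ (∀ a, H (-a) = H a) ∧ (∀ a, DifferentiableAt ℝ H a) ∧
      Continuous (deriv H) ∧
      (∀ a > 0, HasDerivAt (deriv H) ((1 + deriv g a ^ 2) • (f (H a) -
        profileNormSqA j ν g a • H a) - (j * (1 + deriv g a ^ 2) / a) • deriv H a) a) ∧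
      ((∀ n : ℕ, ContDiff ℝ n H → ContDiff ℝ n fun a => f (H a)) → ContDiff ℝ ∞ H) := by
  wlog hL0 : 0 ≤ L generalizing L
  · exact this (L := |L|) (fun x y => (hf x y).trans
      (mul_le_mul_of_nonneg_right (le_abs_self L) (norm_nonneg _))) (abs_nonneg L)
  obtain ⟨M, hM0, hM⟩ := h.exists_bound_normSqA hμ hν hα hβ hcone
  have hq : ∀ a, 1 + deriv g a ^ 2 ≤ (α ^ 2)⁻¹ := fun a => by
    rw [← one_div, le_div_iff₀ (by positivity), mul_comm]
    rcases le_total 0 a with ha | ha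
    · exact h.one_add_sq_le hα hunit ha
    · have := h.one_add_sq_le hα hunit (a := -a) (by linarith)
      rwa [h.deriv_neg, neg_sq] at this
  have hfc : Continuous f :=
    (LipschitzWith.of_dist_le_mul (K := L.toNNReal) fun x y => by
      rw [dist_eq_norm, dist_eq_norm, Real.coe_toNNReal _ hL0]; exact hf x y).continuous
  have hgc := h.contDiff_deriv.continuous
  have hAc := h.contDiff_profileNormSqA.continuous
  set G : ℝ → E → E := fun a x => (1 + deriv g a ^ 2) • (f x - profileNormSqA j ν g a • x) with hG
  obtain ⟨H, hHc, hHe, hHeq⟩ := exists_eq_add_singularIntegral j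
    h.contDiff_profileDensity.continuous profileDensity_pos h.profileDensity_neg
    (h.monotoneOn_profileDensity hμ) (G := G) (L := (α ^ 2)⁻¹ * (L + M)) (M := (α ^ 2)⁻¹ * ‖f 0‖)
    (by simp only [hG, Function.uncurry_def]; fun_prop)
    (fun a x => by simp only [hG, h.deriv_neg, neg_sq, h.profileNormSqA_neg])
    (fun a x y => by
      simp only [hG]
      rw [← smul_sub, norm_smul, Real.norm_eq_abs, abs_of_pos (h.one_add_pos a), mul_assoc]
      refine mul_le_mul (hq a) ?_ (norm_nonneg _) (by positivity)
      rw [sub_sub_sub_comm, ← smul_sub]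
      refine (norm_sub_le _ _).trans ?_
      rw [norm_smul, Real.norm_eq_abs, add_mul]
      exact add_le_add (hf x y) (mul_le_mul_of_nonneg_right (hM a) (norm_nonneg _)))
    (fun a => by
      simp only [hG, smul_zero, sub_zero]
      rw [norm_smul, Real.norm_eq_abs, abs_of_pos (h.one_add_pos a)]
      exact mul_le_mul_of_nonneg_right (hq a) (norm_nonneg _)) x₀
  have hφc : Continuous fun r => G r (H r) := by simp only [hG]; fun_prop
  have hHd : ∀ a, HasDerivAt H (deriv (singularIntegral j (profileDensity ν g)
      fun r => G r (H r)) a) a := fun a => by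
    have h1 := hasDerivAt_singularIntegral (j := j) h.contDiff_profileDensity.continuous
      profileDensity_pos hφc a
    rw [h1.deriv]
    exact (h1.const_add x₀).congr_of_eventuallyEq (Eventually.of_forall hHeq)
  have hdH : deriv H = deriv (singularIntegral j (profileDensity ν g) fun r => G r (H r)) :=
    funext fun a => (hHd a).deriv
  refine ⟨H, ?_, hHe, fun a => (hHd a).differentiableAt, ?_, fun a ha => ?_, fun hn => ?_⟩
  · rw [hHeq]; simp [singularIntegral]
  · rw [hdH, show deriv (singularIntegral j (profileDensity ν g) fun r => G r (H r)) = _ from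
      funext fun a => (hasDerivAt_singularIntegral h.contDiff_profileDensity.continuous
        profileDensity_pos hφc a).deriv]
    exact continuous_singularIntegrand h.contDiff_profileDensity.continuous profileDensity_pos hφc
  · rw [hdH]
    refine (hasDerivAt_deriv_singularIntegral (h.contDiff_profileDensity.differentiable (by simp))
      profileDensity_pos hφc ha).congr_deriv ?_
    rw [h.deriv_profileDensity hμ ha.le]
    congr 2
    rw [← h.mul_slopeQuotient hμ ha.le]
    field_simp
  · refine contDiff_of_eq_add_singularIntegral h.contDiff_profileDensity profileDensity_pos hφc
      hHeq fun n hHn => ?_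
    have h1 : ContDiff ℝ n (deriv g) := h.contDiff_deriv.of_le (by exact_mod_cast le_top)
    have h2 : ContDiff ℝ n (profileNormSqA j ν g) :=
      h.contDiff_profileNormSqA.of_le (by exact_mod_cast le_top)
    exact (contDiff_const.add (h1.pow 2)).smul ((hn n hHn).sub (h2.smul hHn))

end IsProfileGraph

end

/-! ### The Jacobi–Toda system along a profile graph. -/

section

section Force

variable {ι E : Type*} [Fintype ι] [NormedAddCommGroup E] [InnerProductSpace ℝ E]

theorem norm_cutoffForce_sub_le {κ : ℝ} (hκ : 0 ≤ κ) (d : ι → E) (x y : E) :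
    ‖κ • ∑ i, cutoffExp (inner ℝ (d i) x) • d i - κ • ∑ i, cutoffExp (inner ℝ (d i) y) • d i‖ ≤
      (κ * ∑ i, √2 * ‖d i‖ ^ 2) * ‖x - y‖ := by
  rw [← smul_sub, ← Finset.sum_sub_distrib, norm_smul, Real.norm_eq_abs, abs_of_nonneg hκ,
    mul_assoc, Finset.sum_mul]
  refine mul_le_mul_of_nonneg_left ((norm_sum_le _ _).trans (Finset.sum_le_sum fun i _ => ?_)) hκ
  rw [← sub_smul, norm_smul, Real.norm_eq_abs]
  have h1 := abs_cutoffExp_sub_le (inner ℝ (d i) x) (inner ℝ (d i) y)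
  rw [← inner_sub_right] at h1
  have h2 := abs_real_inner_le_norm (d i) (x - y)
  have h3 := h1.trans (mul_le_mul_of_nonneg_left h2 (Real.sqrt_nonneg 2))
  calc _ ≤ √2 * (‖d i‖ * ‖x - y‖) * ‖d i‖ := mul_le_mul_of_nonneg_right h3 (norm_nonneg _)
    _ = _ := by ring

/-- The force is minus the gradient of a nonnegative potential, which is the structure the energy
estimate requires. -/
theorem hasFDerivAt_cutoffPotential_sum (κ : ℝ) (d : ι → E) (x : E) :
    HasFDerivAt (fun x => κ * ∑ i, cutoffPotential (inner ℝ (d i) x))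
      (-innerSL ℝ (κ • ∑ i, cutoffExp (inner ℝ (d i) x) • d i)) x := by
  have h1 : ∀ i, HasFDerivAt (fun x => cutoffPotential (inner ℝ (d i) x))
      (-cutoffExp (inner ℝ (d i) x) • innerSL ℝ (d i)) x := fun i =>
    (hasDerivAt_cutoffPotential _).comp_hasFDerivAt x (innerSL ℝ (d i)).hasFDerivAt
  refine ((HasFDerivAt.fun_sum fun i (_ : i ∈ Finset.univ) => h1 i).const_mul κ).congr_fderiv ?_
  simp [map_sum, Finset.sum_neg_distrib]

end Force

namespace IsProfileGraph

variable {j : ℕ} {ν α β : ℝ} {g : ℝ → ℝ} (h : IsProfileGraph (j : ℝ) ν α β g)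
include h

/-- The Jacobi–Toda system along a profile graph, for gaps `⟨d i, H⟩`. -/
theorem exists_toda_solution (hμ : 0 < (j : ℝ)) (hν : 0 < ν) (hα : 0 < α) (hβ : 0 < β)
    (hunit : α ^ 2 + β ^ 2 = 1) (hcone : ν * α ^ 2 = j * β ^ 2)
    {ι E : Type*} [Fintype ι] [NormedAddCommGroup E] [InnerProductSpace ℝ E] [CompleteSpace E]
    (d : ι → E) (x₁ : E) (hx₁ : ∀ i, inner ℝ (d i) x₁ = 1) {γ : ℝ} (hγ : 0 < γ) :
    ∃ δs : ℝ, 0 < δs ∧ ∀ δ : ℝ, 0 < δ → δ ≤ δs → ∃ H : ℝ → E, ContDiff ℝ ∞ H ∧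
      (∀ a, H (-a) = H a) ∧ (∀ i a, 0 < inner ℝ (d i) (H a)) ∧
      ∀ a > 0, (1 + deriv g a ^ 2)⁻¹ • deriv (deriv H) a + (j / a) • deriv H a +
        profileNormSqA j ν g a • H a =
        (γ / δ) • ∑ i, Real.exp (-(√2 * inner ℝ (d i) (H a))) • d i := by
  obtain ⟨D, hD, hb⟩ := h.exists_normSqA_bound hμ hν hα hβ hcone
  set C := Real.exp (D / (α * √j) * (Real.pi / 2 + g 0)) with hC
  have hC0 : 0 < C := Real.exp_pos _
  have h20 : 0 < √2 := by positivity
  -- C does not depend on δ, so the initial gap L can be fixed before δ; with it the initial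
  -- potential, amplified by C, is at most κ/(2√2) for every κ.
  obtain ⟨L, hL, hL0⟩ : ∃ L : ℝ, C * (Fintype.card ι * Real.exp (-(√2 * L))) ≤ 1 / 2 ∧ 0 < L := by
    have h1 : Tendsto (fun L : ℝ => C * (Fintype.card ι * Real.exp (-(√2 * L)))) atTop
        (𝓝 (C * (Fintype.card ι * 0))) :=
      ((Real.tendsto_exp_neg_atTop_nhds_zero.comp
        (tendsto_id.const_mul_atTop h20)).const_mul _).const_mul _
    rw [mul_zero, mul_zero] at h1
    exact ((h1.eventually (ge_mem_nhds (by norm_num : (0 : ℝ) < 1 / 2))).and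
      (eventually_gt_atTop 0)).exists
  set Q := C * (j / 2 * ‖L • x₁‖ ^ 2) with hQ
  have hQ0 : 0 ≤ Q := by positivity
  -- Q is the amplified quadratic part of the initial energy. The bound on δ gives κ/(2√2) ≥ Q + 1,
  -- which makes Q strictly less than the remaining half of the threshold.
  refine ⟨γ * (√2)⁻¹ / (2 * (Q + 1)), by positivity, fun δ hδ hδs => ?_⟩
  set κ := γ / δ with hκdef
  have hκ : 0 < κ := by positivity
  have hQκ : Q < κ * (√2)⁻¹ / 2 := by
    rw [le_div_iff₀ (by positivity)] at hδs
    rw [hκdef, div_mul_eq_mul_div, div_div, lt_div_iff₀ (by positivity)]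
    linarith
  obtain ⟨H, hH0, hHe, hHd, hHc, hode, hHs⟩ := h.exists_solution hμ hν hα hβ hunit hcone
    (norm_cutoffForce_sub_le hκ.le d) (L • x₁)
  have hd0 : deriv H 0 = 0 := by
    have h1 : ∀ x, deriv H (-x) = -deriv H x := fun x => by
      have h1 := deriv_comp_neg H x
      rw [show (fun x => H (-x)) = H from funext hHe] at h1
      rw [h1, neg_neg]
    have h2 := h1 0
    rw [neg_zero] at h2
    have h3 : (2 : ℝ) • deriv H 0 = 0 := by
      rw [two_smul]; nth_rewrite 1 [h2]; exact neg_add_cancel _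
    exact (smul_eq_zero.1 h3).resolve_left two_ne_zero
  -- No continuation argument is needed: the cut off solution and its energy bound are global, and a
  -- nonpositive gap at any single a already makes the potential at least κ/√2.
  have hgap : ∀ i, ∀ a ≥ 0, 0 < inner ℝ (d i) (H a) := by
    intro i a ha
    by_contra! hneg
    have h1 := h.potential_le hμ hν hα hβ hunit hD hb
      (Ψ := fun x => κ * ∑ i, cutoffPotential (inner ℝ (d i) x))
      (hasFDerivAt_cutoffPotential_sum κ d)
      (fun x => mul_nonneg hκ.le (Finset.sum_nonneg fun i _ => cutoffPotential_nonneg _))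
      (fun a => (hHd a).hasDerivAt) hHc hd0 hode ha
    rw [hH0, ← hC, mul_add, ← hQ] at h1
    have h2 : ∀ i, cutoffPotential (inner ℝ (d i) (L • x₁)) =
        (√2)⁻¹ * Real.exp (-(√2 * L)) := fun i => by
      rw [inner_smul_right, hx₁, mul_one, cutoffPotential_of_nonneg hL0.le]
    simp only [h2, Finset.sum_const, Finset.card_univ, nsmul_eq_mul] at h1
    have h3 : (√2)⁻¹ ≤ ∑ i, cutoffPotential (inner ℝ (d i) (H a)) :=
      (cutoffPotential_of_nonpos hneg).trans
        (Finset.single_le_sum (f := fun i => cutoffPotential (inner ℝ (d i) (H a)))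
          (fun i _ => cutoffPotential_nonneg _) (Finset.mem_univ i))
    have h4 := mul_le_mul_of_nonneg_left h3 hκ.le
    have h5 := mul_le_mul_of_nonneg_left hL (mul_pos hκ (inv_pos.2 h20)).le
    linarith
  have hgap' : ∀ i a, 0 < inner ℝ (d i) (H a) := fun i a => by
    rcases le_total 0 a with ha | ha
    · exact hgap i a ha
    · rw [← hHe]; exact hgap i (-a) (by linarith)
  have hforce : ∀ a, κ • ∑ i, cutoffExp (inner ℝ (d i) (H a)) • d i =
      κ • ∑ i, Real.exp (-(√2 * inner ℝ (d i) (H a))) • d i := fun a => by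
    simp only [fun i => cutoffExp_of_nonneg (hgap' i a).le]
  -- Smoothness comes only now: `cutoffExp` has a corner at 0, but along H, whose gaps are positive,
  -- the force is the true exponential.
  refine ⟨H, hHs fun n hn => ?_, hHe, hgap', fun a ha => ?_⟩
  · simp only [hforce]
    refine contDiff_const.smul (ContDiff.sum fun i _ => ?_)
    exact ((contDiff_const.mul (contDiff_const.inner ℝ hn)).neg.exp).smul contDiff_const
  · have h1 := (h.one_add_pos a).ne'
    rw [(hode a ha).deriv, ← hforce, smul_sub, smul_smul, smul_smul, inv_mul_cancel₀ h1, one_smul,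
      show (1 + deriv g a ^ 2)⁻¹ * (j * (1 + deriv g a ^ 2) / a) = j / a by field_simp]
    abel

end IsProfileGraph

end

/-! ### Invariant hypersurfaces and their planar equations. -/

section

theorem exists_isometry_apply_eq {F : Type*} [NormedAddCommGroup F] [InnerProductSpace ℝ F]
    [CompleteSpace F] {x x' : F} (h : ‖x‖ = ‖x'‖) : ∃ σ : F ≃ₗᵢ[ℝ] F, σ x = x' :=
  ⟨(ℝ ∙ (x - x'))ᗮ.reflection, Submodule.reflection_sub h⟩

theorem exists_unit_inner_eq_zero {m : ℕ} (hm : 2 ≤ m) (x : EuclideanSpace ℝ (Fin m)) :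
    ∃ v : EuclideanSpace ℝ (Fin m), ‖v‖ = 1 ∧ inner ℝ x v = (0 : ℝ) := by
  have h1 : 0 < Module.finrank ℝ (ℝ ∙ x)ᗮ := by
    have h2 := (ℝ ∙ x).finrank_add_finrank_orthogonal
    rw [finrank_euclideanSpace_fin] at h2
    have h3 : Module.finrank ℝ (ℝ ∙ x) ≤ 1 :=
      (finrank_span_le_card ({x} : Set (EuclideanSpace ℝ (Fin m)))).trans (by simp)
    omega
  obtain ⟨⟨v, hv⟩, hv0⟩ := Module.finrank_pos_iff_exists_ne_zero.1 h1
  have hv0 : v ≠ 0 := fun h => hv0 (Subtype.ext h)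
  refine ⟨‖v‖⁻¹ • v, norm_inv_norm_smul hv0, ?_⟩
  rw [inner_smul_right, Submodule.mem_orthogonal_singleton_iff_inner_right.1 hv, mul_zero]

theorem norm_cos_smul_add_sin_smul {F : Type*} [NormedAddCommGroup F] [InnerProductSpace ℝ F]
    {u v : F} (h : inner ℝ u v = (0 : ℝ)) (hn : ‖v‖ = ‖u‖) (θ : ℝ) :
    ‖Real.cos θ • u + Real.sin θ • v‖ = ‖u‖ := by
  refine (sq_eq_sq₀ (norm_nonneg _) (norm_nonneg _)).1 ?_
  rw [norm_add_sq_real, inner_smul_left, inner_smul_right, h, norm_smul, norm_smul, mul_pow,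
    mul_pow, Real.norm_eq_abs, Real.norm_eq_abs, sq_abs, sq_abs, hn]
  linear_combination ‖u‖ ^ 2 * Real.cos_sq_add_sin_sq θ

section Defining

variable {V : Type*} [NormedAddCommGroup V] [InnerProductSpace ℝ V] [FiniteDimensional ℝ V]
  {S : Set V} {f : V → ℝ} {p : V}

/-- f vanishes along a circle through p contained in S, and v is the velocity of that circle at p.
-/
theorem fderiv_eq_zero_of_circle (hf : ContDiffAt ℝ ∞ f p) (hS : ∀ᶠ q in 𝓝 p, q ∈ S ↔ f q = 0)
    {u v : V} (hc : ∀ θ : ℝ, p + (Real.cos θ - 1) • u + Real.sin θ • v ∈ S) :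
    fderiv ℝ f p v = 0 := by
  set c : ℝ → V := fun θ => p + (Real.cos θ - 1) • u + Real.sin θ • v with hcdef
  have hc0 : c 0 = p := by simp [hcdef]
  have hd : HasDerivAt c v 0 := by
    have h1 := ((((Real.hasDerivAt_cos 0).sub_const 1).smul_const u).const_add p).add
      ((Real.hasDerivAt_sin 0).smul_const v)
    exact h1.congr_deriv (by simp)
  have hf' : HasFDerivAt f (fderiv ℝ f p) (c 0) := by
    rw [hc0]; exact (hf.differentiableAt (by simp)).hasFDerivAt
  have h2 : HasDerivAt (f ∘ c) 0 0 := by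
    refine (hasDerivAt_const (0 : ℝ) (0 : ℝ)).congr_of_eventuallyEq ?_
    have h3 := hd.continuousAt.tendsto
    rw [hc0] at h3
    filter_upwards [h3.eventually hS] with θ hθ using hθ.1 (hc θ)
  exact (hf'.comp_hasDerivAt 0 hd).unique h2

/-- f and f ∘ A are both local equations of S at p, so the kernels of their differentials are the
same tangent space. -/
theorem fderiv_apply_eq_zero_iff_of_symm (hp : p ∈ S) (hf : ContDiffAt ℝ ∞ f p)
    (h0 : fderiv ℝ f p ≠ 0) (hS : ∀ᶠ q in 𝓝 p, q ∈ S ↔ f q = 0) (A : V ≃L[ℝ] V) (hA : A p = p)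
    (hAS : ∀ q, A q ∈ S ↔ q ∈ S) (v : V) : fderiv ℝ f p (A v) = 0 ↔ fderiv ℝ f p v = 0 := by
  have hf1 : ContDiffAt ℝ 1 f p := hf.of_le (by simp)
  have h1 := tangentSpace_eq_ker hp hf1 h0 hS
  have hf1A : ContDiffAt ℝ 1 f (A p) := by rw [hA]; exact hf1
  have hd : fderiv ℝ (f ∘ A) p = (fderiv ℝ f p).comp (A : V →L[ℝ] V) := by
    have := (hf1A.differentiableAt one_ne_zero).hasFDerivAt.comp p A.hasFDerivAt
    rw [hA] at this
    exact this.fderiv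
  have h2 := tangentSpace_eq_ker (f := f ∘ A) hp (hf1A.comp p A.contDiff.contDiffAt)
    (fun h => h0 (ContinuousLinearMap.ext fun w => by
      have := congrArg (fun B : V →L[ℝ] ℝ => B (A.symm w)) (hd.symm.trans h)
      simpa using this))
    (by
      have h3 := A.continuous.tendsto p
      rw [hA] at h3
      filter_upwards [h3.eventually hS] with q hq
      rw [← hAS q, hq]; rfl)
  rw [h1] at h2
  have h3 := Submodule.ext_iff.1 h2 v
  rw [hd] at h3
  exact h3.symm

end Defining

section Plane

variable {m n : ℕ}

/-- The linear parametrization `(a, b) ↦ (a x₀, b y₀)` of a plane meeting all the orbits. -/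
def planeMap (x₀ : EuclideanSpace ℝ (Fin m)) (y₀ : EuclideanSpace ℝ (Fin n)) :
    ℝ × ℝ →L[ℝ] Space m n :=
  ((WithLp.prodContinuousLinearEquiv 2 ℝ (EuclideanSpace ℝ (Fin m))
    (EuclideanSpace ℝ (Fin n))).symm : _ →L[ℝ] Space m n).comp
    ((ContinuousLinearMap.toSpanSingleton ℝ x₀).prodMap
      (ContinuousLinearMap.toSpanSingleton ℝ y₀))

theorem planeMap_fst (x₀ : EuclideanSpace ℝ (Fin m)) (y₀ : EuclideanSpace ℝ (Fin n)) (z : ℝ × ℝ) :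
    (planeMap x₀ y₀ z).fst = z.1 • x₀ := rfl

theorem planeMap_snd (x₀ : EuclideanSpace ℝ (Fin m)) (y₀ : EuclideanSpace ℝ (Fin n)) (z : ℝ × ℝ) :
    (planeMap x₀ y₀ z).snd = z.2 • y₀ := rfl

theorem Space.ext {q q' : Space m n} (h1 : q.fst = q'.fst) (h2 : q.snd = q'.snd) : q = q' :=
  WithLp.ofLp_injective 2 (Prod.ext h1 h2)

theorem norm_sq_eq_fst_snd (q : Space m n) : ‖q‖ ^ 2 = ‖q.fst‖ ^ 2 + ‖q.snd‖ ^ 2 :=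
  WithLp.prod_norm_sq_eq_of_L2 q

/-- The action of a pair of isometries, as a linear map. -/
def actEquiv (σ : EuclideanSpace ℝ (Fin m) ≃ₗᵢ[ℝ] EuclideanSpace ℝ (Fin m))
    (τ : EuclideanSpace ℝ (Fin n) ≃ₗᵢ[ℝ] EuclideanSpace ℝ (Fin n)) : Space m n ≃L[ℝ] Space m n :=
  ((WithLp.prodContinuousLinearEquiv 2 ℝ _ _).trans
    (σ.toContinuousLinearEquiv.prodCongr τ.toContinuousLinearEquiv)).trans
    (WithLp.prodContinuousLinearEquiv 2 ℝ _ _).symm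

theorem actEquiv_apply (σ : EuclideanSpace ℝ (Fin m) ≃ₗᵢ[ℝ] EuclideanSpace ℝ (Fin m))
    (τ : EuclideanSpace ℝ (Fin n) ≃ₗᵢ[ℝ] EuclideanSpace ℝ (Fin n)) (q : Space m n) :
    actEquiv σ τ q = act σ τ q := rfl

namespace IsInvariantSet

variable {S : Set (Space m n)} (hS : IsInvariantSet S)
include hS

theorem mem_of_norm_eq {q q' : Space m n} (hq : q ∈ S) (h1 : ‖q.fst‖ = ‖q'.fst‖)
    (h2 : ‖q.snd‖ = ‖q'.snd‖) : q' ∈ S := by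
  obtain ⟨σ, hσ⟩ := exists_isometry_apply_eq h1
  obtain ⟨τ, hτ⟩ := exists_isometry_apply_eq h2
  have := hS σ τ q hq
  rwa [show act σ τ q = q' from Space.ext hσ hτ] at this

theorem mem_iff_of_norm_eq {q q' : Space m n} (h1 : ‖q.fst‖ = ‖q'.fst‖)
    (h2 : ‖q.snd‖ = ‖q'.snd‖) : q ∈ S ↔ q' ∈ S :=
  ⟨fun hq => hS.mem_of_norm_eq hq h1 h2, fun hq => hS.mem_of_norm_eq hq h1.symm h2.symm⟩

theorem actEquiv_mem_iff (σ : EuclideanSpace ℝ (Fin m) ≃ₗᵢ[ℝ] EuclideanSpace ℝ (Fin m))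
    (τ : EuclideanSpace ℝ (Fin n) ≃ₗᵢ[ℝ] EuclideanSpace ℝ (Fin n)) (q : Space m n) :
    actEquiv σ τ q ∈ S ↔ q ∈ S :=
  hS.mem_iff_of_norm_eq (σ.norm_map _) (τ.norm_map _)

variable {f : Space m n → ℝ} {p : Space m n}

/-- Rotating `p.fst` towards v, rescaled to the same length, stays in the orbit of p. -/
theorem fderiv_fst_of_inner_eq_zero (hp : p ∈ S) (hf : ContDiffAt ℝ ∞ f p)
    (hfS : ∀ᶠ q in 𝓝 p, q ∈ S ↔ f q = 0) (h0 : p.fst ≠ 0) {v : EuclideanSpace ℝ (Fin m)}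
    (hv : inner ℝ p.fst v = (0 : ℝ)) : fderiv ℝ f p (WithLp.toLp 2 (v, 0)) = 0 := by
  by_cases hv0 : v = 0
  · rw [hv0, show (WithLp.toLp 2 ((0 : EuclideanSpace ℝ (Fin m)), (0 : EuclideanSpace ℝ (Fin n))) :
      Space m n) = 0 from rfl, map_zero]
  set r := ‖p.fst‖ / ‖v‖ with hr
  have hr0 : r ≠ 0 := div_ne_zero (norm_ne_zero_iff.2 h0) (norm_ne_zero_iff.2 hv0)
  have h1 := fderiv_eq_zero_of_circle hf hfS (u := WithLp.toLp 2 (p.fst, 0))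
    (v := WithLp.toLp 2 (r • v, 0)) fun θ => by
      refine hS.mem_of_norm_eq hp ?_ (by simp)
      have h2 : (p + (Real.cos θ - 1) • (WithLp.toLp 2 (p.fst, 0) : Space m n) +
          Real.sin θ • (WithLp.toLp 2 (r • v, 0) : Space m n)).fst =
          Real.cos θ • p.fst + Real.sin θ • r • v := by
        simp [sub_smul]
      rw [h2]
      refine (norm_cos_smul_add_sin_smul ?_ ?_ θ).symm
      · rw [inner_smul_right, hv, mul_zero]
      · rw [norm_smul, hr, norm_div, norm_norm, norm_norm,
          div_mul_cancel₀ _ (norm_ne_zero_iff.2 hv0)]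
  have h4 : (WithLp.toLp 2 (r • v, 0) : Space m n) = r • WithLp.toLp 2 (v, 0) :=
    Space.ext (by simp) (by simp)
  rw [h4, map_smul] at h1
  exact (smul_eq_zero.1 h1).resolve_left hr0

theorem fderiv_snd_of_inner_eq_zero (hp : p ∈ S) (hf : ContDiffAt ℝ ∞ f p)
    (hfS : ∀ᶠ q in 𝓝 p, q ∈ S ↔ f q = 0) (h0 : p.snd ≠ 0) {v : EuclideanSpace ℝ (Fin n)}
    (hv : inner ℝ p.snd v = (0 : ℝ)) : fderiv ℝ f p (WithLp.toLp 2 (0, v)) = 0 := by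
  by_cases hv0 : v = 0
  · rw [hv0, show (WithLp.toLp 2 ((0 : EuclideanSpace ℝ (Fin m)), (0 : EuclideanSpace ℝ (Fin n))) :
      Space m n) = 0 from rfl, map_zero]
  set r := ‖p.snd‖ / ‖v‖ with hr
  have hr0 : r ≠ 0 := div_ne_zero (norm_ne_zero_iff.2 h0) (norm_ne_zero_iff.2 hv0)
  have h1 := fderiv_eq_zero_of_circle hf hfS (u := WithLp.toLp 2 (0, p.snd))
    (v := WithLp.toLp 2 (0, r • v)) fun θ => by
      refine hS.mem_of_norm_eq hp (by simp) ?_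
      have h2 : (p + (Real.cos θ - 1) • (WithLp.toLp 2 (0, p.snd) : Space m n) +
          Real.sin θ • (WithLp.toLp 2 (0, r • v) : Space m n)).snd =
          Real.cos θ • p.snd + Real.sin θ • r • v := by
        simp [sub_smul]
      rw [h2]
      refine (norm_cos_smul_add_sin_smul ?_ ?_ θ).symm
      · rw [inner_smul_right, hv, mul_zero]
      · rw [norm_smul, hr, norm_div, norm_norm, norm_norm,
          div_mul_cancel₀ _ (norm_ne_zero_iff.2 hv0)]
  have h4 : (WithLp.toLp 2 (0, r • v) : Space m n) = r • WithLp.toLp 2 (0, v) :=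
    Space.ext (by simp) (by simp)
  rw [h4, map_smul] at h1
  exact (smul_eq_zero.1 h1).resolve_left hr0

/-- The point p is fixed by all of O(m), so the kernel of df on the first factor is invariant under
O(m). As m ≥ 2 it contains a unit vector, and the orbit of its multiples is everything: Σ meets this
axis orthogonally. -/
theorem fderiv_fst_of_eq_zero (hm : 2 ≤ m) (hp : p ∈ S) (hf : ContDiffAt ℝ ∞ f p)
    (h0 : fderiv ℝ f p ≠ 0) (hfS : ∀ᶠ q in 𝓝 p, q ∈ S ↔ f q = 0) (hp0 : p.fst = 0)
    (v : EuclideanSpace ℝ (Fin m)) : fderiv ℝ f p (WithLp.toLp 2 (v, 0)) = 0 := by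
  set ℓ : EuclideanSpace ℝ (Fin m) →L[ℝ] ℝ := (fderiv ℝ f p).comp
    (((WithLp.prodContinuousLinearEquiv 2 ℝ (EuclideanSpace ℝ (Fin m))
    (EuclideanSpace ℝ (Fin n))).symm : _ →L[ℝ] Space m n).comp (.inl ℝ (EuclideanSpace ℝ (Fin m)) (EuclideanSpace ℝ (Fin n)))) with hℓ
  have hℓv : ∀ v, ℓ v = fderiv ℝ f p (WithLp.toLp 2 (v, 0)) := fun v => rfl
  obtain ⟨w, hw1, hw2⟩ := exists_unit_inner_eq_zero hm ((InnerProductSpace.toDual ℝ _).symm ℓ)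
  rw [InnerProductSpace.toDual_symm_apply] at hw2
  have hnorm : ‖v‖ = ‖‖v‖ • w‖ := by rw [norm_smul, hw1, norm_norm, mul_one]
  obtain ⟨σ, hσ⟩ := exists_isometry_apply_eq hnorm
  have h1 := fderiv_apply_eq_zero_iff_of_symm hp hf h0 hfS (actEquiv σ (.refl ℝ _))
    (Space.ext (by rw [actEquiv_apply]; simp [act, hp0]) rfl)
    (hS.actEquiv_mem_iff σ _) (WithLp.toLp 2 (v, 0))
  rw [← h1, actEquiv_apply]
  have h2 : act σ (.refl ℝ _) (WithLp.toLp 2 (v, 0) : Space m n) = WithLp.toLp 2 (‖v‖ • w, 0) :=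
    Space.ext hσ rfl
  rw [h2, ← hℓv, map_smul, hw2, smul_zero]

theorem fderiv_snd_of_eq_zero (hn : 2 ≤ n) (hp : p ∈ S) (hf : ContDiffAt ℝ ∞ f p)
    (h0 : fderiv ℝ f p ≠ 0) (hfS : ∀ᶠ q in 𝓝 p, q ∈ S ↔ f q = 0) (hp0 : p.snd = 0)
    (v : EuclideanSpace ℝ (Fin n)) : fderiv ℝ f p (WithLp.toLp 2 (0, v)) = 0 := by
  set ℓ : EuclideanSpace ℝ (Fin n) →L[ℝ] ℝ := (fderiv ℝ f p).comp
    (((WithLp.prodContinuousLinearEquiv 2 ℝ (EuclideanSpace ℝ (Fin m))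
    (EuclideanSpace ℝ (Fin n))).symm : _ →L[ℝ] Space m n).comp (.inr ℝ (EuclideanSpace ℝ (Fin m)) (EuclideanSpace ℝ (Fin n)))) with hℓ
  have hℓv : ∀ v, ℓ v = fderiv ℝ f p (WithLp.toLp 2 (0, v)) := fun v => rfl
  obtain ⟨w, hw1, hw2⟩ := exists_unit_inner_eq_zero hn ((InnerProductSpace.toDual ℝ _).symm ℓ)
  rw [InnerProductSpace.toDual_symm_apply] at hw2
  have hnorm : ‖v‖ = ‖‖v‖ • w‖ := by rw [norm_smul, hw1, norm_norm, mul_one]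
  obtain ⟨τ, hτ⟩ := exists_isometry_apply_eq hnorm
  have h1 := fderiv_apply_eq_zero_iff_of_symm hp hf h0 hfS (actEquiv (.refl ℝ _) τ)
    (Space.ext rfl (by rw [actEquiv_apply]; simp [act, hp0]))
    (hS.actEquiv_mem_iff _ τ) (WithLp.toLp 2 (0, v))
  rw [← h1, actEquiv_apply]
  have h2 : act (.refl ℝ _) τ (WithLp.toLp 2 (0, v) : Space m n) = WithLp.toLp 2 (0, ‖v‖ • w) :=
    Space.ext rfl hτ
  rw [h2, ← hℓv, map_smul, hw2, smul_zero]

/-- A local equation of an invariant hypersurface restricts to one of its planar profile. -/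
theorem exists_planar_equation (hm : 2 ≤ m) (hn : 2 ≤ n) (hsm : IsSmoothHypersurface S)
    {x₀ : EuclideanSpace ℝ (Fin m)} {y₀ : EuclideanSpace ℝ (Fin n)} (hx : ‖x₀‖ = 1)
    (hy : ‖y₀‖ = 1) {z : ℝ × ℝ} (hz : planeMap x₀ y₀ z ∈ S) :
    ∃ F : ℝ × ℝ → ℝ, ContDiffAt ℝ ∞ F z ∧ fderiv ℝ F z ≠ 0 ∧
      (z.1 = 0 → fderiv ℝ F z (1, 0) = 0) ∧ (z.2 = 0 → fderiv ℝ F z (0, 1) = 0) ∧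
      ∀ᶠ q in 𝓝 z, planeMap x₀ y₀ q ∈ S ↔ F q = 0 := by
  obtain ⟨U, f, hU, hpU, hf, hf0, hSU⟩ := hsm _ hz
  have hfp : ContDiffAt ℝ ∞ f (planeMap x₀ y₀ z) := hf.contDiffAt (hU.mem_nhds hpU)
  have h0 := hf0 _ hpU
  have hfS : ∀ᶠ q in 𝓝 (planeMap x₀ y₀ z), q ∈ S ↔ f q = 0 := by
    filter_upwards [hU.mem_nhds hpU] with q hq
    have := Set.ext_iff.1 hSU q
    simpa [hq] using this
  have hd : fderiv ℝ (f ∘ planeMap x₀ y₀) z =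
      (fderiv ℝ f (planeMap x₀ y₀ z)).comp (planeMap x₀ y₀) :=
    ((hfp.differentiableAt (by simp)).hasFDerivAt.comp z (planeMap x₀ y₀).hasFDerivAt).fderiv
  have hd1 : fderiv ℝ (f ∘ planeMap x₀ y₀) z (1, 0) =
      fderiv ℝ f (planeMap x₀ y₀ z) (WithLp.toLp 2 (x₀, 0)) := by
    rw [hd, ContinuousLinearMap.comp_apply]
    congr 1
    exact Space.ext (by simp [planeMap_fst]) (by simp [planeMap_snd])
  have hd2 : fderiv ℝ (f ∘ planeMap x₀ y₀) z (0, 1) =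
      fderiv ℝ f (planeMap x₀ y₀ z) (WithLp.toLp 2 (0, y₀)) := by
    rw [hd, ContinuousLinearMap.comp_apply]
    congr 1
    exact Space.ext (by simp [planeMap_fst]) (by simp [planeMap_snd])
  have hxx : inner ℝ x₀ x₀ = (1 : ℝ) := by rw [real_inner_self_eq_norm_sq, hx, one_pow]
  have hyy : inner ℝ y₀ y₀ = (1 : ℝ) := by rw [real_inner_self_eq_norm_sq, hy, one_pow]
  refine ⟨f ∘ planeMap x₀ y₀, hfp.comp z (planeMap x₀ y₀).contDiff.contDiffAt, fun hF => h0 ?_,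
    fun hz1 => ?_, fun hz2 => ?_, (planeMap x₀ y₀).continuous.continuousAt.eventually hfS⟩
  -- Invariance kills df on the directions along the orbits, and on a whole factor over its axis; if
  -- df also vanished on the plane it would be zero.
  · rw [hF] at hd1 hd2
    have e1 : ∀ v, fderiv ℝ f (planeMap x₀ y₀ z) (WithLp.toLp 2 (v, 0)) = 0 := fun v => by
      by_cases hz1 : (planeMap x₀ y₀ z).fst = 0
      · exact hS.fderiv_fst_of_eq_zero hm hz hfp h0 hfS hz1 v
      · have h1 := hS.fderiv_fst_of_inner_eq_zero hz hfp hfS hz1 (v := v - inner ℝ x₀ v • x₀) (by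
          rw [planeMap_fst, inner_smul_left, inner_sub_right, inner_smul_right, hxx]; simp)
        have h2 : (WithLp.toLp 2 (v, 0) : Space m n) = WithLp.toLp 2 (v - inner ℝ x₀ v • x₀, 0) +
            inner ℝ x₀ v • WithLp.toLp 2 (x₀, 0) := Space.ext (by simp) (by simp)
        rw [h2, map_add, map_smul, h1, ← hd1]; simp
    have e2 : ∀ v, fderiv ℝ f (planeMap x₀ y₀ z) (WithLp.toLp 2 (0, v)) = 0 := fun v => by
      by_cases hz2 : (planeMap x₀ y₀ z).snd = 0
      · exact hS.fderiv_snd_of_eq_zero hn hz hfp h0 hfS hz2 v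
      · have h1 := hS.fderiv_snd_of_inner_eq_zero hz hfp hfS hz2 (v := v - inner ℝ y₀ v • y₀) (by
          rw [planeMap_snd, inner_smul_left, inner_sub_right, inner_smul_right, hyy]; simp)
        have h2 : (WithLp.toLp 2 (0, v) : Space m n) = WithLp.toLp 2 (0, v - inner ℝ y₀ v • y₀) +
            inner ℝ y₀ v • WithLp.toLp 2 (0, y₀) := Space.ext (by simp) (by simp)
        rw [h2, map_add, map_smul, h1, ← hd2]; simp
    refine ContinuousLinearMap.ext fun q => ?_
    have h2 : q = WithLp.toLp 2 (q.fst, 0) + WithLp.toLp 2 (0, q.snd) :=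
      Space.ext (by simp) (by simp)
    rw [h2, map_add, e1, e2]; simp
  · rw [hd1]
    exact hS.fderiv_fst_of_eq_zero hm hz hfp h0 hfS (by rw [planeMap_fst, hz1, zero_smul]) _
  · rw [hd2]
    exact hS.fderiv_snd_of_eq_zero hn hz hfp h0 hfS (by rw [planeMap_snd, hz2, zero_smul]) _

end IsInvariantSet

end Plane


end

/-! ### From the Lawson leaf to its planar profile. -/

section

theorem IsFrame.swap {e d : ℝ × ℝ} (h : IsFrame e d) : IsFrame e.swap d.swap :=
  ⟨by rw [← h.left]; exact add_comm _ _, by rw [← h.right]; exact add_comm _ _,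
    by rw [← h.orth]; exact add_comm _ _⟩

theorem dot_swap (e z : ℝ × ℝ) : dot e.swap z.swap = dot e z := by
  simp only [dot, Prod.fst_swap, Prod.snd_swap]; ring

/-- The roles of the two axes of a profile can be exchanged. -/
theorem IsProfile.swap {μ ν α β : ℝ} {Γ : Set (ℝ × ℝ)} (h : IsProfile μ ν α β Γ) :
    IsProfile ν μ β α (Prod.swap ⁻¹' Γ) where
  pos_left := h.pos_right
  pos_right := h.pos_left
  cone_left := h.cone_right
  cone_right := h.cone_left
  cone_unit := by rw [← h.cone_unit, add_comm]
  cone_eq := h.cone_eq.symm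
  closed := h.closed.preimage continuous_swap
  neg_fst a b := h.neg_snd b a
  neg_snd a b := h.neg_fst b a
  connected := by
    have h1 := h.connected.image Prod.swap continuous_swap.continuousOn
    convert h1 using 1
    rw [image_image, ← image_swap_eq_preimage_swap, image_image]
    rfl
  exists_eq z hz := by
    obtain ⟨F, h1, h2, h3, h4, h5⟩ := h.exists_eq z.swap hz
    set A : (ℝ × ℝ) ≃L[ℝ] (ℝ × ℝ) := ContinuousLinearEquiv.prodComm ℝ ℝ ℝ with hA
    have hAz : ∀ z, A z = z.swap := fun z => rfl
    have hd : fderiv ℝ (F ∘ A) z = (fderiv ℝ F z.swap).comp (A : ℝ × ℝ →L[ℝ] ℝ × ℝ) :=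
      (HasFDerivAt.comp z (h1.differentiableAt (by simp)).hasFDerivAt A.hasFDerivAt).fderiv
    refine ⟨F ∘ A, ContDiffAt.comp z h1 A.contDiff.contDiffAt, fun h0 => h2 ?_, fun hz1 => ?_,
      fun hz2 => ?_, continuous_swap.continuousAt.eventually h5⟩
    · refine ContinuousLinearMap.ext fun w => ?_
      have := congrArg (fun B : ℝ × ℝ →L[ℝ] ℝ => B w.swap) (hd.symm.trans h0)
      simpa [hAz] using this
    · rw [hd]; exact h4 hz1
    · rw [hd]; exact h3 hz2
  ode z hz h1 h2 e d w hf hw hev := by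
    have hev' : ∀ᶠ q in 𝓝 z.swap, q ∈ Γ ↔ dot d.swap q = w (dot e.swap q) := by
      have h3 : Tendsto Prod.swap (𝓝 z.swap) (𝓝 z) := continuous_swap.tendsto z.swap
      filter_upwards [h3.eventually hev] with q hq
      have h4 : q.swap ∈ Prod.swap ⁻¹' Γ ↔ q ∈ Γ := by simp
      rw [h4] at hq
      rw [hq, ← dot_swap d, ← dot_swap e, Prod.swap_swap]
    have := h.ode z.swap hz h2 h1 e.swap d.swap w hf.swap (by rwa [dot_swap]) hev'
    rw [dot_swap] at this
    rw [this]
    simp only [Prod.fst_swap, Prod.snd_swap]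
    ring
  asymptotic := by
    obtain ⟨R, B, 𝒲, w₀, h1, h2, h3⟩ := h.asymptotic
    -- Exchanging the axes reverses the normal of the ray, hence the sign of w.
    refine ⟨R, B, (fun w t => -w t) '' 𝒲, fun t => -w₀ t, ⟨w₀, h1, rfl⟩, ?_, ?_⟩
    · rintro _ ⟨w, hw, rfl⟩
      obtain ⟨a1, a2, a3⟩ := h2 w hw
      refine ⟨a1.neg, by simpa using a2.neg, fun t ht => ?_⟩
      have := a3 t ht
      simpa [sub_eq_add_neg] using this
    · intro z hz z1 z2 hB
      rcases h3 z.swap hz z2 z1 (by simpa [add_comm] using hB) with ⟨w, hw, t, ht, hor⟩ |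
        ⟨t, ht, hzt⟩
      · refine Or.inl ⟨_, ⟨w, hw, rfl⟩, t, ht, ?_⟩
        rw [or_comm]
        simpa [sub_eq_add_neg] using hor
      · refine Or.inr ⟨t, ht, ?_⟩
        have := congrArg Prod.swap hzt
        simpa [sub_eq_add_neg] using this

section Leaf

variable {m n : ℕ} {S : Set (Space m n)}

/-- The first component of the unit vector along the profile of the Lawson cone. -/
def coneLeft (m n : ℕ) : ℝ := √(((m : ℝ) - 1) / (m + n - 2))

/-- The second component of the unit vector along the profile of the Lawson cone. -/
def coneRight (m n : ℕ) : ℝ := √(((n : ℝ) - 1) / (m + n - 2))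

theorem coneLeft_pos (hm : 2 ≤ m) (hn : 2 ≤ n) : 0 < coneLeft m n := by
  have h1 : (2 : ℝ) ≤ m := by exact_mod_cast hm
  have h2 : (2 : ℝ) ≤ n := by exact_mod_cast hn
  exact Real.sqrt_pos.2 (div_pos (by linarith) (by linarith))

theorem coneRight_pos (hm : 2 ≤ m) (hn : 2 ≤ n) : 0 < coneRight m n := by
  have h1 : (2 : ℝ) ≤ m := by exact_mod_cast hm
  have h2 : (2 : ℝ) ≤ n := by exact_mod_cast hn
  exact Real.sqrt_pos.2 (div_pos (by linarith) (by linarith))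

theorem mul_coneLeft_sq (hm : 2 ≤ m) (hn : 2 ≤ n) :
    ((m : ℝ) + n - 2) * coneLeft m n ^ 2 = m - 1 := by
  have h1 : (2 : ℝ) ≤ m := by exact_mod_cast hm
  have h2 : (2 : ℝ) ≤ n := by exact_mod_cast hn
  rw [coneLeft, Real.sq_sqrt (div_nonneg (by linarith) (by linarith)), mul_div_cancel₀]
  linarith

theorem mul_coneRight_sq (hm : 2 ≤ m) (hn : 2 ≤ n) :
    ((m : ℝ) + n - 2) * coneRight m n ^ 2 = n - 1 := by
  have h1 : (2 : ℝ) ≤ m := by exact_mod_cast hm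
  have h2 : (2 : ℝ) ≤ n := by exact_mod_cast hn
  rw [coneRight, Real.sq_sqrt (div_nonneg (by linarith) (by linarith)), mul_div_cancel₀]
  linarith

theorem coneLeft_sq_add_sq (hm : 2 ≤ m) (hn : 2 ≤ n) :
    coneLeft m n ^ 2 + coneRight m n ^ 2 = 1 := by
  have h1 : (2 : ℝ) ≤ m := by exact_mod_cast hm
  have h2 : (2 : ℝ) ≤ n := by exact_mod_cast hn
  have h3 : (0 : ℝ) < m + n - 2 := by linarith
  refine mul_left_cancel₀ h3.ne' ?_
  linear_combination mul_coneLeft_sq hm hn + mul_coneRight_sq hm hn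

/-- The point of the cone in the directions of given unit vectors. -/
def conePoint (x : EuclideanSpace ℝ (Fin m)) (y : EuclideanSpace ℝ (Fin n)) (t : ℝ) : Space m n :=
  planeMap x y (coneLeft m n * t, coneRight m n * t)

theorem planeMap_norm {x : EuclideanSpace ℝ (Fin m)} {y : EuclideanSpace ℝ (Fin n)}
    (hx : ‖x‖ = 1) (hy : ‖y‖ = 1) (z : ℝ × ℝ) : ‖planeMap x y z‖ ^ 2 = z.1 ^ 2 + z.2 ^ 2 := by
  rw [norm_sq_eq_fst_snd, planeMap_fst, planeMap_snd, norm_smul, norm_smul, hx, hy, mul_one,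
    mul_one, Real.norm_eq_abs, Real.norm_eq_abs, sq_abs, sq_abs]

theorem norm_conePoint (hm : 2 ≤ m) (hn : 2 ≤ n) {x : EuclideanSpace ℝ (Fin m)}
    {y : EuclideanSpace ℝ (Fin n)} (hx : ‖x‖ = 1) (hy : ‖y‖ = 1) {t : ℝ} (ht : 0 ≤ t) :
    ‖conePoint x y t‖ = t := by
  refine (sq_eq_sq₀ (norm_nonneg _) ht).1 ?_
  rw [conePoint, planeMap_norm hx hy]
  linear_combination t ^ 2 * coneLeft_sq_add_sq hm hn

theorem tendsto_conePoint (hm : 2 ≤ m) (hn : 2 ≤ n) {x : EuclideanSpace ℝ (Fin m)}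
    {y : EuclideanSpace ℝ (Fin n)} (hx : ‖x‖ = 1) (hy : ‖y‖ = 1) :
    Tendsto (fun t => conePoint x y t) atTop (Bornology.cobounded (Space m n)) := by
  refine tendsto_norm_atTop_iff_cobounded.1 (tendsto_id.congr' ?_)
  filter_upwards [eventually_ge_atTop 0] with t ht
  exact (norm_conePoint hm hn hx hy ht).symm

theorem conePoint_mem (hm : 2 ≤ m) (hn : 2 ≤ n) {x : EuclideanSpace ℝ (Fin m)}
    {y : EuclideanSpace ℝ (Fin n)} (hx : ‖x‖ = 1) (hy : ‖y‖ = 1) (t : ℝ) :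
    conePoint x y t ∈ lawsonCone m n := by
  simp only [lawsonCone, mem_ofPred_eq, conePoint, planeMap_fst, planeMap_snd, norm_smul, hx, hy,
    mul_one, Real.norm_eq_abs, sq_abs]
  rw [← mul_coneLeft_sq hm hn, ← mul_coneRight_sq hm hn]
  ring

theorem exists_eq_conePoint (hm : 2 ≤ m) (hn : 2 ≤ n) {ξ : Space m n} (hξ : ξ ∈ lawsonCone m n)
    (h0 : 0 < ‖ξ‖) : ∃ (x : EuclideanSpace ℝ (Fin m)) (y : EuclideanSpace ℝ (Fin n)),
      ‖x‖ = 1 ∧ ‖y‖ = 1 ∧ ξ = conePoint x y ‖ξ‖ := by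
  have h1 : (2 : ℝ) ≤ m := by exact_mod_cast hm
  have h2 : (2 : ℝ) ≤ n := by exact_mod_cast hn
  have h3 : (0 : ℝ) < m + n - 2 := by linarith
  have hα := coneLeft_pos hm hn
  have hβ := coneRight_pos hm hn
  have hc : ((n : ℝ) - 1) * ‖ξ.fst‖ ^ 2 = (m - 1) * ‖ξ.snd‖ ^ 2 := hξ
  have hsq := norm_sq_eq_fst_snd ξ
  have e1 : ‖ξ.fst‖ = coneLeft m n * ‖ξ‖ := by
    refine (sq_eq_sq₀ (norm_nonneg _) (by positivity)).1 (mul_left_cancel₀ h3.ne' ?_)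
    rw [mul_pow, hsq]
    linear_combination hc - (‖ξ.fst‖ ^ 2 + ‖ξ.snd‖ ^ 2) * mul_coneLeft_sq hm hn
  have e2 : ‖ξ.snd‖ = coneRight m n * ‖ξ‖ := by
    refine (sq_eq_sq₀ (norm_nonneg _) (by positivity)).1 (mul_left_cancel₀ h3.ne' ?_)
    rw [mul_pow, hsq]
    linear_combination -hc - (‖ξ.fst‖ ^ 2 + ‖ξ.snd‖ ^ 2) * mul_coneRight_sq hm hn
  have f1 : ξ.fst ≠ 0 := norm_ne_zero_iff.1 (by rw [e1]; positivity)
  have f2 : ξ.snd ≠ 0 := norm_ne_zero_iff.1 (by rw [e2]; positivity)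
  refine ⟨‖ξ.fst‖⁻¹ • ξ.fst, ‖ξ.snd‖⁻¹ • ξ.snd, norm_inv_norm_smul f1, norm_inv_norm_smul f2,
    Space.ext ?_ ?_⟩
  · rw [conePoint, planeMap_fst, ← e1, smul_inv_smul₀ (norm_ne_zero_iff.2 f1)]
  · rw [conePoint, planeMap_snd, ← e2, smul_inv_smul₀ (norm_ne_zero_iff.2 f2)]

theorem coneNormal_conePoint (hm : 2 ≤ m) (hn : 2 ≤ n) {x : EuclideanSpace ℝ (Fin m)}
    {y : EuclideanSpace ℝ (Fin n)} (hx : ‖x‖ = 1) (hy : ‖y‖ = 1) {t : ℝ} (ht : 0 < t) :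
    coneNormal (conePoint x y t) = planeMap x y (-coneRight m n, coneLeft m n) := by
  have h1 : (2 : ℝ) ≤ m := by exact_mod_cast hm
  have h2 : (2 : ℝ) ≤ n := by exact_mod_cast hn
  have h3 : (0 : ℝ) < m + n - 2 := by linarith
  have hα := coneLeft_pos hm hn
  have hβ := coneRight_pos hm hn
  set r := ((m : ℝ) + n - 2) * coneLeft m n * coneRight m n * t with hr
  have hr0 : 0 < r := by positivity
  have e1 : coneGradient (conePoint x y t) = r • planeMap x y (-coneRight m n, coneLeft m n) := by
    refine Space.ext ?_ ?_
    · refine (smul_smul _ _ x).trans ((congrArg (· • x) ?_).trans (smul_smul _ _ x).symm)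
      change (1 - (n : ℝ)) * (coneLeft m n * t) = r * -coneRight m n
      rw [hr]
      linear_combination (coneLeft m n * t) * mul_coneRight_sq hm hn
    · refine (smul_smul _ _ y).trans ((congrArg (· • y) ?_).trans (smul_smul _ _ y).symm)
      change ((m : ℝ) - 1) * (coneRight m n * t) = r * coneLeft m n
      rw [hr]
      linear_combination -(coneRight m n * t) * mul_coneLeft_sq hm hn
  have e2 : ‖planeMap x y (-coneRight m n, coneLeft m n)‖ = 1 := by
    refine (sq_eq_sq₀ (norm_nonneg _) zero_le_one).1 ?_
    rw [planeMap_norm hx hy]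
    linear_combination coneLeft_sq_add_sq hm hn
  rw [coneNormal, e1, norm_smul, e2, mul_one, Real.norm_eq_abs, abs_of_pos hr0,
    inv_smul_smul₀ hr0.ne']

theorem conePoint_add_smul_coneNormal (hm : 2 ≤ m) (hn : 2 ≤ n) {x : EuclideanSpace ℝ (Fin m)}
    {y : EuclideanSpace ℝ (Fin n)} (hx : ‖x‖ = 1) (hy : ‖y‖ = 1) {t : ℝ} (ht : 0 < t) (s : ℝ) :
    conePoint x y t + s • coneNormal (conePoint x y t) =
      planeMap x y (coneLeft m n * t - coneRight m n * s, coneRight m n * t + coneLeft m n * s) := by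
  rw [coneNormal_conePoint hm hn hx hy ht, conePoint, ← map_smul, ← map_add]
  congr 1
  ext
  · simp; ring
  · simp; ring

/-- The planar profile of a Lawson leaf. -/
theorem IsLawsonLeaf.isProfile (hm : 2 ≤ m) (hn : 2 ≤ n) (hS : IsLawsonLeaf S)
    {x₀ : EuclideanSpace ℝ (Fin m)} {y₀ : EuclideanSpace ℝ (Fin n)} (hx : ‖x₀‖ = 1)
    (hy : ‖y₀‖ = 1) :
    IsProfile ((m : ℝ) - 1) ((n : ℝ) - 1) (coneLeft m n) (coneRight m n)
      (planeMap x₀ y₀ ⁻¹' S) := by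
  have h1 : (2 : ℝ) ≤ m := by exact_mod_cast hm
  have h2 : (2 : ℝ) ≤ n := by exact_mod_cast hn
  have hinv := hS.invariant
  have hfst : ∀ z, ‖(planeMap x₀ y₀ z).fst‖ = |z.1| := fun z => by
    rw [planeMap_fst, norm_smul, hx, mul_one, Real.norm_eq_abs]
  have hsnd : ∀ z, ‖(planeMap x₀ y₀ z).snd‖ = |z.2| := fun z => by
    rw [planeMap_snd, norm_smul, hy, mul_one, Real.norm_eq_abs]
  have hmem : ∀ (q : Space m n) (z : ℝ × ℝ), ‖q.fst‖ = |z.1| → ‖q.snd‖ = |z.2| →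
      (z ∈ planeMap x₀ y₀ ⁻¹' S ↔ q ∈ S) := fun q z e1 e2 =>
    hinv.mem_iff_of_norm_eq (by rw [hfst, e1]) (by rw [hsnd, e2])
  have hfc : Continuous fun q : Space m n => ‖q.fst‖ := (WithLp.continuous_fst _ _ _).norm
  have hsc : Continuous fun q : Space m n => ‖q.snd‖ := (WithLp.continuous_snd _ _ _).norm
  refine ⟨by linarith, by linarith, coneLeft_pos hm hn, coneRight_pos hm hn,
    coneLeft_sq_add_sq hm hn, ?_, hS.closed.preimage (planeMap x₀ y₀).continuous,
    fun a b hab => ?_, fun a b hab => ?_, ?_, fun z hz =>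
      hinv.exists_planar_equation hm hn hS.minimal.1 hx hy hz, ?_, ?_⟩
  · rw [← mul_coneLeft_sq hm hn, ← mul_coneRight_sq hm hn]; ring
  · exact (hmem (planeMap x₀ y₀ (a, b)) (-a, b) (by rw [hfst, abs_neg]) (hsnd _)).2 hab
  · exact (hmem (planeMap x₀ y₀ (a, b)) (a, -b) (hfst _) (by rw [hsnd, abs_neg])).2 hab
  · have : (fun z : ℝ × ℝ => (|z.1|, |z.2|)) '' (planeMap x₀ y₀ ⁻¹' S) =
        (fun q : Space m n => (‖q.fst‖, ‖q.snd‖)) '' S := by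
      ext z
      constructor
      · rintro ⟨w, hw, rfl⟩
        exact ⟨planeMap x₀ y₀ w, hw, Prod.ext (hfst w) (hsnd w)⟩
      · rintro ⟨q, hq, rfl⟩
        refine ⟨(‖q.fst‖, ‖q.snd‖), (hmem q _ ?_ ?_).2 hq, ?_⟩ <;> simp
    rw [this]
    exact hS.connected.isPreconnected.image _ (hfc.prodMk hsc).continuousOn
  · intro z hz hz1 hz2 e d w hfr hw hev
    set p := planeMap x₀ y₀ z with hp
    have hp1 : ‖p.fst‖ = z.1 := by rw [hfst, abs_of_pos hz1]
    have hp2 : ‖p.snd‖ = z.2 := by rw [hsnd, abs_of_pos hz2]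
    have hcoord : ∀ c (q : Space m n), radialCoord c q = dot c (‖q.fst‖, ‖q.snd‖) :=
      fun c q => rfl
    have hpz : (‖p.fst‖, ‖p.snd‖) = z := by rw [hp1, hp2]
    have hc : ContinuousAt (fun q : Space m n => (‖q.fst‖, ‖q.snd‖)) p :=
      (hfc.prodMk hsc).continuousAt
    have hc' : Tendsto (fun q : Space m n => (‖q.fst‖, ‖q.snd‖)) (𝓝 p) (𝓝 z) := by
      have := hc.tendsto
      rwa [hpz] at this
    have hG : IsRadialGraphAt S e d w p := by
      refine ⟨hz, norm_ne_zero_iff.1 (by rw [hp1]; exact hz1.ne'),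
        norm_ne_zero_iff.1 (by rw [hp2]; exact hz2.ne'), hfr, by rw [hcoord, hpz]; exact hw, ?_⟩
      filter_upwards [hc'.eventually hev] with q hq
      rw [hcoord, hcoord, ← hq, hmem q _ (by simp) (by simp)]
    have := hG.deriv_deriv_eq (hS.minimal.2 p hz)
    rw [hcoord, hpz, hp1, hp2] at this
    rw [this]
  · obtain ⟨R, w, K, hR, hK, hwc, hwt, himg⟩ := hS.asymptotic
    obtain ⟨B, hB⟩ := hK.exists_norm_le
    have hwc' : ContinuousOn w (lawsonCone m n ∩ {ξ | R < ‖ξ‖}) := hwc.continuousOn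
    refine ⟨R, B, {v | ∃ (x : EuclideanSpace ℝ (Fin m)) (y : EuclideanSpace ℝ (Fin n)),
      ‖x‖ = 1 ∧ ‖y‖ = 1 ∧ v = fun t => w (conePoint x y t)}, fun t => w (conePoint x₀ y₀ t),
      ⟨x₀, y₀, hx, hy, rfl⟩, ?_, ?_⟩
    · rintro _ ⟨x, y, hx', hy', rfl⟩
      have hcont : Continuous fun t => conePoint x y t :=
        (planeMap x y).continuous.comp (by fun_prop)
      have hcob : Tendsto (fun t => conePoint x y t) atTop (Bornology.cobounded (Space m n)) :=
        tendsto_conePoint hm hn hx' hy'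
      have hmaps : MapsTo (fun t => conePoint x y t) (Ioi R) (lawsonCone m n ∩ {ξ | R < ‖ξ‖}) := fun t ht => by
        have ht' : R < t := ht
        refine ⟨conePoint_mem hm hn hx' hy' t, ?_⟩
        change R < ‖conePoint x y t‖
        rwa [norm_conePoint hm hn hx' hy' (hR.trans ht').le]
      have hwx : ContinuousOn (w ∘ fun t => conePoint x y t) (Ioi R) :=
        hwc'.comp hcont.continuousOn hmaps
      refine ⟨hwx, ?_, fun t ht => ?_⟩
      · exact Tendsto.comp hwt (tendsto_inf.2 ⟨hcob, tendsto_principal.2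
          (Eventually.of_forall fun t => conePoint_mem hm hn hx' hy' t)⟩)
      · have ht0 : 0 < t := hR.trans ht
        have hq : planeMap x y (coneLeft m n * t - coneRight m n * w (conePoint x y t),
            coneRight m n * t + coneLeft m n * w (conePoint x y t)) ∈ S := by
          rw [← conePoint_add_smul_coneNormal hm hn hx' hy' ht0]
          have : conePoint x y t + w (conePoint x y t) • coneNormal (conePoint x y t) ∈ S \ K := by
            rw [himg]
            refine ⟨conePoint x y t, ⟨conePoint_mem hm hn hx' hy' t, ?_⟩, rfl⟩
            change R < ‖conePoint x y t‖
            rwa [norm_conePoint hm hn hx' hy' ht0.le]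
          exact this.1
        refine (hmem _ _ ?_ ?_).2 hq
        · rw [planeMap_fst, norm_smul, hx', mul_one, Real.norm_eq_abs]
        · rw [planeMap_snd, norm_smul, hy', mul_one, Real.norm_eq_abs]
    · intro z hz hz1 hz2 hzB
      -- By Cauchy–Schwarz the norm of the point is at least its coordinate along the ray, which
      -- exceeds the bound B of K.
      have hzK : planeMap x₀ y₀ z ∉ K := fun hzK => by
        have e1 := hB _ hzK
        have e2 := planeMap_norm hx hy z
        have e3 : (coneLeft m n * z.1 + coneRight m n * z.2) ^ 2 ≤ ‖planeMap x₀ y₀ z‖ ^ 2 := by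
          rw [e2]
          have : z.1 ^ 2 + z.2 ^ 2 - (coneLeft m n * z.1 + coneRight m n * z.2) ^ 2 =
              (coneRight m n * z.1 - coneLeft m n * z.2) ^ 2 := by
            linear_combination -(z.1 ^ 2 + z.2 ^ 2) * coneLeft_sq_add_sq hm hn
          have := sq_nonneg (coneRight m n * z.1 - coneLeft m n * z.2)
          linarith
        have e4 := abs_le_of_sq_le_sq' e3 (norm_nonneg _)
        linarith [e4.2]
      have hmem' : planeMap x₀ y₀ z ∈ S \ K := ⟨hz, hzK⟩
      rw [himg] at hmem'
      obtain ⟨ξ, ⟨hξ1, hξ2⟩, hξ3⟩ := hmem'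
      have hξ2 : R < ‖ξ‖ := hξ2
      obtain ⟨x, y, hx', hy', hξ4⟩ := exists_eq_conePoint hm hn hξ1 (hR.trans hξ2)
      set t := ‖ξ‖ with ht
      have ht0 : 0 < t := hR.trans hξ2
      simp only at hξ3
      rw [hξ4, conePoint_add_smul_coneNormal hm hn hx' hy' ht0] at hξ3
      by_cases hor : coneLeft m n * t - coneRight m n * w (conePoint x y t) ≤ 0 ∨
          coneRight m n * t + coneLeft m n * w (conePoint x y t) ≤ 0
      · exact Or.inl ⟨_, ⟨x, y, hx', hy', rfl⟩, t, hξ2, hor⟩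
      -- When both signed lengths are positive, comparing norms identifies them with the coordinates
      -- of z, and then the directions of the foot point must be x₀ and y₀.
      · push Not at hor
        right
        refine ⟨t, hξ2, ?_⟩
        have e1 := congrArg (fun q : Space m n => q.fst) hξ3
        have e2 := congrArg (fun q : Space m n => q.snd) hξ3
        simp only [planeMap_fst, planeMap_snd] at e1 e2
        have n1 := congrArg norm e1
        have n2 := congrArg norm e2
        rw [norm_smul, norm_smul, hx, hx', mul_one, mul_one, Real.norm_eq_abs, Real.norm_eq_abs,
          abs_of_pos hor.1, abs_of_nonneg hz1] at n1
        rw [norm_smul, norm_smul, hy, hy', mul_one, mul_one, Real.norm_eq_abs, Real.norm_eq_abs,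
          abs_of_pos hor.2, abs_of_nonneg hz2] at n2
        have x1 : x = x₀ := by
          rw [n1] at e1
          exact smul_right_injective _ (n1 ▸ hor.1.ne') e1
        have y1 : y = y₀ := by
          rw [n2] at e2
          exact smul_right_injective _ (n2 ▸ hor.2.ne') e2
        rw [x1, y1] at n1 n2
        exact Prod.ext n1.symm n2.symm

end Leaf


end

/-! ### The chain of gaps, and transfer of solutions to the hypersurface. -/

section

section Chain

variable {K : ℕ}

/-- The vector which measures the gap between consecutive coordinates. -/
def gapVector (K : ℕ) (i : Fin K) : EuclideanSpace ℝ (Fin (K + 1)) :=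
  EuclideanSpace.single i.succ 1 - EuclideanSpace.single i.castSucc 1

theorem inner_gapVector (i : Fin K) (x : EuclideanSpace ℝ (Fin (K + 1))) :
    inner ℝ (gapVector K i) x = x i.succ - x i.castSucc := by
  simp [gapVector, inner_sub_left, EuclideanSpace.inner_single_left]

/-- The sequence of functions on `X` given by the coordinates of a vector valued function. -/
def coordSeq {X : Type*} (F : X → EuclideanSpace ℝ (Fin (K + 1))) (j : ℕ) (p : X) : ℝ :=
  if hj : j - 1 < K + 1 then F p ⟨j - 1, hj⟩ else 0

theorem coordSeq_succ {X : Type*} (F : X → EuclideanSpace ℝ (Fin (K + 1))) {l : ℕ}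
    (hl : l < K + 1) (p : X) : coordSeq F (l + 1) p = F p ⟨l, hl⟩ := by
  simp [coordSeq, hl]

/-- Only the two gaps adjacent to a coordinate contribute, with opposite signs, and at the ends of
the chain the missing one is the zero value of `interaction`. Coordinate l carries h_{l+1}, since
coordinates start at 0 and sheets at 1. -/
theorem sum_gapVector_apply {X : Type*} (F : X → EuclideanSpace ℝ (Fin (K + 1))) (p : X) {l : ℕ}
    (hl : l < K + 1) :
    (∑ i, Real.exp (-(√2 * inner ℝ (gapVector K i) (F p))) • gapVector K i) ⟨l, hl⟩ =
      interaction (K + 1) (coordSeq F) l p - interaction (K + 1) (coordSeq F) (l + 1) p := by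
  have h0 : (∑ i, Real.exp (-(√2 * inner ℝ (gapVector K i) (F p))) • gapVector K i) ⟨l, hl⟩ =
      (∑ i, Real.exp (-(√2 * inner ℝ (gapVector K i) (F p))) *
        if (⟨l, hl⟩ : Fin (K + 1)) = i.succ then 1 else 0) -
      ∑ i, Real.exp (-(√2 * inner ℝ (gapVector K i) (F p))) *
        if (⟨l, hl⟩ : Fin (K + 1)) = i.castSucc then 1 else 0 := by
    rw [← Finset.sum_sub_distrib]
    simp only [WithLp.ofLp_sum, Finset.sum_apply]
    refine Finset.sum_congr rfl fun i _ => ?_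
    simp only [gapVector, PiLp.smul_apply, PiLp.sub_apply, EuclideanSpace.single_apply,
      smul_eq_mul, mul_sub]
  rw [h0]
  congr 1
  · rcases l with _ | l
    · simp only [interaction]
      refine (Finset.sum_eq_zero fun i _ => ?_).trans (by simp)
      rw [if_neg fun h => by simp [Fin.ext_iff] at h, mul_zero]
    · have hlK : l < K := by omega
      rw [Finset.sum_eq_single ⟨l, hlK⟩, if_pos (show (⟨l + 1, hl⟩ : Fin (K + 1)) =
        Fin.succ ⟨l, hlK⟩ from rfl), mul_one, inner_gapVector, interaction,
        if_pos ⟨by omega, hl⟩, coordSeq_succ F hl, coordSeq_succ F (by omega : l < K + 1)]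
      · rfl
      · intro i _ hi
        rw [if_neg fun h => hi ?_, mul_zero]
        ext
        simp only [Fin.ext_iff, Fin.val_succ] at h
        simp; omega
      · simp
  · by_cases hlK : l < K
    · rw [Finset.sum_eq_single ⟨l, hlK⟩, if_pos (show (⟨l, hl⟩ : Fin (K + 1)) =
        Fin.castSucc ⟨l, hlK⟩ from rfl), mul_one, inner_gapVector, interaction,
        if_pos ⟨by omega, by omega⟩, coordSeq_succ F hl, coordSeq_succ F (by omega : l + 1 < K + 1)]
      · rfl
      · intro i _ hi
        rw [if_neg fun h => hi ?_, mul_zero]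
        ext
        simp only [Fin.ext_iff, Fin.val_castSucc] at h
        simp [h]
      · simp
    · rw [interaction, if_neg (by omega)]
      refine Finset.sum_eq_zero fun i _ => ?_
      rw [if_neg fun h => ?_, mul_zero]
      simp only [Fin.ext_iff, Fin.val_castSucc] at h
      omega

end Chain

theorem IsProfileGraph.profileNormSqA_eq {μ ν α β : ℝ} {g : ℝ → ℝ}
    (h : IsProfileGraph μ ν α β g) (hμ : 0 < μ) {a : ℝ} (ha : 0 < a) :
    profileNormSqA μ ν g a = deriv (deriv g) a ^ 2 / (1 + deriv g a ^ 2) ^ 3 +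
      (μ * (deriv g a / a) ^ 2 + ν * (1 / g a) ^ 2) / (1 + deriv g a ^ 2) := by
  have h1 : slopeQuotient μ ν g a = deriv g a / a := by
    rw [eq_div_iff ha.ne', mul_comm]; exact h.mul_slopeQuotient hμ ha.le
  have h2 : ν / g a - μ * slopeQuotient μ ν g a = deriv (deriv g) a / (1 + deriv g a ^ 2) := by
    rw [slopeQuotient, mul_div_cancel₀ _ hμ.ne']; ring
  rw [profileNormSqA, h2, h1]
  have := (h.one_add_pos a).ne'
  have := (h.pos a).ne'
  field_simp
  ring

section Rotated

variable {m n : ℕ} {S : Set (Space m n)}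

/-- An invariant hypersurface described by a radial coordinate and a profile graph: its curvature,
its Laplace operator on functions of the coordinate, and a path to each point of the axis. -/
structure IsRotatedGraph (S : Set (Space m n)) (μ ν : ℝ) (r : Space m n → ℝ) (g : ℝ → ℝ) :
    Prop where
  smooth : IsSmoothHypersurface S
  nonneg : ∀ q, 0 ≤ r q
  contDiff : ∀ H : ℝ → ℝ, ContDiff ℝ ∞ H → (∀ a, H (-a) = H a) → ContDiff ℝ ∞ fun q => H (r q)
  invariant : ∀ σ τ q, r (act σ τ q) = r q
  normSqA_eq : ∀ q ∈ S, 0 < r q → normSqA S q = profileNormSqA μ ν g (r q)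
  laplaceBeltrami_eq : ∀ q ∈ S, 0 < r q → ∀ H : ℝ → ℝ, ContDiff ℝ ∞ H →
    laplaceBeltrami S (fun q => H (r q)) q =
      (1 + deriv g (r q) ^ 2)⁻¹ * deriv (deriv H) (r q) + μ / r q * deriv H (r q)
  exists_path : ∀ q ∈ S, r q = 0 → ∃ φ : ℝ → Space m n, Continuous φ ∧ φ 0 = q ∧
    (∀ t, φ t ∈ S) ∧ ∀ t > 0, 0 < r (φ t)

/-- Points of the axis are limits of points of S off the axis, along the paths of `exists_path`. -/
theorem IsRotatedGraph.eqOn {μ ν : ℝ} {r : Space m n → ℝ} {g : ℝ → ℝ}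
    (h : IsRotatedGraph S μ ν r g) {f₁ f₂ : Space m n → ℝ} (h1 : ContinuousOn f₁ S)
    (h2 : ContinuousOn f₂ S) (heq : ∀ q ∈ S, 0 < r q → f₁ q = f₂ q) : EqOn f₁ f₂ S := by
  intro q hq
  rcases (h.nonneg q).eq_or_lt with h0 | h0
  · obtain ⟨φ, hφ, hφ0, hφS, hφr⟩ := h.exists_path q hq h0.symm
    have c1 : Continuous fun t => f₁ (φ t) := h1.comp_continuous hφ hφS
    have c2 : Continuous fun t => f₂ (φ t) := h2.comp_continuous hφ hφS
    have hev : (fun t => f₁ (φ t)) =ᶠ[𝓝[>] 0] fun t => f₂ (φ t) := by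
      filter_upwards [self_mem_nhdsWithin] with t ht using heq _ (hφS t) (hφr t ht)
    have := tendsto_nhds_unique_of_eventuallyEq
      (c1.continuousAt.tendsto.mono_left (nhdsWithin_le_nhds (a := (0 : ℝ)) (s := Ioi 0)))
      (c2.continuousAt.tendsto.mono_left nhdsWithin_le_nhds) hev
    rwa [hφ0] at this
  · exact heq q hq h0

theorem continuous_interaction {X : Type*} [TopologicalSpace X] (k : ℕ) {h : ℕ → X → ℝ}
    (hc : ∀ j, Continuous (h j)) (j : ℕ) : Continuous (interaction k h j) := by
  unfold interaction
  by_cases hj : 1 ≤ j ∧ j < k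
  · simp only [hj, and_self, if_true]
    have := hc j
    have := hc (j + 1)
    fun_prop
  · simp only [hj, if_false]
    exact continuous_const

/-- The Jacobi–Toda system on a rotated profile graph. -/
theorem IsRotatedGraph.exists_toda_solution {j : ℕ} {ν α β : ℝ} {r : Space m n → ℝ} {g : ℝ → ℝ}
    (h : IsRotatedGraph S (j : ℝ) ν r g) (hg : IsProfileGraph (j : ℝ) ν α β g)
    (hμ : 0 < (j : ℝ)) (hν : 0 < ν) (hα : 0 < α) (hβ : 0 < β) (hunit : α ^ 2 + β ^ 2 = 1)
    (hcone : ν * α ^ 2 = j * β ^ 2) {γ : ℝ} (hγ : 0 < γ) {k : ℕ} (hk : 1 ≤ k) :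
    ∃ δs : ℝ, 0 < δs ∧ ∀ δ : ℝ, 0 < δ → δ ≤ δs → ∃ h : ℕ → Space m n → ℝ,
      (∀ j, 1 ≤ j → j ≤ k → ContDiffOn ℝ ∞ (h j) S ∧ IsInvariantOn S (h j)) ∧
      SolvesJacobiToda S δ γ k h ∧
      (∀ j, 1 ≤ j → j < k → ∀ p ∈ S, h j p < h (j + 1) p) := by
  obtain ⟨K, rfl⟩ : ∃ K, k = K + 1 := ⟨k - 1, by omega⟩
  -- The vector (0, 1, …, K) has all gaps equal to 1, so its multiples prescribe equal initial gaps.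
  obtain ⟨δs, hδs, hsol⟩ := hg.exists_toda_solution hμ hν hα hβ hunit hcone (gapVector K)
    (WithLp.toLp 2 fun i : Fin (K + 1) => ((i : ℕ) : ℝ))
    (fun i => by rw [inner_gapVector]; simp) hγ
  refine ⟨δs, hδs, fun δ hδ hle => ?_⟩
  obtain ⟨H, hH, hHe, hgap, hode⟩ := hsol δ hδ hle
  have hHl : ∀ l : Fin (K + 1), ContDiff ℝ ∞ fun a => H a l := fun l =>
    (EuclideanSpace.proj (𝕜 := ℝ) l).contDiff.comp hH
  have hd : ∀ l a, deriv (fun a => H a l) a = deriv H a l := fun l a =>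
    ((EuclideanSpace.proj (𝕜 := ℝ) l).hasFDerivAt.comp_hasDerivAt a
      (hH.differentiable (by simp) a).hasDerivAt).deriv
  have hdd : ∀ l a, deriv (deriv fun a => H a l) a = deriv (deriv H) a l := fun l a => by
    rw [show deriv (fun a => H a l) = fun a => deriv H a l from funext (hd l)]
    exact ((EuclideanSpace.proj (𝕜 := ℝ) l).hasFDerivAt.comp_hasDerivAt a
      (((contDiff_infty_iff_deriv.1 hH).2).differentiable (by simp) a).hasDerivAt).deriv
  set F : ℕ → Space m n → ℝ := coordSeq fun q => H (r q) with hF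
  have hFl : ∀ {l : ℕ} (hl : l < K + 1), F (l + 1) = fun q => H (r q) ⟨l, hl⟩ := fun hl =>
    funext fun q => coordSeq_succ _ hl q
  have hFs : ∀ j, ContDiff ℝ ∞ (F j) := fun j => by
    by_cases hj : j - 1 < K + 1
    · have : F j = fun q => H (r q) ⟨j - 1, hj⟩ := funext fun q => by
        simp only [hF, coordSeq, dif_pos hj]
      rw [this]
      exact h.contDiff _ (hHl _) fun a => by rw [hHe]
    · have : F j = fun _ => 0 := funext fun q => by simp only [hF, coordSeq, dif_neg hj]
      rw [this]
      exact contDiff_const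
  refine ⟨F, fun j _ _ => ⟨(hFs j).contDiffOn, fun σ τ p _ => ?_⟩, ?_, ?_⟩
  · simp only [hF, coordSeq, h.invariant]
  · intro j hj1 hjK p hp
    obtain ⟨l, rfl⟩ : ∃ l, j = l + 1 := ⟨j - 1, by omega⟩
    have hl : l < K + 1 := by omega
    rw [Nat.add_sub_cancel]
    have hcont : ∀ i, Continuous (interaction (K + 1) F i) :=
      continuous_interaction _ fun j => (hFs j).continuous
    -- The differential equation is known only for r > 0, where the reduction to one variable is
    -- valid; continuity of both sides covers the axis.
    refine h.eqOn
      (f₁ := fun p => δ * (laplaceBeltrami S (F (l + 1)) p + normSqA S p * F (l + 1) p))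
      (f₂ := fun p => γ * (interaction (K + 1) F l p - interaction (K + 1) F (l + 1) p))
      (continuousOn_const.mul ((h.smooth.continuousOn_laplaceBeltrami (hFs _)).add
        (h.smooth.continuousOn_normSqA.mul (hFs _).continuous.continuousOn)))
      (continuous_const.mul ((hcont _).sub (hcont _))).continuousOn (fun q hq hr => ?_) hp
    have e1 := congrArg (fun x : EuclideanSpace ℝ (Fin (K + 1)) => x ⟨l, hl⟩) (hode (r q) hr)
    simp only [PiLp.add_apply, PiLp.smul_apply, smul_eq_mul] at e1
    rw [sum_gapVector_apply (fun q => H (r q)) q hl] at e1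
    rw [hFl hl, h.laplaceBeltrami_eq q hq hr _ (hHl _), h.normSqA_eq q hq hr, hd, hdd, e1]
    field_simp
    rfl
  · intro j hj1 hjK p hp
    obtain ⟨l, rfl⟩ : ∃ l, j = l + 1 := ⟨j - 1, by omega⟩
    have h1 := hgap ⟨l, by omega⟩ (r p)
    rw [inner_gapVector] at h1
    rw [hFl (by omega : l < K + 1), hFl (by omega : l + 1 < K + 1)]
    exact sub_pos.1 h1

theorem isRotatedGraph_fst (hS : IsLawsonLeaf S) (hm : 2 ≤ m) (hn : 2 ≤ n) {α β : ℝ} {g : ℝ → ℝ}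
    (hg : IsProfileGraph ((m : ℝ) - 1) ((n : ℝ) - 1) α β g)
    (hSg : ∀ q, q ∈ S ↔ ‖q.snd‖ = g ‖q.fst‖) :
    IsRotatedGraph S ((m : ℝ) - 1) ((n : ℝ) - 1) (fun q => ‖q.fst‖) g := by
  have hμ : (0 : ℝ) < m - 1 := by
    have : (2 : ℝ) ≤ m := by exact_mod_cast hm
    linarith
  have hG : ∀ q ∈ S, 0 < ‖q.fst‖ → IsRadialGraphAt S (1, 0) (0, 1) g q := fun q hq h0 =>
    ⟨hq, norm_pos_iff.1 h0, norm_pos_iff.1 (by rw [(hSg q).1 hq]; exact hg.pos _), isFrame_std,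
      (hg.smooth.contDiffAt).of_le two_le_infty,
      Eventually.of_forall fun q => by simp [radialCoord, hSg]⟩
  have hr : ∀ q : Space m n, radialCoord (1, 0) q = ‖q.fst‖ := fun q => by simp [radialCoord]
  refine ⟨hS.minimal.1, fun q => norm_nonneg _, fun H hH hHe => ?_, fun σ τ q => σ.norm_map _,
    fun q hq h0 => ?_, fun q hq h0 H hH => ?_, fun q hq h0 => ?_⟩
  · have h1 : ContDiff ℝ ∞ fun q : Space m n => q.fst :=
      (WithLp.fstL 2 ℝ (EuclideanSpace ℝ (Fin m)) (EuclideanSpace ℝ (Fin n))).contDiff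
    exact (contDiff_comp_norm hH hHe).comp h1
  · rw [(hG q hq h0).normSqA_eq, hr, hg.profileNormSqA_eq hμ h0, ← (hSg q).1 hq]
    simp only [mul_one, mul_zero, zero_sub, sub_zero, neg_div, neg_sq]
  · rw [(hG q hq h0).laplaceBeltrami_eq (hS.minimal.2 q hq) (H := H)
      (fun q _ => by simp only [hr]) ((hH.contDiffAt).of_le two_le_infty), hr]
    ring
  · obtain ⟨x, hx, -⟩ := exists_unit_inner_eq_zero hm 0
    have hq0 : q.fst = 0 := norm_eq_zero.1 h0
    have hg0 : ‖q.snd‖ = g 0 := by rw [(hSg q).1 hq, h0]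
    have hy : ‖(g 0)⁻¹ • q.snd‖ = 1 := by
      rw [norm_smul, hg0, norm_inv, Real.norm_eq_abs, abs_of_pos (hg.pos 0),
        inv_mul_cancel₀ (hg.pos 0).ne']
    have hf : ∀ t, ‖(planeMap x ((g 0)⁻¹ • q.snd) (t, g t)).fst‖ = |t| := fun t => by
      rw [planeMap_fst, norm_smul, hx, mul_one, Real.norm_eq_abs]
    -- The profile curve in a plane through q and a chosen direction x; it passes through q at t = 0
    -- and leaves the axis at once.
    refine ⟨fun t => planeMap x ((g 0)⁻¹ • q.snd) (t, g t),
      (planeMap x _).continuous.comp (continuous_id.prodMk hg.smooth.continuous),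
      Space.ext ?_ ?_, fun t => ?_, fun t ht => ?_⟩
    · rw [planeMap_fst, hq0, zero_smul]
    · rw [planeMap_snd, smul_inv_smul₀ (hg.pos 0).ne']
    · rw [hSg, hf, planeMap_snd, norm_smul, hy, mul_one, Real.norm_eq_abs, abs_of_pos (hg.pos t)]
      rcases abs_choice t with h | h <;> rw [h]
      rw [hg.even]
    · change 0 < ‖(planeMap x ((g 0)⁻¹ • q.snd) (t, g t)).fst‖
      rw [hf]
      exact abs_pos.2 ht.ne'

theorem isRotatedGraph_snd (hS : IsLawsonLeaf S) (hm : 2 ≤ m) (hn : 2 ≤ n) {α β : ℝ} {g : ℝ → ℝ}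
    (hg : IsProfileGraph ((n : ℝ) - 1) ((m : ℝ) - 1) α β g)
    (hSg : ∀ q, q ∈ S ↔ ‖q.fst‖ = g ‖q.snd‖) :
    IsRotatedGraph S ((n : ℝ) - 1) ((m : ℝ) - 1) (fun q => ‖q.snd‖) g := by
  have hμ : (0 : ℝ) < n - 1 := by
    have : (2 : ℝ) ≤ n := by exact_mod_cast hn
    linarith
  have hG : ∀ q ∈ S, 0 < ‖q.snd‖ → IsRadialGraphAt S (0, 1) (1, 0) g q := fun q hq h0 =>
    ⟨hq, norm_pos_iff.1 (by rw [(hSg q).1 hq]; exact hg.pos _), norm_pos_iff.1 h0,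
      isFrame_std.symm, (hg.smooth.contDiffAt).of_le two_le_infty,
      Eventually.of_forall fun q => by simp [radialCoord, hSg]⟩
  have hr : ∀ q : Space m n, radialCoord (0, 1) q = ‖q.snd‖ := fun q => by simp [radialCoord]
  refine ⟨hS.minimal.1, fun q => norm_nonneg _, fun H hH hHe => ?_, fun σ τ q => τ.norm_map _,
    fun q hq h0 => ?_, fun q hq h0 H hH => ?_, fun q hq h0 => ?_⟩
  · have h1 : ContDiff ℝ ∞ fun q : Space m n => q.snd :=
      (WithLp.sndL 2 ℝ (EuclideanSpace ℝ (Fin m)) (EuclideanSpace ℝ (Fin n))).contDiff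
    exact (contDiff_comp_norm hH hHe).comp h1
  · rw [(hG q hq h0).normSqA_eq, hr, hg.profileNormSqA_eq hμ h0, ← (hSg q).1 hq]
    simp only [mul_one, mul_zero, zero_sub, sub_zero, neg_div, neg_sq]
    ring
  · rw [(hG q hq h0).laplaceBeltrami_eq (hS.minimal.2 q hq) (H := H)
      (fun q _ => by simp only [hr]) ((hH.contDiffAt).of_le two_le_infty), hr]
    ring
  · obtain ⟨y, hy, -⟩ := exists_unit_inner_eq_zero hn 0
    have hq0 : q.snd = 0 := norm_eq_zero.1 h0
    have hg0 : ‖q.fst‖ = g 0 := by rw [(hSg q).1 hq, h0]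
    have hx : ‖(g 0)⁻¹ • q.fst‖ = 1 := by
      rw [norm_smul, hg0, norm_inv, Real.norm_eq_abs, abs_of_pos (hg.pos 0),
        inv_mul_cancel₀ (hg.pos 0).ne']
    have hf : ∀ t, ‖(planeMap ((g 0)⁻¹ • q.fst) y (g t, t)).snd‖ = |t| := fun t => by
      rw [planeMap_snd, norm_smul, hy, mul_one, Real.norm_eq_abs]
    refine ⟨fun t => planeMap ((g 0)⁻¹ • q.fst) y (g t, t),
      (planeMap _ y).continuous.comp (hg.smooth.continuous.prodMk continuous_id),
      Space.ext ?_ ?_, fun t => ?_, fun t ht => ?_⟩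
    · rw [planeMap_fst, smul_inv_smul₀ (hg.pos 0).ne']
    · rw [planeMap_snd, hq0, zero_smul]
    · rw [hSg, hf, planeMap_fst, norm_smul, hx, mul_one, Real.norm_eq_abs, abs_of_pos (hg.pos t)]
      rcases abs_choice t with h | h <;> rw [h]
      rw [hg.even]
    · change 0 < ‖(planeMap ((g 0)⁻¹ • q.fst) y (g t, t)).snd‖
      rw [hf]
      exact abs_pos.2 ht.ne'

end Rotated


end

/-! ### The two sides of the cone. -/

section

variable {m n : ℕ} {S : Set (Space m n)}

/-- In E⁺ the defining inequality becomes α|b| > β|a| in the plane, so the profile is a graph over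
the first axis. It determines S, since orbits are determined by the two norms. -/
theorem IsLawsonLeaf.exists_isRotatedGraph_fst (hm : 2 ≤ m) (hn : 2 ≤ n) (hS : IsLawsonLeaf S)
    (hside : S ⊆ coneSidePos m n) : ∃ g : ℝ → ℝ,
      IsProfileGraph ((m : ℝ) - 1) ((n : ℝ) - 1) (coneLeft m n) (coneRight m n) g ∧
      IsRotatedGraph S ((m : ℝ) - 1) ((n : ℝ) - 1) (fun q => ‖q.fst‖) g := by
  obtain ⟨x₀, hx, -⟩ := exists_unit_inner_eq_zero hm 0
  obtain ⟨y₀, hy, -⟩ := exists_unit_inner_eq_zero hn 0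
  have hP := hS.isProfile hm hn hx hy
  obtain ⟨g, hg, hΓ⟩ := hP.exists_graph_axis fun z hz => by
    have h1 : ((n : ℝ) - 1) * ‖(planeMap x₀ y₀ z).fst‖ ^ 2 <
      ((m : ℝ) - 1) * ‖(planeMap x₀ y₀ z).snd‖ ^ 2 := hside hz
    rw [planeMap_fst, planeMap_snd, norm_smul, norm_smul, hx, hy, mul_one, mul_one,
      Real.norm_eq_abs, Real.norm_eq_abs, ← mul_coneLeft_sq hm hn, ← mul_coneRight_sq hm hn,
      mul_assoc, mul_assoc, ← mul_pow, ← mul_pow] at h1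
    have h2 : (0 : ℝ) ≤ m + n - 2 := by
      have h1 : (2 : ℝ) ≤ m := by exact_mod_cast hm
      have h2 : (2 : ℝ) ≤ n := by exact_mod_cast hn
      linarith
    exact lt_of_pow_lt_pow_left₀ 2 (mul_nonneg (coneLeft_pos hm hn).le (abs_nonneg _))
      (lt_of_mul_lt_mul_left h1 h2)
  refine ⟨g, hg, isRotatedGraph_fst hS hm hn hg fun q => ?_⟩
  have h1 := hΓ ‖q.fst‖ ‖q.snd‖
  rw [abs_of_nonneg (norm_nonneg _)] at h1
  rw [← h1]
  exact hS.invariant.mem_iff_of_norm_eq (by rw [planeMap_fst, norm_smul, hx, mul_one, norm_norm])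
    (by rw [planeMap_snd, norm_smul, hy, mul_one, norm_norm])

/-- In E⁻ the inequality is reversed, and exchanging the axes of the profile restores it. -/
theorem IsLawsonLeaf.exists_isRotatedGraph_snd (hm : 2 ≤ m) (hn : 2 ≤ n) (hS : IsLawsonLeaf S)
    (hside : S ⊆ coneSideNeg m n) : ∃ g : ℝ → ℝ,
      IsProfileGraph ((n : ℝ) - 1) ((m : ℝ) - 1) (coneRight m n) (coneLeft m n) g ∧
      IsRotatedGraph S ((n : ℝ) - 1) ((m : ℝ) - 1) (fun q => ‖q.snd‖) g := by
  obtain ⟨x₀, hx, -⟩ := exists_unit_inner_eq_zero hm 0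
  obtain ⟨y₀, hy, -⟩ := exists_unit_inner_eq_zero hn 0
  have hP := (hS.isProfile hm hn hx hy).swap
  obtain ⟨g, hg, hΓ⟩ := hP.exists_graph_axis fun z hz => by
    have h1 : ((m : ℝ) - 1) * ‖(planeMap x₀ y₀ z.swap).snd‖ ^ 2 <
      ((n : ℝ) - 1) * ‖(planeMap x₀ y₀ z.swap).fst‖ ^ 2 := hside hz
    rw [planeMap_fst, planeMap_snd, norm_smul, norm_smul, hx, hy, mul_one, mul_one,
      Real.norm_eq_abs, Real.norm_eq_abs, ← mul_coneLeft_sq hm hn, ← mul_coneRight_sq hm hn,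
      mul_assoc, mul_assoc, ← mul_pow, ← mul_pow] at h1
    have h2 : (0 : ℝ) ≤ m + n - 2 := by
      have h1 : (2 : ℝ) ≤ m := by exact_mod_cast hm
      have h2 : (2 : ℝ) ≤ n := by exact_mod_cast hn
      linarith
    exact lt_of_pow_lt_pow_left₀ 2 (mul_nonneg (coneRight_pos hm hn).le (abs_nonneg _))
      (lt_of_mul_lt_mul_left h1 h2)
  refine ⟨g, hg, isRotatedGraph_snd hS hm hn hg fun q => ?_⟩
  have h1 := hΓ ‖q.snd‖ ‖q.fst‖
  rw [abs_of_nonneg (norm_nonneg _)] at h1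
  rw [← h1]
  exact hS.invariant.mem_iff_of_norm_eq (by simp [planeMap_fst, norm_smul, hx])
    (by simp [planeMap_snd, norm_smul, hy])


end

end JacobiToda

end

theorem theorem1p3 (m n : ℕ) (hm : 2 ≤ m) (hn : 2 ≤ n) (hmn : 8 ≤ m + n)
    (γ : ℝ) (hγ : 0 < γ) (k : ℕ) (hk : 1 ≤ k)
    (S : Set (Space m n)) (hS : IsLawsonLeaf S) :
    ∃ δs : ℝ, 0 < δs ∧ ∀ δ : ℝ, 0 < δ → δ ≤ δs →
      ∃ h : ℕ → Space m n → ℝ,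
        (∀ j, 1 ≤ j → j ≤ k → ContDiffOn ℝ ∞ (h j) S ∧ IsInvariantOn S (h j)) ∧
        SolvesJacobiToda S δ γ k h ∧
        (∀ j, 1 ≤ j → j < k → ∀ p ∈ S, h j p < h (j + 1) p) := by
  have hα := coneLeft_pos hm hn
  have hβ := coneRight_pos hm hn
  have hunit := coneLeft_sq_add_sq hm hn
  have hcone : ((n : ℝ) - 1) * coneLeft m n ^ 2 = ((m : ℝ) - 1) * coneRight m n ^ 2 := by
    rw [← mul_coneLeft_sq hm hn, ← mul_coneRight_sq hm hn]; ring
  -- The weight of the rotated sphere has to be a natural number, as it is the power of the dilation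
  -- variable in the singular integral.
  have hm1 : ((m - 1 : ℕ) : ℝ) = m - 1 := Nat.cast_pred (by omega)
  have hn1 : ((n - 1 : ℕ) : ℝ) = n - 1 := Nat.cast_pred (by omega)
  have hm0 : (0 : ℝ) < (m - 1 : ℕ) := Nat.cast_pos.2 (by omega)
  have hn0 : (0 : ℝ) < (n - 1 : ℕ) := Nat.cast_pos.2 (by omega)
  rw [← hm1, ← hn1] at hcone
  rcases hS.side with hside | hside
  · obtain ⟨g, hg, hr⟩ := hS.exists_isRotatedGraph_fst hm hn hside
    rw [← hm1, ← hn1] at hg hr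
    exact hr.exists_toda_solution hg hm0 hn0 hα hβ hunit hcone hγ hk
  · obtain ⟨g, hg, hr⟩ := hS.exists_isRotatedGraph_snd hm hn hside
    rw [← hm1, ← hn1] at hg hr
    exact hr.exists_toda_solution hg hn0 hm0 hβ hα (by rw [add_comm, hunit]) hcone.symm hγ hk
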